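/- **Theorem 2′.** Let $\mathbb X$ be a measurable space whose diagonal is measurable in $\mathbb X\times\mathbb X$ (for instance a standard Borel space), let $H$ be a nonatomic probability measure on $\mathbb X$, and let $\lambda:(0,\infty)\to[0,\infty]$ be measurable with $\int_0^\infty(1-e^{-w})\lambda(w)\,dw<\infty$ and $\int_0^\infty\lambda(w)\,dw=\infty$. Write $\mathrm{CRM}(\lambda,H)$ for the law of the homogeneous completely random measure $\sum_j w_j\delta_{X_j}$, where the points $(w_j,X_j)$ form a Poisson process on $(0,\infty)\times\mathbb X$ with mean measure $\lambda(w)\,dw\,H(dx)$. Let $G\sim\mathrm{CRM}(\lambda,H)$ and let $L,m\ge 0$ be integers. Given $G$, let $Y_\ell=(Y_{\ell1},\dots,Y_{\ell m})$, $\ell=1,\dots,L$, be independent Plackett–Luce lists of distinct items, $$P(Y_\ell\mid G)=\prod_{i=1}^m\frac{G(\{Y_{\ell i}\})}{G(\mathbb X\setminus\{Y_{\ell1},\dots,Y_{\ell\,i-1}\})},$$ and, given $G$ and $(Y_\ell)_\ell$, let the latent variables $Z_{\ell i}$ be independent with $Z_{\ell i}\sim\mathrm{Exp}\big(G(\mathbb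 X\setminus\{Y_{\ell1},\dots,Y_{\ell\,i-1}\})\big)$. Let $X_1^*,\dots,X_K^*$ be the distinct items occurring in the $L$ lists, $n_k$ the number of occurrences of $X_k^*$, and $\delta_{\ell ik}=0$ if $Y_{\ell j}=X_k^*$ for some $j<i$ and $\delta_{\ell ik}=1$ otherwise. Then, for almost every value of the observations and latent variables, a (regular) conditional law of $G$ given $(Y_\ell,Z_\ell)_{\ell=1}^L$ is the law of $$G^*+\sum_{k=1}^K w_k^*\,\delta_{X_k^*},$$ where $G^*,w_1^*,\dots,w_K^*$ are mutually independent, $G^*\sim\mathrm{CRM}(\lambda^*,H)$ with $\lambda^*(w)=\lambda(w)e^{-w\sum_{\ell,i}Z_{\ell i}}$ (which satisfies the same two integral conditions as $\lambda$), and $w_k^*$ has the density on $(0,\infty)$ $$\frac{w^{n_k}\,e^{-w\sum_{\ell,i}\delta_{\ell ik}Z_{\ell i}}\,\lambda(w)}{\kappa\big(n_k,\sum_{\ell,i}\delta_{\ell ik}Z_{\ell i}\big)},\qquad \kappa(n,z)=\int_0^\infty w^n e^{-zw}\lambda(w)\,dw .$$ -/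

import Mathlib

open MeasureTheory ProbabilityTheory Set
open scoped ENNReal

noncomputable section

namespace PlackettLuce

/-! ### Poisson processes and homogeneous completely random measures -/

/-- `Q` is the law of a Poisson process (Poisson random measure) with mean measure `ν` on `S`:
the number of points in `B` is Poisson with mean `ν B` (and is a.s. infinite if `ν B = ∞`), and
the numbers of points in pairwise disjoint sets are independent. -/
structure IsPoissonProcessLaw {S : Type*} [MeasurableSpace S] (ν : Measure S)
    (Q : Measure (Measure S)) : Prop where
  isProbabilityMeasure : IsProbabilityMeasure Q
  map_apply_of_ne_top : ∀ B : Set S, MeasurableSet B → ν B ≠ ∞ →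
    Q.map (fun N : Measure S => N B) =
      (poissonMeasure (ν B).toNNReal).map (fun n : ℕ => (n : ℝ≥0∞))
  ae_eq_top : ∀ B : Set S, MeasurableSet B → ν B = ∞ → ∀ᵐ N ∂Q, N B = ∞
  iIndepFun_apply : ∀ (n : ℕ) (B : Fin n → Set S), (∀ i, MeasurableSet (B i)) →
    (Pairwise fun i j => Disjoint (B i) (B j)) →
      iIndepFun (fun (i : Fin n) (N : Measure S) => N (B i)) Q

/-- The measure `λ(w) dw` on `(0, ∞)`, as a measure on `ℝ`. -/
def jumpMeasure (lam : ℝ → ℝ≥0∞) : Measure ℝ :=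
  (volume.restrict (Ioi 0)).withDensity lam

/-- The random measure `∑ⱼ wⱼ δ_{Xⱼ}` built from the point measure `N = ∑ⱼ δ_{(wⱼ, Xⱼ)}`,
that is, `B ↦ ∫ w 1_B(x) N(dw, dx)`. -/
def massMeasure {X : Type*} [MeasurableSpace X] (N : Measure (ℝ × X)) : Measure X :=
  (N.withDensity fun p => ENNReal.ofReal p.1).map Prod.snd

/-- The conditions on the jump part `λ` of the Lévy intensity of a homogeneous CRM that make the
CRM a normalisable random measure with infinitely many atoms. -/
structure IsLevyIntensity (lam : ℝ → ℝ≥0∞) : Prop where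
  measurable : Measurable lam
  lintegral_lt_top : ∫⁻ w in Ioi (0 : ℝ), ENNReal.ofReal (1 - Real.exp (-w)) * lam w < ∞
  lintegral_eq_top : ∫⁻ w in Ioi (0 : ℝ), lam w = ∞

/-- `R` is the law `CRM(λ, H)` of the homogeneous completely random measure `∑ⱼ wⱼ δ_{Xⱼ}`, where
the points `(wⱼ, Xⱼ)` form a Poisson process on `(0, ∞) × X` with mean measure `λ(w) dw H(dx)`. -/
def IsCRMLaw {X : Type*} [MeasurableSpace X] (lam : ℝ → ℝ≥0∞) (H : Measure X)
    (R : Measure (Measure X)) : Prop :=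
  IsLevyIntensity lam ∧ ∃ Q : Measure (Measure (ℝ × X)),
    IsPoissonProcessLaw ((jumpMeasure lam).prod H) Q ∧ R = Q.map massMeasure

/-! ### Conditional laws and the Plackett--Luce model -/

/-- `U` has a regular conditional distribution given `V` whose value at `b` satisfies `p b`
for almost every value `b` of `V`. -/
def HasCondLaw {Ω α β : Type*} [MeasurableSpace Ω] [MeasurableSpace α] [MeasurableSpace β]
    (U : Ω → α) (V : Ω → β) (P : Measure Ω) (p : β → Measure α → Prop) : Prop :=
  ∃ κ : Kernel β α, IsMarkovKernel κ ∧ HasCondDistrib U V κ P ∧ ∀ᵐ b ∂(P.map V), p b (κ b)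

/-- The items still available at stage `i` of the list `y`. -/
def remaining {X : Type*} {m : ℕ} (y : Fin m → X) (i : Fin m) : Set X :=
  {x | ∀ j < i, y j ≠ x}

open Classical in
/-- The Plackett--Luce law of a top-`m` list given `g`: at stage `i` the item `yᵢ` is drawn from
the restriction of `g` to the items not yet drawn, normalised. For a finite measure `g`, a list
`y` of distinct items has probability `∏ᵢ g {yᵢ} / g (X ∖ {y₁, …, yᵢ₋₁})`. -/
def plMeasure {X : Type*} [MeasurableSpace X] (g : Measure X) (m : ℕ) : Measure (Fin m → X) :=
  (Measure.pi fun _ : Fin m => g).withDensity fun y =>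
    if Function.Injective y then ∏ i, (g (remaining y i))⁻¹ else 0

/-- The law of the latent inter-arrival times of a list `y` given `g`: independent, the `i`-th
being exponential with rate `g (X ∖ {y₁, …, yᵢ₋₁})`. -/
def arrivalMeasure {X : Type*} [MeasurableSpace X] (g : Measure X) {m : ℕ} (y : Fin m → X) :
    Measure (Fin m → ℝ) :=
  Measure.pi fun i => expMeasure (g.real (remaining y i))

/-! ### Statistics of the observations -/

open Classical in
/-- The unique items among all the lists. -/
def uniqueItems {X : Type*} {L m : ℕ} (y : Fin L → Fin m → X) : Finset X :=
  Finset.univ.image fun p : Fin L × Fin m => y p.1 p.2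

open Classical in
/-- The number of occurrences of the item `x` among the lists. -/
def occurrences {X : Type*} {L m : ℕ} (y : Fin L → Fin m → X) (x : X) : ℕ :=
  (Finset.univ.filter fun p : Fin L × Fin m => y p.1 p.2 = x).card

open Classical in
/-- The occurrence indicator: `0` if `x` occurs in list `l` before stage `i`, and `1` otherwise. -/
def occIndicator {X : Type*} {L m : ℕ} (y : Fin L → Fin m → X) (l : Fin L) (i : Fin m) (x : X) :
    ℝ :=
  if ∃ j < i, y l j = x then 0 else 1

/-- `∑_{l,i} Z_{l,i}`. -/
def totalTime {L m : ℕ} (z : Fin L → Fin m → ℝ) : ℝ :=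
  ∑ l, ∑ i, z l i

/-- `∑_{l,i} δ_{l,i}(x) Z_{l,i}`. -/
def itemTime {X : Type*} {L m : ℕ} (y : Fin L → Fin m → X) (z : Fin L → Fin m → ℝ) (x : X) : ℝ :=
  ∑ l, ∑ i, occIndicator y l i x * z l i

/-! ### The posterior law -/

/-- The exponentially tilted intensity `λ(w) e^{-ws}`. -/
def tilt (lam : ℝ → ℝ≥0∞) (s : ℝ) : ℝ → ℝ≥0∞ :=
  fun w => lam w * ENNReal.ofReal (Real.exp (-(w * s)))

/-- The moment function `κ(n, s) = ∫₀^∞ w^n e^{-ws} λ(w) dw`. -/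
def kappa (lam : ℝ → ℝ≥0∞) (n : ℕ) (s : ℝ) : ℝ≥0∞ :=
  ∫⁻ w in Ioi (0 : ℝ), ENNReal.ofReal (w ^ n * Real.exp (-(w * s))) * lam w

/-- The law on `(0, ∞)` with density `w^n e^{-ws} λ(w) / κ(n, s)`. -/
def massLaw (lam : ℝ → ℝ≥0∞) (n : ℕ) (s : ℝ) : Measure ℝ :=
  (volume.restrict (Ioi 0)).withDensity fun w =>
    ENNReal.ofReal (w ^ n * Real.exp (-(w * s))) * lam w / kappa lam n s

/-- `R` is the law of `G* + ∑ₓ wₓ δₓ`, the sum running over the unique items `x` of the lists `y`,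
where `G*` and the `wₓ` are mutually independent, `G* ∼ CRM(λ*, H)` with
`λ*(w) = λ(w) e^{-w ∑ Z}`, and `wₓ` has law `massLaw` with the number of occurrences of `x` and
the sum `∑ δ(x) Z`. -/
def IsPosteriorLaw {X : Type*} [MeasurableSpace X] {L m : ℕ} (lam : ℝ → ℝ≥0∞) (H : Measure X)
    (y : Fin L → Fin m → X) (z : Fin L → Fin m → ℝ) (R : Measure (Measure X)) : Prop :=
  ∃ Rstar : Measure (Measure X), IsCRMLaw (tilt lam (totalTime z)) H Rstar ∧
    R = (Rstar.prod (Measure.pi fun x : uniqueItems y =>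
          massLaw lam (occurrences y x) (itemTime y z x))).map
        fun p => p.1 + ∑ x : uniqueItems y, ENNReal.ofReal (p.2 x) • Measure.dirac (x : X)

end PlackettLuce

end

namespace PlackettLuce

noncomputable section

open scoped NNReal BoundedContinuousFunction
open Filter Topology

/-! ### The function `e^{-x}` on `[0, ∞]` -/

/-! The theorem is Bayes' rule, with the Palm formula playing the part of the change of measure.

Each latent time has density `r e^{-rz}` with rate `r` equal to the denominator of the matching
Plackett–Luce factor. The two cancel (`inv_mul_exponentialPDF`), so lists and times together behave
like independent draws from the unnormalised measure `G`, weighted by the exponential of a linear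
function of `G` (`timeDensity`).

The Palm formula (`IsCRMLaw.palm`) replaces a point drawn from `G` by a point `(w, x)` drawn from `w
λ(w) dw H(dx)`, and `G` by an independent copy to which `w δ_x` is added. Iterating it
(`IsCRMLaw.atomLIntegral_lintegral`), a further draw is either new, because `H` has no atoms, or it
repeats an item and raises the exponent of its weight by one. After all draws the random measure is
`G + ∑ w_k δ_{X_k}`, with `w_k` integrated against `w^{n_k} λ(w) dw`. On such a measure the weight
factorises (`timeDensity_add_atomSum`): one factor depends on `G(X)` only and tilts the CRM
(`IsCRMLaw.tiltLaw`), the others tilt the individual `w_k` and are normalised by `κ`. This is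
`IsCRMLaw.atomLIntegral_timeDensity_mul`.

The marginal law of the lists is never computed. `IsCRMLaw.exists_functional` only records that
expectations depend on the integrand through its integral over `G` with the listed items as fixed
atoms; the two sides of the disintegration are then compared for each `y` and almost every `z`.

Identities for Poisson processes and CRMs are proved through Laplace functionals, which determine
the law of a random measure (`ext_of_laplace`); the Palm formula is a directional derivative of one.
Taking `e^{-x}` on all of `[0, ∞]` removes integrability conditions. Measurability of the posterior
in the data needs a separate argument, since the number of atoms varies with the lists
(`IsLevyIntensity.measurable_atomLIntegral`). -/

/-- The function `x ↦ e^{-x}` on `[0, ∞]`. -/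
def negExp (x : ℝ≥0∞) : ℝ≥0∞ := EReal.exp (-(x : EReal))

@[simp] lemma negExp_zero : negExp 0 = 1 := by simp [negExp]

@[simp] lemma negExp_top : negExp ∞ = 0 := by simp [negExp]

lemma negExp_add (x y : ℝ≥0∞) : negExp (x + y) = negExp x * negExp y := by
  unfold negExp
  rw [EReal.exp_neg, EReal.exp_neg, EReal.exp_neg, EReal.coe_ennreal_add, EReal.exp_add,
    ENNReal.mul_inv]
  · exact Or.inl (by simp [EReal.exp_eq_zero_iff])
  · exact Or.inr (by simp [EReal.exp_eq_zero_iff])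

lemma negExp_ofReal {x : ℝ} (hx : 0 ≤ x) :
    negExp (ENNReal.ofReal x) = ENNReal.ofReal (Real.exp (-x)) := by
  rw [negExp, EReal.coe_ennreal_ofReal, max_eq_left hx, ← EReal.coe_neg, EReal.exp_coe]

lemma negExp_antitone : Antitone negExp := fun x y h => by
  unfold negExp
  simpa [EReal.exp_le_exp_iff] using h

lemma negExp_le_one (x : ℝ≥0∞) : negExp x ≤ 1 := by
  simpa using negExp_antitone (zero_le (a := x))

lemma negExp_ne_top (x : ℝ≥0∞) : negExp x ≠ ∞ := ne_top_of_le_ne_top (by simp) (negExp_le_one x)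

lemma negExp_eq_zero_iff {x : ℝ≥0∞} : negExp x = 0 ↔ x = ∞ := by
  simp [negExp]

lemma negExp_lt_one_iff {x : ℝ≥0∞} : negExp x < 1 ↔ 0 < x := by
  simp [negExp]

lemma negExp_strictAnti : StrictAnti negExp := fun x y h => by
  unfold negExp
  simpa [EReal.exp_lt_exp_iff] using h

lemma continuous_negExp : Continuous negExp := by
  have h : Continuous EReal.exp := EReal.expHomeomorph.continuous
  exact h.comp (continuous_neg.comp continuous_coe_ennreal_ereal)

@[fun_prop]
lemma measurable_negExp : Measurable negExp := continuous_negExp.measurable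

lemma measurable_negExp_comp {α : Type*} [MeasurableSpace α] {f : α → ℝ≥0∞} (hf : Measurable f) :
    Measurable fun x => negExp (f x) := measurable_negExp.comp hf

lemma negExp_sum {ι : Type*} (s : Finset ι) (f : ι → ℝ≥0∞) :
    negExp (∑ i ∈ s, f i) = ∏ i ∈ s, negExp (f i) := by
  classical
  induction s using Finset.induction_on with
  | empty => simp
  | insert a s ha ih => rw [Finset.sum_insert ha, Finset.prod_insert ha, negExp_add, ih]

/-! ### Uniqueness of Laplace transforms -/

/-- A finite measure on `[0, ∞]^ι` is determined by its Laplace transform. -/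
lemma ext_of_lintegral_prod_negExp {ι : Type*} [Fintype ι] {μ ν : Measure (ι → ℝ≥0∞)}
    [IsFiniteMeasure μ] [IsFiniteMeasure ν]
    (h : ∀ t : ι → ℕ, ∫⁻ x, ∏ i, negExp (t i * x i) ∂μ = ∫⁻ x, ∏ i, negExp (t i * x i) ∂ν) :
    μ = ν := by
  let e (t : ι → ℕ) : (ι → ℝ≥0∞) →ᵇ ℝ :=
    BoundedContinuousFunction.mkOfCompact
      ⟨fun x => (∏ i, negExp (t i * x i)).toReal, by
        refine continuous_iff_continuousAt.2 fun x => ?_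
        refine (ENNReal.continuousAt_toReal ?_).comp ?_
        · exact ENNReal.prod_ne_top fun i _ => negExp_ne_top _
        · refine Continuous.continuousAt ?_
          have : ∀ i : ι, Continuous fun x : ι → ℝ≥0∞ => (negExp (t i * x i)).toReal := fun i =>
            ENNReal.continuousOn_toReal.comp_continuous
              (continuous_negExp.comp
                ((ENNReal.continuous_const_mul (ENNReal.natCast_ne_top _)).comp
                  (continuous_apply i))) fun x => negExp_ne_top _
          have h2 : Continuous fun x : ι → ℝ≥0∞ =>
              ENNReal.ofReal (∏ i, (negExp (t i * x i)).toReal) :=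
            ENNReal.continuous_ofReal.comp (continuous_finsetProd _ fun i _ => this i)
          refine h2.congr fun x => ?_
          rw [← ENNReal.toReal_prod, ENNReal.ofReal_toReal]
          exact ENNReal.prod_ne_top fun i _ => negExp_ne_top _⟩
  have he : ∀ t x, e t x = (∏ i, negExp (t i * x i)).toReal := fun t x => rfl
  have hint : ∀ t, ∫ x, e t x ∂μ = ∫ x, e t x ∂ν := fun t => by
    have hm : Measurable fun x : ι → ℝ≥0∞ => ∏ i, negExp (t i * x i) := by fun_prop
    simp_rw [he]
    rw [integral_toReal hm.aemeasurable, integral_toReal hm.aemeasurable, h]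
    all_goals exact ae_of_all _ fun x =>
      (ENNReal.prod_ne_top fun i _ => negExp_ne_top _).lt_top
  -- Products of these exponentials are again of the same form, so the algebra they generate is
  -- merely their linear span, and equality of integrals extends to it by linearity.
  let M : Submonoid ((ι → ℝ≥0∞) →ᵇ ℝ) :=
    { carrier := Set.range e
      one_mem' := ⟨0, by ext x; simp [he]⟩
      mul_mem' := by
        rintro _ _ ⟨s, rfl⟩ ⟨t, rfl⟩
        refine ⟨s + t, ?_⟩
        ext x
        simp [he, add_mul, negExp_add, Finset.prod_mul_distrib] }
  let A : StarSubalgebra ℝ ((ι → ℝ≥0∞) →ᵇ ℝ) :=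
    { Algebra.adjoin ℝ (M : Set ((ι → ℝ≥0∞) →ᵇ ℝ)) with
      star_mem' := fun {a} ha => by
        have : star a = a := by ext x; simp
        rw [this]; exact ha }
  refine ext_of_forall_mem_subalgebra_integral_eq_of_polish (𝕜 := ℝ) (A := A) ?_ ?_
  · intro x y hxy
    obtain ⟨i, hi⟩ := Function.ne_iff.1 hxy
    classical
    refine ⟨e (Pi.single i 1), ⟨_, ⟨e (Pi.single i 1), Algebra.subset_adjoin ⟨_, rfl⟩, rfl⟩, rfl⟩,
      ?_⟩
    rw [he, he]
    have h1 : ∀ z : ι → ℝ≥0∞, ∏ j, negExp ((Pi.single i 1 : ι → ℕ) j * z j) = negExp (z i) := by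
      intro z
      rw [Finset.prod_eq_single i]
      · simp
      · intro j _ hj; simp [Pi.single_eq_of_ne hj]
      · simp
    rw [h1, h1]
    intro h2
    exact hi (negExp_strictAnti.injective
      ((ENNReal.toReal_eq_toReal_iff' (negExp_ne_top _) (negExp_ne_top _)).1 h2))
  · intro g hg
    have hg' : g ∈ Submodule.span ℝ (M : Set ((ι → ℝ≥0∞) →ᵇ ℝ)) := by
      have h1 : g ∈ Subalgebra.toSubmodule (Algebra.adjoin ℝ (M : Set ((ι → ℝ≥0∞) →ᵇ ℝ))) := hg
      rwa [Algebra.adjoin_eq_span, Submonoid.closure_eq] at h1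
    clear hg
    induction hg' using Submodule.span_induction with
    | mem g hg => obtain ⟨t, rfl⟩ := hg; exact hint t
    | zero => simp
    | add f g hf hg h1 h2 =>
      simp only [BoundedContinuousFunction.coe_add, Pi.add_apply]
      rw [integral_add (f.integrable _) (g.integrable _),
        integral_add (f.integrable _) (g.integrable _), h1, h2]
    | smul c f hf h1 =>
      simp only [BoundedContinuousFunction.coe_smul, smul_eq_mul]
      rw [integral_const_mul, integral_const_mul, h1]

/-- A finite law of a random measure is determined by its Laplace functional. -/
lemma ext_of_laplace {S : Type*} [MeasurableSpace S] {μ ν : Measure (Measure S)}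
    [IsFiniteMeasure μ] [IsFiniteMeasure ν]
    (h : ∀ f : S → ℝ≥0∞, Measurable f →
      ∫⁻ N, negExp (∫⁻ x, f x ∂N) ∂μ = ∫⁻ N, negExp (∫⁻ x, f x ∂N) ∂ν) : μ = ν := by
  let φ : Measure S → ({B : Set S // MeasurableSet B} → ℝ≥0∞) := fun N B => N B.1
  have hφ : Measurable φ := measurable_pi_lambda _ fun B => Measure.measurable_coe B.2
  have hmap : μ.map φ = ν.map φ := by
    -- A finite measure on the product over all measurable sets is determined by its
    -- finite-dimensional marginals, and to those the finite Laplace transform applies.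
    refine IsProjectiveLimit.unique (P := fun J => (ν.map φ).map J.restrict) ?_ fun J => rfl
    intro J
    have hJ := Finset.measurable_restrict (X := fun _ : {B : Set S // MeasurableSet B} => ℝ≥0∞) J
    change (μ.map φ).map J.restrict = (ν.map φ).map J.restrict
    rw [Measure.map_map hJ hφ, Measure.map_map hJ hφ]
    refine ext_of_lintegral_prod_negExp fun t => ?_
    have hm : Measurable fun x : J → ℝ≥0∞ => ∏ i, negExp (t i * x i) := by fun_prop
    rw [lintegral_map hm (hJ.comp hφ), lintegral_map hm (hJ.comp hφ)]
    have hf : Measurable fun x => ∑ i : J, (t i : ℝ≥0∞) * (i.1.1).indicator 1 x := by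
      refine Finset.measurable_sum _ fun i _ => ?_
      exact (measurable_one.indicator i.1.2).const_mul _
    have key : ∀ N : Measure S, ∏ i, negExp (t i * (J.restrict ∘ φ) N i) =
        negExp (∫⁻ x, ∑ i : J, (t i : ℝ≥0∞) * (i.1.1).indicator 1 x ∂N) := fun N => by
      rw [lintegral_finsetSum _ fun i _ => (measurable_one.indicator i.1.2).const_mul _,
        negExp_sum]
      refine Finset.prod_congr rfl fun i _ => ?_
      rw [lintegral_const_mul _ (measurable_one.indicator i.1.2), lintegral_indicator_one i.1.2]
      rfl
    simp_rw [key]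
    exact h _ hf
  ext A hA
  -- The σ-algebra on measures is generated by the evaluations, so every event is a preimage under
  -- `φ`; nothing about the image of `φ` is needed.
  have hle : (Measure.instMeasurableSpace : MeasurableSpace (Measure S)) ≤
      MeasurableSpace.comap φ inferInstance := by
    refine iSup_le fun B => iSup_le fun hB => ?_
    rintro _ ⟨s, hs, rfl⟩
    exact ⟨(fun g => g ⟨B, hB⟩) ⁻¹' s, measurable_pi_apply _ hs, rfl⟩
  obtain ⟨A', hA', rfl⟩ := hle A hA
  rw [← Measure.map_apply hφ hA', hmap, Measure.map_apply hφ hA']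

/-! ### Products of measures -/

lemma lintegral_pi_prod {ι : Type*} [Fintype ι] {E : ι → Type*} [∀ i, MeasurableSpace (E i)]
    (μ : ∀ i, Measure (E i)) [∀ i, SigmaFinite (μ i)] (f : ∀ i, E i → ℝ≥0∞)
    (hf : ∀ i, Measurable (f i)) :
    ∫⁻ x, ∏ i, f i (x i) ∂Measure.pi μ = ∏ i, ∫⁻ x, f i x ∂μ i := by
  classical
  by_cases hne : Nonempty (∀ i, E i)
  · obtain ⟨x₀⟩ := hne
    have key : ∀ s : Finset ι, (∫⋯∫⁻_s, (fun x => ∏ i ∈ s, f i (x i)) ∂μ) =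
        fun _ => ∏ i ∈ s, ∫⁻ x, f i x ∂μ i := by
      intro s
      induction s using Finset.induction_on with
      | empty => simp
      | insert a s ha ih =>
        rw [lmarginal_insert' _ (by fun_prop) ha]
        have h1 : (fun x : ∀ i, E i => ∫⁻ y, ∏ i ∈ insert a s, f i (Function.update x a y i) ∂μ a) =
            fun x => (∫⁻ y, f a y ∂μ a) * ∏ i ∈ s, f i (x i) := by
          ext x
          rw [← lintegral_mul_const _ (hf a)]
          refine lintegral_congr fun y => ?_
          rw [Finset.prod_insert ha, Function.update_self]
          congr 1
          refine Finset.prod_congr rfl fun i hi => ?_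
          rw [Function.update_of_ne (ne_of_mem_of_not_mem hi ha)]
        rw [h1]
        ext x
        have h2 := congrFun ih x
        simp only [lmarginal] at h2 ⊢
        rw [lintegral_const_mul _ (by fun_prop), h2, Finset.prod_insert ha]
    rw [lintegral_eq_lmarginal_univ x₀, key]
  -- Marginal integrals need a base point. Without one, some factor space is empty and both sides
  -- vanish.
  · have : IsEmpty (∀ i, E i) := not_nonempty_iff.1 hne
    obtain ⟨i, hi⟩ : ∃ i, IsEmpty (E i) := by
      by_contra! h
      exact hne ⟨fun i => (h i).some⟩
    rw [lintegral_of_isEmpty, Finset.prod_eq_zero (Finset.mem_univ i)]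
    exact lintegral_of_isEmpty _ _

lemma pi_withDensity {ι : Type*} [Fintype ι] {E : ι → Type*} [∀ i, MeasurableSpace (E i)]
    (μ : ∀ i, Measure (E i)) [∀ i, SigmaFinite (μ i)] (f : ∀ i, E i → ℝ≥0∞)
    (hf : ∀ i, Measurable (f i)) [∀ i, SigmaFinite ((μ i).withDensity (f i))] :
    Measure.pi (fun i => (μ i).withDensity (f i)) =
      (Measure.pi μ).withDensity fun x => ∏ i, f i (x i) := by
  classical
  refine Measure.pi_eq fun s hs => ?_
  rw [withDensity_apply _ (MeasurableSet.univ_pi hs), ← lintegral_indicator (MeasurableSet.univ_pi hs)]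
  have h1 : (univ.pi s).indicator (fun x : ∀ i, E i => ∏ i, f i (x i)) =
      fun x => ∏ i, (s i).indicator (f i) (x i) := by
    ext x
    by_cases hx : x ∈ univ.pi s
    · rw [indicator_of_mem hx]
      exact Finset.prod_congr rfl fun i _ => (indicator_of_mem (hx i (mem_univ i)) _).symm
    · rw [indicator_of_notMem hx]
      simp only [Set.mem_pi, mem_univ, true_implies, not_forall] at hx
      obtain ⟨i, hi⟩ := hx
      exact (Finset.prod_eq_zero (Finset.mem_univ i) (indicator_of_notMem hi _)).symm
  rw [h1, lintegral_pi_prod μ _ fun i => (hf i).indicator (hs i)]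
  refine Finset.prod_congr rfl fun i _ => ?_
  rw [withDensity_apply _ (hs i), lintegral_indicator (hs i)]

/-! ### The Laplace functional of a Poisson process -/

/-- This is the probability generating function, summed by the exponential series. -/
lemma lintegral_poissonMeasure_pow (r : ℝ≥0) {u : ℝ≥0∞} (hu : u ≤ 1) :
    ∫⁻ n, u ^ n ∂poissonMeasure r = negExp (r * (1 - u)) := by
  lift u to ℝ≥0 using ne_top_of_le_ne_top (by simp) hu
  have hu' : u ≤ 1 := by exact_mod_cast hu
  have hu'' : (u : ℝ) ≤ 1 := by exact_mod_cast hu'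
  rw [poissonMeasure, lintegral_sum_measure]
  have h1 : ∀ n : ℕ, ∫⁻ k, (u : ℝ≥0∞) ^ k
      ∂(ENNReal.ofReal (Real.exp (-r) * r ^ n / n.factorial) • Measure.dirac n) =
      ENNReal.ofReal (Real.exp (-r) * ((r * u : ℝ) ^ n / n.factorial)) := fun n => by
    rw [lintegral_smul_measure, lintegral_dirac, smul_eq_mul, ← ENNReal.ofReal_coe_nnreal,
      ← ENNReal.ofReal_pow (by positivity), ← ENNReal.ofReal_mul (by positivity)]
    congr 1
    ring
  simp_rw [h1]
  have h2 : HasSum (fun n : ℕ => Real.exp (-r) * ((r * u : ℝ) ^ n / n.factorial))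
      (Real.exp (-r) * Real.exp (r * u)) := by
    rw [Real.exp_eq_exp_ℝ]
    exact (NormedSpace.expSeries_div_hasSum_exp (r * u : ℝ)).mul_left _
  rw [← ENNReal.ofReal_tsum_of_nonneg (fun n => by positivity) h2.summable, h2.tsum_eq,
    ← Real.exp_add]
  have h3 : (r : ℝ≥0∞) * (1 - u) = ENNReal.ofReal (r * (1 - u)) := by
    rw [ENNReal.ofReal_mul (by positivity), ENNReal.ofReal_sub _ (by positivity)]
    simp
  rw [h3, negExp_ofReal (mul_nonneg (by positivity) (by linarith))]
  congr 2
  ring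

lemma negExp_mul_natCast (c : ℝ≥0∞) (n : ℕ) : negExp (c * n) = negExp c ^ n := by
  have := negExp_sum (Finset.range n) fun _ => c
  simpa [mul_comm] using this

lemma one_sub_negExp_eq_zero_iff {c : ℝ≥0∞} : 1 - negExp c = 0 ↔ c = 0 := by
  rw [tsub_eq_zero_iff_le]
  constructor
  · intro h
    by_contra hc
    exact absurd h (not_le.2 (negExp_lt_one_iff.2 (pos_iff_ne_zero.2 hc)))
  · rintro rfl; simp

lemma IsPoissonProcessLaw.lintegral_negExp_apply {S : Type*} [MeasurableSpace S] {ν : Measure S}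
    {Q : Measure (Measure S)} (hQ : IsPoissonProcessLaw ν Q) {B : Set S} (hB : MeasurableSet B)
    (c : ℝ≥0∞) : ∫⁻ N, negExp (c * N B) ∂Q = negExp (ν B * (1 - negExp c)) := by
  have := hQ.isProbabilityMeasure
  have hm : Measurable fun N : Measure S => N B := Measure.measurable_coe hB
  by_cases hν : ν B = ∞
  · rw [hν]
    rcases eq_or_ne c 0 with rfl | hc
    · simp
    · rw [ENNReal.top_mul (by rwa [Ne, one_sub_negExp_eq_zero_iff]), negExp_top,
        lintegral_eq_zero_iff (measurable_negExp_comp (hm.const_mul c))]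
      filter_upwards [hQ.ae_eq_top B hB hν] with N hN
      simp [hN, ENNReal.mul_top hc]
  · have h1 : ∫⁻ N, negExp (c * N B) ∂Q = ∫⁻ x, negExp (c * x) ∂(Q.map fun N => N B) := by
      rw [lintegral_map (by fun_prop) hm]
    rw [h1, hQ.map_apply_of_ne_top B hB hν, lintegral_map (by fun_prop) (by fun_prop)]
    simp_rw [negExp_mul_natCast]
    rw [lintegral_poissonMeasure_pow _ (negExp_le_one c), ENNReal.coe_toNNReal hν]

/-- For simple functions the counts on the level sets are independent and the expectation is a
product of Poisson generating functions. The general case follows by increasing approximation, since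
`negExp` is continuous on `[0, ∞]`. -/
lemma IsPoissonProcessLaw.laplace {S : Type*} [MeasurableSpace S] {ν : Measure S}
    {Q : Measure (Measure S)} (hQ : IsPoissonProcessLaw ν Q) {f : S → ℝ≥0∞} (hf : Measurable f) :
    ∫⁻ N, negExp (∫⁻ x, f x ∂N) ∂Q = negExp (∫⁻ x, (1 - negExp (f x)) ∂ν) := by
  have := hQ.isProbabilityMeasure
  have simple : ∀ g : SimpleFunc S ℝ≥0∞,
      ∫⁻ N, negExp (∫⁻ x, g x ∂N) ∂Q = negExp (∫⁻ x, (1 - negExp (g x)) ∂ν) := by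
    intro g
    have h1 : ∫⁻ x, (1 - negExp (g x)) ∂ν =
        ∑ c ∈ g.range, (1 - negExp c) * ν (g ⁻¹' {c}) := by
      rw [← SimpleFunc.map_lintegral (fun c => 1 - negExp c), ← SimpleFunc.lintegral_eq_lintegral]
      rfl
    have h2 : ∀ N : Measure S, negExp (∫⁻ x, g x ∂N) =
        ∏ c ∈ g.range, negExp (c * N (g ⁻¹' {c})) := fun N => by
      rw [SimpleFunc.lintegral_eq_lintegral, SimpleFunc.lintegral, negExp_sum]
    simp_rw [h1, h2]
    rw [negExp_sum]
    let e := g.range.equivFin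
    let B : Fin g.range.card → Set S := fun i => g ⁻¹' {((e.symm i : g.range) : ℝ≥0∞)}
    have hB : ∀ i, MeasurableSet (B i) := fun i => g.measurableSet_preimage _
    have hd : Pairwise fun i j => Disjoint (B i) (B j) := fun i j hij => by
      refine Disjoint.preimage _ (disjoint_singleton.2 fun h => hij ?_)
      exact e.symm.injective (Subtype.ext h)
    have hr : ∀ φ : ℝ≥0∞ → ℝ≥0∞, ∏ c ∈ g.range, φ c = ∏ i, φ (e.symm i : g.range) := fun φ => by
      rw [← Finset.prod_coe_sort, ← e.symm.prod_comp]
    simp_rw [hr]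
    have hi := hQ.iIndepFun_apply _ B hB hd
    have hi' : iIndepFun (fun i (N : Measure S) =>
        negExp (((e.symm i : g.range) : ℝ≥0∞) * N (B i))) Q :=
      hi.comp (fun i x => negExp (((e.symm i : g.range) : ℝ≥0∞) * x)) fun i => by fun_prop
    have hmB : ∀ i, Measurable fun N : Measure S => N (B i) := fun i =>
      Measure.measurable_coe (hB i)
    have h3 := lintegral_prod_eq_prod_lintegral_of_indepFun Finset.univ _ hi'
      (fun i => measurable_negExp.comp ((hmB i).const_mul _))
    refine h3.trans (Finset.prod_congr rfl fun i _ => ?_)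
    rw [hQ.lintegral_negExp_apply (hB i), mul_comm]
  have lim1 : Tendsto (fun n => ∫⁻ N, negExp (∫⁻ x, SimpleFunc.eapprox f n x ∂N) ∂Q) atTop
      (𝓝 (∫⁻ N, negExp (∫⁻ x, f x ∂N) ∂Q)) := by
    refine tendsto_lintegral_of_dominated_convergence (fun _ => 1)
      (fun n => measurable_negExp.comp (Measure.measurable_lintegral (SimpleFunc.measurable _)))
      (fun n => ae_of_all _ fun N => negExp_le_one _) (by simp) (ae_of_all _ fun N => ?_)
    refine (continuous_negExp.tendsto _).comp ?_
    exact lintegral_tendsto_of_tendsto_of_monotone (fun n => (SimpleFunc.measurable _).aemeasurable)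
      (ae_of_all _ fun x n m h => SimpleFunc.monotone_eapprox f h x)
      (ae_of_all _ fun x => SimpleFunc.tendsto_eapprox hf x)
  have lim2 : Tendsto (fun n => negExp (∫⁻ x, (1 - negExp (SimpleFunc.eapprox f n x)) ∂ν)) atTop
      (𝓝 (negExp (∫⁻ x, (1 - negExp (f x)) ∂ν))) := by
    refine (continuous_negExp.tendsto _).comp ?_
    -- The mean measure may be infinite, so no dominating function is available here; but `1 -
    -- e^{-f}` increases with `f`.
    refine lintegral_tendsto_of_tendsto_of_monotone
      (fun n => (measurable_const.sub
        (measurable_negExp.comp (SimpleFunc.measurable _))).aemeasurable)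
      (ae_of_all _ fun x n m h => tsub_le_tsub_left
        (negExp_antitone (SimpleFunc.monotone_eapprox f h x)) _)
      (ae_of_all _ fun x => ?_)
    exact ENNReal.Tendsto.sub tendsto_const_nhds
      ((continuous_negExp.tendsto _).comp (SimpleFunc.tendsto_eapprox hf x)) (by simp)
  refine tendsto_nhds_unique lim1 (lim2.congr fun n => (simple _).symm)

/-- A random measure with the Laplace functional of a Poisson process is a Poisson process. -/
lemma isPoissonProcessLaw_of_laplace {S : Type*} [MeasurableSpace S] {ν : Measure S}
    {Q : Measure (Measure S)} [IsProbabilityMeasure Q]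
    (h : ∀ f : S → ℝ≥0∞, Measurable f →
      ∫⁻ N, negExp (∫⁻ x, f x ∂N) ∂Q = negExp (∫⁻ x, (1 - negExp (f x)) ∂ν)) :
    IsPoissonProcessLaw ν Q := by
  have joint : ∀ (n : ℕ) (B : Fin n → Set S), (∀ i, MeasurableSet (B i)) →
      (Pairwise fun i j => Disjoint (B i) (B j)) → ∀ t : Fin n → ℕ,
      ∫⁻ N, ∏ i, negExp (t i * N (B i)) ∂Q = ∏ i, negExp (ν (B i) * (1 - negExp (t i))) := by
    intro n B hB hd t
    have hf : Measurable fun x => ∑ i, (t i : ℝ≥0∞) * (B i).indicator 1 x :=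
      Finset.measurable_sum _ fun i _ => (measurable_one.indicator (hB i)).const_mul _
    have h1 : ∀ N : Measure S, ∏ i, negExp (t i * N (B i)) =
        negExp (∫⁻ x, ∑ i, (t i : ℝ≥0∞) * (B i).indicator 1 x ∂N) := fun N => by
      rw [lintegral_finsetSum _ fun i _ => (measurable_one.indicator (hB i)).const_mul _,
        negExp_sum]
      refine Finset.prod_congr rfl fun i _ => ?_
      rw [lintegral_const_mul _ (measurable_one.indicator (hB i)), lintegral_indicator_one (hB i)]
    simp_rw [h1]
    rw [h _ hf, ← negExp_sum]
    congr 1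
    -- By disjointness at most one indicator is nonzero at `x`, so the exponential of the sum acts
    -- on a single term.
    have h2 : ∀ x, 1 - negExp (∑ i, (t i : ℝ≥0∞) * (B i).indicator 1 x) =
        ∑ i, (1 - negExp (t i)) * (B i).indicator 1 x := fun x => by
      by_cases hx : ∃ i, x ∈ B i
      · obtain ⟨i, hi⟩ := hx
        have hj : ∀ j, j ≠ i → x ∉ B j := fun j hj hxj => (hd hj).le_bot ⟨hxj, hi⟩
        rw [Finset.sum_eq_single i, Finset.sum_eq_single i]
        · simp [hi]
        · intro j _ hji; simp [hj j hji]
        · simp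
        · intro j _ hji; simp [hj j hji]
        · simp
      · push Not at hx
        simp [hx]
    simp_rw [h2]
    rw [lintegral_finsetSum _ fun i _ => (measurable_one.indicator (hB i)).const_mul _]
    refine Finset.sum_congr rfl fun i _ => ?_
    rw [lintegral_const_mul _ (measurable_one.indicator (hB i)), lintegral_indicator_one (hB i),
      mul_comm]
  have single : ∀ B : Set S, MeasurableSet B → ∀ t : ℕ,
      ∫⁻ N, negExp (t * N B) ∂Q = negExp (ν B * (1 - negExp t)) := fun B hB t => by
    simpa using joint 1 (fun _ => B) (fun _ => hB)
      (fun i j hij => (hij (Subsingleton.elim i j)).elim) fun _ => t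
  have hm : ∀ B : Set S, MeasurableSet B → Measurable fun N : Measure S => N B := fun B hB =>
    Measure.measurable_coe hB
  refine ⟨inferInstance, fun B hB hν => ?_, fun B hB hν => ?_, fun n B hB hd => ?_⟩
  · have hmB := hm B hB
    have := Measure.isProbabilityMeasure_map (μ := Q) hmB.aemeasurable
    -- The uniqueness theorem is stated for finite products; a single variable is treated as a
    -- family indexed by `Unit`.
    let φ : ℝ≥0∞ → (Unit → ℝ≥0∞) := fun x _ => x
    have hφ : Measurable φ := by fun_prop
    have h1 : (Q.map fun N => N B).map φ =
        ((poissonMeasure (ν B).toNNReal).map (fun n : ℕ => (n : ℝ≥0∞))).map φ := by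
      refine ext_of_lintegral_prod_negExp fun t => ?_
      rw [lintegral_map (by fun_prop) hφ, lintegral_map (by fun_prop) hφ,
        lintegral_map (by fun_prop) hmB, lintegral_map (by fun_prop) (by fun_prop)]
      simp only [φ, Finset.univ_unique, Finset.prod_singleton]
      rw [single B hB]
      simp_rw [negExp_mul_natCast]
      rw [lintegral_poissonMeasure_pow _ (negExp_le_one _), ENNReal.coe_toNNReal hν]
    have h2 := congrArg (fun μ => μ.map fun g : Unit → ℝ≥0∞ => g ()) h1
    rw [Measure.map_map (by fun_prop) hφ, Measure.map_map (by fun_prop) hφ] at h2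
    simpa [φ, Function.comp_def] using h2
  -- The expectation of `e^{-N(B)}` is `e^{-∞} = 0`, which forces the count to be infinite almost
  -- surely.
  · have h1 := single B hB 1
    rw [hν, ENNReal.top_mul (by simp [one_sub_negExp_eq_zero_iff]), negExp_top,
      lintegral_eq_zero_iff (measurable_negExp_comp ((hm B hB).const_mul _))] at h1
    filter_upwards [h1] with N hN
    simpa [negExp_eq_zero_iff] using hN
  · have hmB : ∀ i, Measurable fun N : Measure S => N (B i) := fun i => hm _ (hB i)
    rw [iIndepFun_iff_map_fun_eq_pi_map fun i => (hmB i).aemeasurable]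
    have : ∀ i, IsProbabilityMeasure (Q.map fun N => N (B i)) := fun i =>
      Measure.isProbabilityMeasure_map (hmB i).aemeasurable
    have hmp : Measurable fun (N : Measure S) (i : Fin n) => N (B i) :=
      measurable_pi_lambda _ hmB
    refine ext_of_lintegral_prod_negExp fun t => ?_
    rw [lintegral_map (by fun_prop) hmp, joint n B hB hd,
      lintegral_pi_prod _ (fun i x => negExp (t i * x)) fun i => by fun_prop]
    refine Finset.prod_congr rfl fun i _ => ?_
    rw [lintegral_map (by fun_prop) (hmB i), single _ (hB i)]

/-! ### Homogeneous completely random measures -/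

/-- The second term is the exponent of `y` under an intensity reweighted by `e^{-x}`. Both
exponential tilting and the Palm formula come from this splitting. -/
lemma one_sub_negExp_add (x y : ℝ≥0∞) :
    1 - negExp (x + y) = (1 - negExp x) + negExp x * (1 - negExp y) := by
  rw [negExp_add, ENNReal.mul_sub fun _ _ => negExp_ne_top x, mul_one,
    tsub_add_tsub_cancel (negExp_le_one x)]
  exact mul_le_of_le_one_right' (negExp_le_one y)

/-- Subadditivity of `1 - e^{-x}`; it carries integrability from exponent `1` to every finite
exponent. -/
lemma one_sub_negExp_natCast_mul_le (n : ℕ) (x : ℝ≥0∞) :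
    1 - negExp (n * x) ≤ n * (1 - negExp x) := by
  induction n with
  | zero => simp
  | succ n ih =>
    rw [Nat.cast_succ, add_mul, add_mul, one_mul, one_mul, one_sub_negExp_add]
    exact add_le_add ih (mul_le_of_le_one_left' (negExp_le_one _))

lemma one_sub_negExp_ofReal {w : ℝ} (hw : 0 ≤ w) :
    1 - negExp (ENNReal.ofReal w) = ENNReal.ofReal (1 - Real.exp (-w)) := by
  rw [negExp_ofReal hw, ENNReal.ofReal_sub _ (Real.exp_nonneg _), ENNReal.ofReal_one]

lemma measurable_one_sub_negExp_comp {α : Type*} [MeasurableSpace α] {f : α → ℝ≥0∞}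
    (hf : Measurable f) : Measurable fun x => 1 - negExp (f x) :=
  measurable_const.sub (measurable_negExp_comp hf)

/-! ### Integrability of the jump intensity. -/

section Jump

variable {lam : ℝ → ℝ≥0∞}

lemma lintegral_jumpMeasure (hlam : Measurable lam) {f : ℝ → ℝ≥0∞} (hf : Measurable f) :
    ∫⁻ w, f w ∂jumpMeasure lam = ∫⁻ w in Ioi (0 : ℝ), f w * lam w := by
  rw [jumpMeasure, lintegral_withDensity_eq_lintegral_mul _ hlam hf]
  exact lintegral_congr fun w => mul_comm _ _

lemma ae_jumpMeasure_pos (lam : ℝ → ℝ≥0∞) : ∀ᵐ w ∂jumpMeasure lam, 0 < w :=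
  (withDensity_absolutelyContinuous _ _).ae_le (ae_restrict_mem measurableSet_Ioi)

/-- The factor `1 - e^{-w}` is positive for `w > 0`, so an infinite value of `λ` on a non-null set
would contradict the integral condition. The σ-finiteness of the jump measure rests on this. -/
lemma IsLevyIntensity.ae_ne_top (h : IsLevyIntensity lam) :
    ∀ᵐ w ∂(volume.restrict (Ioi (0 : ℝ))), lam w ≠ ∞ := by
  have hm : Measurable fun w => ENNReal.ofReal (1 - Real.exp (-w)) * lam w := by
    have := h.measurable; fun_prop
  filter_upwards [ae_lt_top hm h.lintegral_lt_top.ne, ae_restrict_mem measurableSet_Ioi]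
    with w hw hw0 htop
  rw [htop, ENNReal.mul_top] at hw
  · exact lt_irrefl _ hw
  · have : Real.exp (-w) < 1 := Real.exp_lt_one_iff.2 (by simpa using hw0)
    simpa using this

lemma IsLevyIntensity.sigmaFinite (h : IsLevyIntensity lam) : SigmaFinite (jumpMeasure lam) :=
  SigmaFinite.withDensity_of_ne_top h.ae_ne_top

lemma IsLevyIntensity.lintegral_one_sub_negExp_lt_top (h : IsLevyIntensity lam) {s : ℝ≥0∞}
    (hs : s ≠ ∞) : ∫⁻ w, (1 - negExp (ENNReal.ofReal w * s)) ∂jumpMeasure lam < ∞ := by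
  obtain ⟨n, hn⟩ := ENNReal.exists_nat_gt hs
  calc ∫⁻ w, (1 - negExp (ENNReal.ofReal w * s)) ∂jumpMeasure lam
      ≤ ∫⁻ w, n * (1 - negExp (ENNReal.ofReal w)) ∂jumpMeasure lam := by
        refine lintegral_mono fun w => ?_
        refine le_trans (tsub_le_tsub_left (negExp_antitone ?_) _)
          (one_sub_negExp_natCast_mul_le n (ENNReal.ofReal w))
        rw [mul_comm]
        gcongr
    _ = n * ∫⁻ w in Ioi (0 : ℝ), ENNReal.ofReal (1 - Real.exp (-w)) * lam w := by
        rw [lintegral_const_mul _ (by fun_prop), lintegral_jumpMeasure h.measurable (by fun_prop)]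
        congr 1
        refine setLIntegral_congr_fun measurableSet_Ioi fun w hw => ?_
        rw [one_sub_negExp_ofReal (le_of_lt hw)]
    _ < ∞ := ENNReal.mul_lt_top (by simp) h.lintegral_lt_top

lemma IsLevyIntensity.jumpMeasure_univ (h : IsLevyIntensity lam) : jumpMeasure lam univ = ∞ := by
  rw [← lintegral_one, lintegral_jumpMeasure h.measurable measurable_const]
  simpa using h.lintegral_eq_top

end Jump

variable {X : Type*} [MeasurableSpace X]

lemma lintegral_massMeasure (N : Measure (ℝ × X)) {f : X → ℝ≥0∞} (hf : Measurable f) :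
    ∫⁻ x, f x ∂massMeasure N = ∫⁻ p, ENNReal.ofReal p.1 * f p.2 ∂N := by
  rw [massMeasure, lintegral_map hf measurable_snd,
    lintegral_withDensity_eq_lintegral_mul _ (by fun_prop) (by fun_prop)]
  rfl

lemma measurable_massMeasure : Measurable (massMeasure : Measure (ℝ × X) → Measure X) := by
  refine Measure.measurable_of_measurable_coe _ fun B hB => ?_
  simp_rw [← lintegral_indicator_one hB]
  simp_rw [lintegral_massMeasure _ (measurable_one.indicator hB)]
  exact Measure.measurable_lintegral
    ((by fun_prop : Measurable fun p : ℝ × X => ENNReal.ofReal p.1).mul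
      ((measurable_one.indicator hB).comp measurable_snd))

/-- The Laplace exponent of `CRM(λ, H)`. -/
def laplaceExponent (lam : ℝ → ℝ≥0∞) (H : Measure X) (f : X → ℝ≥0∞) : ℝ≥0∞ :=
  ∫⁻ p, (1 - negExp (ENNReal.ofReal p.1 * f p.2)) ∂((jumpMeasure lam).prod H)

lemma measurable_lintegral_measure {f : X → ℝ≥0∞} (hf : Measurable f) :
    Measurable fun g : Measure X => ∫⁻ x, f x ∂g := Measure.measurable_lintegral hf

/-! ### Laplace functional, total mass and absence of fixed atoms. -/

section CRM

variable {lam : ℝ → ℝ≥0∞} {H : Measure X} {μ : Measure (Measure X)}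

lemma IsCRMLaw.isProbabilityMeasure (h : IsCRMLaw lam H μ) : IsProbabilityMeasure μ := by
  obtain ⟨-, Q, hQ, rfl⟩ := h
  have := hQ.isProbabilityMeasure
  exact Measure.isProbabilityMeasure_map measurable_massMeasure.aemeasurable

lemma IsCRMLaw.laplace (h : IsCRMLaw lam H μ) {f : X → ℝ≥0∞} (hf : Measurable f) :
    ∫⁻ g, negExp (∫⁻ x, f x ∂g) ∂μ = negExp (laplaceExponent lam H f) := by
  obtain ⟨-, Q, hQ, rfl⟩ := h
  rw [lintegral_map (measurable_negExp_comp (measurable_lintegral_measure hf))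
    measurable_massMeasure]
  simp_rw [lintegral_massMeasure _ hf]
  exact hQ.laplace (by fun_prop)

lemma laplaceExponent_const [IsProbabilityMeasure H] (h : IsLevyIntensity lam) (s : ℝ≥0∞) :
    laplaceExponent lam H (fun _ => s) =
      ∫⁻ w, (1 - negExp (ENNReal.ofReal w * s)) ∂jumpMeasure lam := by
  have := h.sigmaFinite
  rw [laplaceExponent, lintegral_prod _ (by fun_prop)]
  simp

lemma laplaceExponent_const_lt_top [IsProbabilityMeasure H] (h : IsLevyIntensity lam) {s : ℝ≥0∞}
    (hs : s ≠ ∞) : laplaceExponent lam H (fun _ => s) < ∞ := by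
  rw [laplaceExponent_const h]
  exact h.lintegral_one_sub_negExp_lt_top hs

lemma IsCRMLaw.laplace_univ [IsProbabilityMeasure H] (h : IsCRMLaw lam H μ) (s : ℝ≥0∞) :
    ∫⁻ g, negExp (s * g univ) ∂μ =
      negExp (∫⁻ w, (1 - negExp (ENNReal.ofReal w * s)) ∂jumpMeasure lam) := by
  have h1 := h.laplace (f := fun _ => s) measurable_const
  simp only [lintegral_const] at h1
  rw [h1, laplaceExponent_const h.1]

lemma measurable_measure_univ : Measurable fun g : Measure X => g univ :=
  Measure.measurable_coe MeasurableSet.univ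

/-- The expectation of `e^{-G(X)/n}` is at most the probability that `G(X)` is finite, and it tends
to `1` because its Laplace exponent tends to `0` by dominated convergence. -/
lemma IsCRMLaw.ae_lt_top [IsProbabilityMeasure H] (h : IsCRMLaw lam H μ) :
    ∀ᵐ g ∂μ, g univ < ∞ := by
  have := h.isProbabilityMeasure
  have hset : MeasurableSet {g : Measure X | g univ < ∞} :=
    measurableSet_lt measurable_measure_univ measurable_const
  refine (prob_compl_eq_zero_iff hset).2 (le_antisymm prob_le_one ?_)
  have lim : Tendsto (fun n : ℕ => ∫⁻ g, negExp ((n : ℝ≥0∞)⁻¹ * g univ) ∂μ) atTop (𝓝 1) := by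
    simp_rw [h.laplace_univ]
    rw [show 𝓝 (1 : ℝ≥0∞) = 𝓝 (negExp (∫⁻ w, 0 ∂jumpMeasure lam)) by simp]
    refine (continuous_negExp.tendsto _).comp ?_
    refine tendsto_lintegral_filter_of_dominated_convergence
      (fun w => 1 - negExp (ENNReal.ofReal w * 1)) (Eventually.of_forall fun n => by fun_prop)
      ?_ (h.1.lintegral_one_sub_negExp_lt_top (by simp)).ne (ae_of_all _ fun w => ?_)
    · filter_upwards [eventually_ge_atTop 1] with n hn
      refine ae_of_all _ fun w => tsub_le_tsub_left (negExp_antitone ?_) _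
      gcongr
      rw [ENNReal.inv_le_one]
      exact_mod_cast hn
    · have h1 : Tendsto (fun n : ℕ => ENNReal.ofReal w * (n : ℝ≥0∞)⁻¹) atTop
          (𝓝 (ENNReal.ofReal w * 0)) :=
        ENNReal.Tendsto.const_mul ENNReal.tendsto_inv_nat_nhds_zero (Or.inr (by simp))
      have h2 := ENNReal.Tendsto.sub (tendsto_const_nhds (x := (1 : ℝ≥0∞)))
        ((continuous_negExp.tendsto _).comp h1) (by simp)
      simpa using h2
  refine le_of_tendsto lim (Eventually.of_forall fun n => ?_)
  rw [← lintegral_indicator_one hset]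
  refine lintegral_mono fun g => ?_
  by_cases hg : g univ < ∞
  · simpa [indicator, hg] using negExp_le_one _
  · have : g univ = ∞ := by simpa using hg
    rw [this, ENNReal.mul_top (by simp)]
    simp

/-- The expectation of `e^{-nG(X)}` is at least the probability that `G(X) = 0`. Its exponent
increases to the total mass of `λ`, which is infinite, so the expectation tends to `0`. -/
lemma IsCRMLaw.ae_univ_ne_zero [IsProbabilityMeasure H] (h : IsCRMLaw lam H μ) :
    ∀ᵐ g ∂μ, g univ ≠ 0 := by
  have := h.isProbabilityMeasure
  have hset : MeasurableSet {g : Measure X | g univ = 0} :=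
    measurable_measure_univ (measurableSet_singleton 0)
  have lim : Tendsto (fun n : ℕ => ∫⁻ g, negExp ((n : ℝ≥0∞) * g univ) ∂μ) atTop (𝓝 0) := by
    simp_rw [h.laplace_univ]
    rw [← negExp_top]
    refine (continuous_negExp.tendsto _).comp ?_
    have h0 : ∞ = ∫⁻ w, 1 ∂jumpMeasure lam := by rw [lintegral_one, h.1.jumpMeasure_univ]
    rw [h0]
    refine lintegral_tendsto_of_tendsto_of_monotone (fun n => by fun_prop)
      (ae_of_all _ fun w n m hnm => tsub_le_tsub_left (negExp_antitone ?_) _) ?_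
    · gcongr
    · filter_upwards [ae_jumpMeasure_pos lam] with w hw
      have h1 : Tendsto (fun n : ℕ => ENNReal.ofReal w * (n : ℝ≥0∞)) atTop
          (𝓝 (ENNReal.ofReal w * ∞)) :=
        ENNReal.Tendsto.const_mul ENNReal.tendsto_nat_nhds_top (Or.inr (by simp))
      have h2 := ENNReal.Tendsto.sub (tendsto_const_nhds (x := (1 : ℝ≥0∞)))
        ((continuous_negExp.tendsto _).comp h1) (by simp)
      rw [ENNReal.mul_top (by simpa using hw)] at h2
      simpa using h2
  rw [ae_iff]
  simp only [ne_eq, not_not]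
  refine le_antisymm (ge_of_tendsto lim (Eventually.of_forall fun n => ?_)) zero_le
  rw [← lintegral_indicator_one hset]
  refine lintegral_mono fun g => ?_
  by_cases hg : g univ = 0
  · simp [indicator, hg]
  · simp [indicator, hg]

/-- Since `H` does not charge `x`, the Laplace exponent of the indicator of `{x}` vanishes, hence
`e^{-G{x}}` has mean `1`. -/
lemma IsCRMLaw.ae_singleton_eq_zero [IsProbabilityMeasure H] [NullSingletonClass H]
    [MeasurableSingletonClass X] (h : IsCRMLaw lam H μ) (x : X) : ∀ᵐ g ∂μ, g {x} = 0 := by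
  have := h.isProbabilityMeasure
  have := h.1.sigmaFinite
  have hm : Measurable fun g : Measure X => g {x} :=
    Measure.measurable_coe (measurableSet_singleton x)
  have h1 := h.laplace (f := ({x} : Set X).indicator 1)
    (measurable_one.indicator (measurableSet_singleton x))
  have h2 : laplaceExponent lam H (({x} : Set X).indicator 1) = 0 := by
    have hm2 : Measurable fun p : ℝ × X =>
        1 - negExp (ENNReal.ofReal p.1 * ({x} : Set X).indicator 1 p.2) :=
      measurable_one_sub_negExp_comp ((by fun_prop : Measurable fun p : ℝ × X =>
        ENNReal.ofReal p.1).mul ((measurable_one.indicator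
          (measurableSet_singleton x)).comp measurable_snd))
    rw [laplaceExponent, lintegral_prod _ hm2.aemeasurable]
    have : ∀ w : ℝ, ∫⁻ y, (1 - negExp (ENNReal.ofReal w * ({x} : Set X).indicator 1 y)) ∂H = 0 := by
      intro w
      rw [← lintegral_zero (μ := H)]
      refine lintegral_congr_ae ?_
      have hx : ∀ᵐ y ∂H, y ≠ x := by
        rw [ae_iff]; simp
      filter_upwards [hx] with y hy
      simp [hy]
    simp [this]
  simp_rw [lintegral_indicator_one (measurableSet_singleton x)] at h1
  rw [h2, negExp_zero] at h1
  have h3 : ∫⁻ g, (1 - negExp (g {x})) ∂μ = 0 := by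
    rw [lintegral_sub (measurable_negExp_comp hm) (by rw [h1]; simp)
      (ae_of_all _ fun g => negExp_le_one _), h1]
    simp
  rw [lintegral_eq_zero_iff (measurable_one_sub_negExp_comp hm)] at h3
  filter_upwards [h3] with g hg
  exact one_sub_negExp_eq_zero_iff.1 hg

end CRM

/-! ### Exponential tilting -/

section Tilt

variable {lam : ℝ → ℝ≥0∞}

lemma measurable_tilt (hlam : Measurable lam) (s : ℝ) : Measurable (tilt lam s) := by
  unfold tilt; fun_prop

lemma jumpMeasure_tilt (hlam : Measurable lam) {s : ℝ} (hs : 0 ≤ s) :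
    jumpMeasure (tilt lam s) =
      (jumpMeasure lam).withDensity fun w => negExp (ENNReal.ofReal w * ENNReal.ofReal s) := by
  rw [jumpMeasure, jumpMeasure, ← withDensity_mul _ hlam (by fun_prop)]
  refine withDensity_congr_ae ?_
  filter_upwards [ae_restrict_mem measurableSet_Ioi] with w hw
  have hw' : 0 ≤ w := le_of_lt hw
  rw [Pi.mul_apply, tilt, ← ENNReal.ofReal_mul hw', negExp_ofReal (mul_nonneg hw' hs)]

lemma IsLevyIntensity.tilt (h : IsLevyIntensity lam) {s : ℝ} (hs : 0 ≤ s) :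
    IsLevyIntensity (tilt lam s) := by
  have hm := measurable_tilt h.measurable s
  refine ⟨hm, lt_of_le_of_lt (setLIntegral_mono' measurableSet_Ioi fun w hw => ?_)
    h.lintegral_lt_top, ?_⟩
  · rw [PlackettLuce.tilt]
    gcongr
    refine mul_le_of_le_one_right' ?_
    rw [ENNReal.ofReal_le_one, Real.exp_le_one_iff]
    have : 0 ≤ w * s := mul_nonneg (le_of_lt hw) hs
    linarith
  · by_contra hne
    have hC : 0 < 1 - Real.exp (-1) := sub_pos.2 (Real.exp_lt_one_iff.2 (by norm_num))
    have hl := h.measurable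
    -- For `w ≤ 1` the tilt costs at most a factor `e^{-s}`; for `w ≥ 1` the weight `1 - e^{-w}` is
    -- at least `1 - e^{-1}`, so `λ` is integrable there. All the infinite mass sits near `0`, where
    -- tilting cannot remove it.
    have key : ∫⁻ w in Ioi (0 : ℝ), lam w ≤
        ENNReal.ofReal (1 - Real.exp (-1))⁻¹ *
          (∫⁻ w in Ioi (0 : ℝ), ENNReal.ofReal (1 - Real.exp (-w)) * lam w) +
        ENNReal.ofReal (Real.exp s) * ∫⁻ w in Ioi (0 : ℝ), PlackettLuce.tilt lam s w := by
      rw [← lintegral_const_mul _ (by fun_prop), ← lintegral_const_mul _ hm,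
        ← lintegral_add_left (by fun_prop)]
      refine setLIntegral_mono' measurableSet_Ioi fun w hw => ?_
      rcases le_total w 1 with hw1 | hw1
      · refine le_add_left ?_
        rw [PlackettLuce.tilt, mul_left_comm, ← ENNReal.ofReal_mul (Real.exp_nonneg _),
          ← Real.exp_add]
        refine le_mul_of_one_le_right' ?_
        rw [ENNReal.one_le_ofReal, Real.one_le_exp_iff]
        nlinarith
      · refine le_add_right ?_
        rw [← mul_assoc, ← ENNReal.ofReal_mul (by positivity)]
        refine le_mul_of_one_le_left' ?_
        rw [ENNReal.one_le_ofReal, inv_mul_eq_div, one_le_div hC]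
        have : Real.exp (-w) ≤ Real.exp (-1) := Real.exp_le_exp.2 (by linarith)
        linarith
    rw [h.lintegral_eq_top, top_le_iff] at key
    exact ENNReal.add_ne_top.2 ⟨ENNReal.mul_ne_top (by simp) h.lintegral_lt_top.ne,
      ENNReal.mul_ne_top (by simp) hne⟩ key

variable {X : Type*} [MeasurableSpace X] {H : Measure X} {μ : Measure (Measure X)}

/-- The law `μ` of a random measure `g`, exponentially tilted by the total mass: reweighted by
`e^{-s g(X)}` and normalised. -/
def tiltLaw (μ : Measure (Measure X)) (s : ℝ) : Measure (Measure X) :=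
  (∫⁻ g, negExp (ENNReal.ofReal s * g univ) ∂μ)⁻¹ •
    μ.withDensity fun g => negExp (ENNReal.ofReal s * g univ)

lemma measurable_negExp_mul_univ (s : ℝ≥0∞) :
    Measurable fun g : Measure X => negExp (s * g univ) :=
  measurable_negExp_comp (measurable_measure_univ.const_mul s)

lemma lintegral_tiltLaw (s : ℝ) {F : Measure X → ℝ≥0∞} (hF : Measurable F) :
    ∫⁻ g, F g ∂tiltLaw μ s = (∫⁻ g, negExp (ENNReal.ofReal s * g univ) ∂μ)⁻¹ *
      ∫⁻ g, negExp (ENNReal.ofReal s * g univ) * F g ∂μ := by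
  rw [tiltLaw, lintegral_smul_measure,
    lintegral_withDensity_eq_lintegral_mul _ (measurable_negExp_mul_univ _) hF]
  rfl

lemma IsCRMLaw.lintegral_negExp_univ_ne_zero [IsProbabilityMeasure H] (h : IsCRMLaw lam H μ)
    (s : ℝ) : ∫⁻ g, negExp (ENNReal.ofReal s * g univ) ∂μ ≠ 0 := by
  rw [h.laplace_univ, Ne, negExp_eq_zero_iff]
  exact (h.1.lintegral_one_sub_negExp_lt_top (by simp)).ne

lemma IsCRMLaw.lintegral_negExp_univ_ne_top [IsProbabilityMeasure H] (h : IsCRMLaw lam H μ)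
    (s : ℝ) : ∫⁻ g, negExp (ENNReal.ofReal s * g univ) ∂μ ≠ ∞ := by
  rw [h.laplace_univ]
  exact negExp_ne_top _

/-- Since `s G(X)` is an integral `∫ ψ dN` over the underlying Poisson process, the reweighting can
be done there: normalising `e^{-∫ψ dN}` turns the mean measure `ν` into `e^{-ψ} ν`, as the Laplace
functional shows. -/
lemma IsCRMLaw.tiltLaw [IsProbabilityMeasure H] (h : IsCRMLaw lam H μ) {s : ℝ} (hs : 0 ≤ s) :
    IsCRMLaw (tilt lam s) H (tiltLaw μ s) := by
  refine ⟨h.1.tilt hs, ?_⟩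
  have hc0 := h.lintegral_negExp_univ_ne_zero s
  have hct := h.lintegral_negExp_univ_ne_top s
  have hc := h.laplace_univ (ENNReal.ofReal s)
  have hA := h.1.lintegral_one_sub_negExp_lt_top (s := ENNReal.ofReal s) (by simp)
  have := h.1.sigmaFinite
  obtain ⟨hlam, Q, hQ, rfl⟩ := h
  have hQp := hQ.isProbabilityMeasure
  set c := ∫⁻ g, negExp (ENNReal.ofReal s * g univ) ∂Q.map massMeasure with hcdef
  let ψ : ℝ × X → ℝ≥0∞ := fun p => ENNReal.ofReal p.1 * ENNReal.ofReal s
  have hψ : Measurable ψ := by fun_prop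
  have hψN : ∀ N : Measure (ℝ × X), ENNReal.ofReal s * massMeasure N univ = ∫⁻ p, ψ p ∂N := by
    intro N
    have h1 := lintegral_massMeasure N (f := fun _ : X => ENNReal.ofReal s) measurable_const
    rw [← h1]; simp
  let D : Measure (ℝ × X) → ℝ≥0∞ := fun N => negExp (∫⁻ p, ψ p ∂N)
  have hD : Measurable D := measurable_negExp_comp (Measure.measurable_lintegral hψ)
  let Q' : Measure (Measure (ℝ × X)) := c⁻¹ • Q.withDensity D
  have hlQ' : ∀ f : ℝ × X → ℝ≥0∞, Measurable f → ∫⁻ N, negExp (∫⁻ x, f x ∂N) ∂Q' =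
      negExp (∫⁻ x, (1 - negExp (f x)) ∂(jumpMeasure (PlackettLuce.tilt lam s)).prod H) := by
    intro f hf
    have hmf : Measurable fun N : Measure (ℝ × X) => negExp (∫⁻ x, f x ∂N) :=
      measurable_negExp_comp (Measure.measurable_lintegral hf)
    rw [lintegral_smul_measure, lintegral_withDensity_eq_lintegral_mul _ hD hmf]
    have h1 : ∫⁻ N, (D * fun N => negExp (∫⁻ x, f x ∂N)) N ∂Q =
        negExp (∫⁻ x, (1 - negExp (ψ x + f x)) ∂(jumpMeasure lam).prod H) := by
      refine Eq.trans (lintegral_congr fun N => ?_) (hQ.laplace (hψ.add hf))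
      change D N * _ = negExp (∫⁻ x, ψ x + f x ∂N)
      rw [lintegral_add_left hψ, negExp_add]
    have h2 : ∫⁻ x, (1 - negExp (ψ x)) ∂(jumpMeasure lam).prod H =
        ∫⁻ w, (1 - negExp (ENNReal.ofReal w * ENNReal.ofReal s)) ∂jumpMeasure lam := by
      rw [lintegral_prod _ (by fun_prop)]
      simp [ψ]
    rw [h1]
    -- The exponent of `ψ` splits off and is cancelled by the normalising constant; what remains is
    -- the exponent of `f` under the tilted intensity.
    simp_rw [one_sub_negExp_add]
    rw [lintegral_add_left (by fun_prop), h2, negExp_add, hc, smul_eq_mul, ← mul_assoc,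
      ENNReal.inv_mul_cancel (by rwa [← hc]) (by rwa [← hc]), one_mul, jumpMeasure_tilt
      hlam.measurable hs, prod_withDensity_left (by fun_prop),
      lintegral_withDensity_eq_lintegral_mul _ (by fun_prop) (by fun_prop)]
    rfl
  have hQ'p : IsProbabilityMeasure Q' := ⟨by
    have := hlQ' (fun _ => 0) measurable_const
    simpa using this⟩
  refine ⟨Q', isPoissonProcessLaw_of_laplace hlQ', ?_⟩
  rw [PlackettLuce.tiltLaw, ← hcdef, Measure.map_smul]
  congr 1
  ext B hB
  rw [withDensity_apply _ hB, Measure.map_apply measurable_massMeasure hB,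
    withDensity_apply _ (measurable_massMeasure hB),
    setLIntegral_map hB (measurable_negExp_mul_univ _) measurable_massMeasure]
  simp_rw [hψN]
  rfl

lemma IsCRMLaw.isProbabilityMeasure_tiltLaw [IsProbabilityMeasure H] (h : IsCRMLaw lam H μ)
    {s : ℝ} (hs : 0 ≤ s) : IsProbabilityMeasure (PlackettLuce.tiltLaw μ s) :=
  (h.tiltLaw hs).isProbabilityMeasure

end Tilt

/-! ### Positivity and finiteness of the moments `κ(n, s)`. -/

section Kappa

variable {lam : ℝ → ℝ≥0∞}

lemma pow_mul_exp_neg_le (k : ℕ) {w s : ℝ} (hw : 0 ≤ w) (hs : 0 < s) :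
    w ^ k * Real.exp (-(w * s)) ≤ k.factorial / s ^ k := by
  have h1 := Real.pow_div_factorial_le_exp (x := w * s) (by positivity) k
  rw [div_le_iff₀ (by positivity), mul_pow] at h1
  rw [le_div_iff₀ (by positivity), Real.exp_neg, mul_right_comm, ← div_eq_mul_inv,
    div_le_iff₀ (Real.exp_pos _)]
  linarith

/-- From `1 + w ≤ e^w` one gets `w ≤ (1 + w)(1 - e^{-w})`. One factor `w` is traded for the
integrable weight `1 - e^{-w}`, and the remaining powers are bounded against `e^{-ws}`. Hence the
need for an exponent of at least one. -/
lemma pow_succ_mul_exp_neg_le (k : ℕ) {w s : ℝ} (hw : 0 ≤ w) (hs : 0 < s) :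
    w ^ (k + 1) * Real.exp (-(w * s)) ≤
      (k.factorial / s ^ k + (k + 1).factorial / s ^ (k + 1)) * (1 - Real.exp (-w)) := by
  have h1 := pow_mul_exp_neg_le k hw hs
  have h2 := pow_mul_exp_neg_le (k + 1) hw hs
  have h3 : w ≤ (1 + w) * (1 - Real.exp (-w)) := by
    have h4 : (1 + w) * Real.exp (-w) ≤ 1 := by
      rw [Real.exp_neg, ← div_eq_mul_inv, div_le_one (Real.exp_pos _), add_comm]
      exact Real.add_one_le_exp w
    linarith
  have h5 : 0 ≤ 1 - Real.exp (-w) := sub_nonneg.2 (Real.exp_le_one_iff.2 (by linarith))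
  calc w ^ (k + 1) * Real.exp (-(w * s)) = (w ^ k * Real.exp (-(w * s))) * w := by ring
    _ ≤ (w ^ k * Real.exp (-(w * s))) * ((1 + w) * (1 - Real.exp (-w))) := by gcongr
    _ = (w ^ k * Real.exp (-(w * s)) + w ^ (k + 1) * Real.exp (-(w * s))) *
        (1 - Real.exp (-w)) := by ring
    _ ≤ _ := by gcongr

lemma IsLevyIntensity.kappa_ne_top (h : IsLevyIntensity lam) {n : ℕ} (hn : n ≠ 0) {s : ℝ}
    (hs : 0 < s) : kappa lam n s ≠ ∞ := by
  obtain ⟨k, rfl⟩ := Nat.exists_eq_succ_of_ne_zero hn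
  have hl := h.measurable
  have hC : 0 ≤ k.factorial / s ^ k + (k + 1).factorial / s ^ (k + 1) := by positivity
  refine ne_top_of_le_ne_top (ENNReal.mul_ne_top
    (ENNReal.ofReal_ne_top (r := k.factorial / s ^ k + (k + 1).factorial / s ^ (k + 1)))
    h.lintegral_lt_top.ne) ?_
  rw [kappa, ← lintegral_const_mul _ (by fun_prop)]
  refine setLIntegral_mono' measurableSet_Ioi fun w hw => ?_
  rw [← mul_assoc, ← ENNReal.ofReal_mul hC]
  refine mul_le_mul_left (ENNReal.ofReal_le_ofReal ?_) _
  exact pow_succ_mul_exp_neg_le k (le_of_lt hw) hs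

/-- The weight is positive on `(0, ∞)`, so a zero moment would make `λ` vanish almost everywhere,
against its infinite total mass. -/
lemma IsLevyIntensity.kappa_ne_zero (h : IsLevyIntensity lam) (n : ℕ) (s : ℝ) :
    kappa lam n s ≠ 0 := by
  intro h0
  have hl := h.measurable
  rw [kappa, lintegral_eq_zero_iff (by fun_prop)] at h0
  have h1 : ∫⁻ w in Ioi (0 : ℝ), lam w = 0 := by
    rw [← lintegral_zero (μ := volume.restrict (Ioi (0 : ℝ)))]
    refine lintegral_congr_ae ?_
    filter_upwards [h0, ae_restrict_mem measurableSet_Ioi] with w hw hw0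
    have hw0' : 0 < w := hw0
    have : 0 < w ^ n * Real.exp (-(w * s)) := by positivity
    simpa [this.not_ge] using hw
  rw [h.lintegral_eq_top] at h1
  exact ENNReal.top_ne_zero h1

lemma massLaw_eq (h : IsLevyIntensity lam) (n : ℕ) (s : ℝ) :
    massLaw lam n s = (jumpMeasure lam).withDensity fun w =>
      ENNReal.ofReal (w ^ n * Real.exp (-(w * s))) * (kappa lam n s)⁻¹ := by
  have hl := h.measurable
  rw [massLaw, jumpMeasure, ← withDensity_mul _ hl (by fun_prop)]
  congr 1
  ext w
  rw [Pi.mul_apply, div_eq_mul_inv]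
  ring

lemma IsLevyIntensity.isProbabilityMeasure_massLaw (h : IsLevyIntensity lam) {n : ℕ}
    (hn : n ≠ 0) {s : ℝ} (hs : 0 < s) : IsProbabilityMeasure (massLaw lam n s) := ⟨by
  have hl := h.measurable
  rw [massLaw, withDensity_apply _ MeasurableSet.univ, Measure.restrict_univ]
  simp_rw [div_eq_mul_inv]
  rw [lintegral_mul_const _ (by fun_prop)]
  exact ENNReal.mul_inv_cancel (h.kappa_ne_zero n s) (h.kappa_ne_top hn hs)⟩

end Kappa

/-! ### The identity kernel on finite measures -/

section FiniteKernel

variable {X : Type*} [MeasurableSpace X]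

open Classical in
/-- The kernel which maps a finite measure to itself and any other measure to `0`. -/
def finKernel (X : Type*) [MeasurableSpace X] : Kernel (Measure X) X where
  toFun g := if g univ < ∞ then g else 0
  measurable' := Measurable.ite (measurableSet_lt measurable_measure_univ measurable_const)
    measurable_id measurable_const

lemma finKernel_of_lt_top {g : Measure X} (hg : g univ < ∞) : finKernel X g = g := by
  simp [finKernel, hg]

instance isFiniteMeasure_finKernel (g : Measure X) : IsFiniteMeasure (finKernel X g) := ⟨by
  by_cases hg : g univ < ∞
  · rwa [finKernel_of_lt_top hg]
  · simp [finKernel, hg]⟩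

-- The kernel is cut according to the integer part of the total mass; the `n`-th piece is bounded by
-- `n + 1`. With s-finiteness, integrals against a random finite measure are measurable and Fubini
-- applies.
open Classical in
instance isSFiniteKernel_finKernel : IsSFiniteKernel (finKernel X) := by
  have hm (n : ℕ) : MeasurableSet {g : Measure X | ⌊(finKernel X g univ).toReal⌋₊ = n} := by
    have h1 : Measurable fun g => finKernel X g univ :=
      Kernel.measurable_coe _ MeasurableSet.univ
    exact (Nat.measurable_floor.comp h1.ennreal_toReal) (measurableSet_singleton n)
  refine ⟨⟨fun n => Kernel.piecewise (hm n) (finKernel X) 0, fun n => ⟨⟨n + 1, by simp, fun g => ?_⟩⟩,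
    ?_⟩⟩
  · rw [Kernel.piecewise_apply]
    split_ifs with hg
    · rw [← ENNReal.ofReal_toReal (measure_ne_top (finKernel X g) univ)]
      have h1 : (finKernel X g univ).toReal < n + 1 := by
        have := Nat.lt_floor_add_one (finKernel X g univ).toReal
        rwa [show ⌊(finKernel X g univ).toReal⌋₊ = n from hg] at this
      refine (ENNReal.ofReal_le_ofReal h1.le).trans ?_
      rw [ENNReal.ofReal_add (by positivity) (by positivity)]
      simp
    · simp
  · ext g s hs
    rw [Kernel.sum_apply' _ _ hs, tsum_eq_single ⌊(finKernel X g univ).toReal⌋₊]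
    · rw [Kernel.piecewise_apply, if_pos]
      rfl
    · intro n hn
      rw [Kernel.piecewise_apply, if_neg]
      · simp
      · exact fun h => hn (Eq.symm h)

lemma measurable_lintegral_finKernel {α : Type*} [MeasurableSpace α] {G : α → Measure X}
    (hG : Measurable G) {F : α → X → ℝ≥0∞} (hF : Measurable (Function.uncurry F)) :
    Measurable fun a => ∫⁻ x, F a x ∂finKernel X (G a) := by
  have := Measurable.lintegral_kernel_prod_right (κ := (finKernel X).comap G hG) hF
  simpa using this

end FiniteKernel

/-! ### The Palm formula -/

section Palm

variable {X : Type*} [MeasurableSpace X]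

/-- Restricting to `X ∈ t` and projecting gives finite laws of random measures, to which
`ext_of_laplace` applies; rectangles then determine the joint measure. -/
lemma ext_prod_of_laplace {M₁ M₂ : Measure (Measure X × X)} [IsFiniteMeasure M₁]
    [IsFiniteMeasure M₂]
    (h : ∀ f : X → ℝ≥0∞, Measurable f → ∀ A : Set X, MeasurableSet A →
      ∫⁻ p, negExp (∫⁻ x, f x ∂p.1) * A.indicator 1 p.2 ∂M₁ =
        ∫⁻ p, negExp (∫⁻ x, f x ∂p.1) * A.indicator 1 p.2 ∂M₂) : M₁ = M₂ := by
  refine Measure.ext_prod fun {s t} hs ht => ?_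
  have hmt : MeasurableSet (Prod.snd ⁻¹' t : Set (Measure X × X)) := measurable_snd ht
  have key : (M₁.restrict (Prod.snd ⁻¹' t)).map Prod.fst =
      (M₂.restrict (Prod.snd ⁻¹' t)).map Prod.fst := by
    refine ext_of_laplace fun f hf => ?_
    have hmf : Measurable fun g : Measure X => negExp (∫⁻ x, f x ∂g) :=
      measurable_negExp_comp (measurable_lintegral_measure hf)
    have h1 : ∀ M : Measure (Measure X × X), ∫⁻ p in Prod.snd ⁻¹' t, negExp (∫⁻ x, f x ∂p.1) ∂M =
        ∫⁻ p, negExp (∫⁻ x, f x ∂p.1) * t.indicator 1 p.2 ∂M := fun M => by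
      rw [← lintegral_indicator hmt]
      refine lintegral_congr fun p => ?_
      by_cases hp : p.2 ∈ t
      · simp [indicator, hp]
      · simp [indicator, hp]
    rw [lintegral_map hmf measurable_fst, lintegral_map hmf measurable_fst, h1, h1]
    exact h f hf t ht
  have h2 : ∀ M : Measure (Measure X × X), M (s ×ˢ t) =
      (M.restrict (Prod.snd ⁻¹' t)).map Prod.fst s := fun M => by
    rw [Measure.map_apply measurable_fst hs, Measure.restrict_apply (measurable_fst hs)]
    rfl
  rw [h2, h2, key]

lemma one_sub_negExp_le (y : ℝ≥0∞) : 1 - negExp y ≤ y := by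
  rcases eq_or_ne y ∞ with rfl | hy
  · simp
  · rw [← ENNReal.ofReal_toReal hy, one_sub_negExp_ofReal ENNReal.toReal_nonneg]
    refine ENNReal.ofReal_le_ofReal ?_
    linarith [Real.add_one_le_exp (-y.toReal)]

lemma mul_negExp_le_one_sub (y : ℝ≥0∞) : y * negExp y ≤ 1 - negExp y := by
  rcases eq_or_ne y ∞ with rfl | hy
  · simp
  · rw [← ENNReal.ofReal_toReal hy, one_sub_negExp_ofReal ENNReal.toReal_nonneg,
      negExp_ofReal ENNReal.toReal_nonneg, ← ENNReal.ofReal_mul ENNReal.toReal_nonneg]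
    refine ENNReal.ofReal_le_ofReal ?_
    have h := Real.add_one_le_exp y.toReal
    have h2 : (y.toReal + 1) * Real.exp (-y.toReal) ≤ 1 := by
      rwa [Real.exp_neg, ← div_eq_mul_inv, div_le_one (Real.exp_pos _)]
    linarith

lemma mul_inv_one_add_le (y : ℝ≥0∞) : y * (1 + y)⁻¹ ≤ 1 - negExp y := by
  rcases eq_or_ne y ∞ with rfl | hy
  · simp
  · have h0 : 1 + y ≠ 0 := by simp
    have ht : 1 + y ≠ ∞ := by simp [hy]
    rw [← div_eq_mul_inv, ENNReal.div_le_iff h0 ht, mul_add, mul_one]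
    have h1 : (1 - negExp y) * y + negExp y * y = y := by
      rw [← add_mul, tsub_add_cancel_of_le (negExp_le_one y), one_mul]
    calc y = (1 - negExp y) * y + negExp y * y := h1.symm
      _ ≤ (1 - negExp y) * y + (1 - negExp y) := by
        gcongr; rw [mul_comm]; exact mul_negExp_le_one_sub y
      _ = _ := add_comm _ _

/-- The derivative of `1 - e^{-y}` at `0` is `1`: squeeze between `y / (1 + y)` and `y`, where `y →
0` because `n y` has a finite limit. -/
lemma tendsto_natCast_mul_one_sub_negExp {y : ℕ → ℝ≥0∞} {a : ℝ≥0∞} (ha : a ≠ ∞)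
    (h : Tendsto (fun n : ℕ => n * y n) atTop (𝓝 a)) :
    Tendsto (fun n : ℕ => n * (1 - negExp (y n))) atTop (𝓝 a) := by
  have hy : Tendsto y atTop (𝓝 0) := by
    have h1 : Tendsto (fun n : ℕ => (n * y n) * (n : ℝ≥0∞)⁻¹) atTop (𝓝 (a * 0)) :=
      ENNReal.Tendsto.mul h (Or.inr (by simp)) ENNReal.tendsto_inv_nat_nhds_zero (Or.inr ha)
    rw [mul_zero] at h1
    refine h1.congr' ?_
    filter_upwards [eventually_ge_atTop 1] with n hn
    rw [mul_right_comm, ENNReal.mul_inv_cancel (by simp; lia) (by simp), one_mul]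
  have h2 : Tendsto (fun n : ℕ => (n * y n) * (1 + y n)⁻¹) atTop (𝓝 a) := by
    have h3 : Tendsto (fun n : ℕ => (1 + y n)⁻¹) atTop (𝓝 1) := by
      have := tendsto_inv_iff.2 (Tendsto.add (tendsto_const_nhds (x := (1 : ℝ≥0∞))) hy)
      simpa using this
    simpa using ENNReal.Tendsto.mul h (Or.inr (by simp)) h3 (Or.inr ha)
  refine tendsto_of_tendsto_of_tendsto_of_le_of_le h2 h (fun n => ?_) fun n => ?_
  · rw [mul_assoc]; gcongr; exact mul_inv_one_add_le _
  · dsimp only; gcongr; exact one_sub_negExp_le _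

variable {lam : ℝ → ℝ≥0∞} {H : Measure X} [IsProbabilityMeasure H] {μ : Measure (Measure X)}

/-- Both sides are minus the derivative of the Laplace functional at `f` in the direction of the
indicator of `A`, computed with increments `1/n`. The bound `f ≥ 1` supplies the dominating
functions through `y e^{-y} ≤ 1` on the random side and `w e^{-w} ≤ 1 - e^{-w}` on the intensity
side. -/
lemma IsCRMLaw.lintegral_negExp_mul_apply (h : IsCRMLaw lam H μ) {f : X → ℝ≥0∞}
    (hf : Measurable f) (hf1 : ∀ x, 1 ≤ f x) {A : Set X} (hA : MeasurableSet A) :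
    ∫⁻ g, negExp (∫⁻ x, f x ∂g) * g A ∂μ =
      negExp (laplaceExponent lam H f) *
        ∫⁻ p, ENNReal.ofReal p.1 * (negExp (ENNReal.ofReal p.1 * f p.2) * A.indicator 1 p.2)
          ∂(jumpMeasure lam).prod H := by
  have hμ := h.isProbabilityMeasure
  have hσ := h.1.sigmaFinite
  have hmA : Measurable fun g : Measure X => g A := Measure.measurable_coe hA
  have hmf : Measurable fun g : Measure X => negExp (∫⁻ x, f x ∂g) :=
    measurable_negExp_comp (measurable_lintegral_measure hf)
  have hind : Measurable fun p : ℝ × X => A.indicator (1 : X → ℝ≥0∞) p.2 :=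
    (measurable_one.indicator hA).comp measurable_snd
  have hle1 : ∀ x, A.indicator (1 : X → ℝ≥0∞) x ≤ 1 := fun x =>
    indicator_le_self' (by simp) x
  -- the left-hand side as a limit of difference quotients
  have limL : Tendsto (fun n : ℕ => n * ∫⁻ g, negExp (∫⁻ x, f x ∂g) *
      (1 - negExp ((n : ℝ≥0∞)⁻¹ * g A)) ∂μ) atTop
      (𝓝 (∫⁻ g, negExp (∫⁻ x, f x ∂g) * g A ∂μ)) := by
    have hm : ∀ n : ℕ, Measurable fun g : Measure X => negExp (∫⁻ x, f x ∂g) *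
        (1 - negExp ((n : ℝ≥0∞)⁻¹ * g A)) := fun n =>
      hmf.mul (measurable_one_sub_negExp_comp (hmA.const_mul _))
    have hn : ∀ n : ℕ, n * ∫⁻ g, negExp (∫⁻ x, f x ∂g) * (1 - negExp ((n : ℝ≥0∞)⁻¹ * g A)) ∂μ =
        ∫⁻ g, negExp (∫⁻ x, f x ∂g) * (n * (1 - negExp ((n : ℝ≥0∞)⁻¹ * g A))) ∂μ := fun n => by
      rw [← lintegral_const_mul _ (hm n)]
      exact lintegral_congr fun g => mul_left_comm _ _ _
    simp_rw [hn]
    refine tendsto_lintegral_of_dominated_convergence (fun _ => 1)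
      (fun n => hmf.mul ((measurable_one_sub_negExp_comp (hmA.const_mul _)).const_mul _))
      (fun n => ae_of_all _ fun g => ?_) (by simp) ?_
    · have h1 : g A ≤ ∫⁻ x, f x ∂g := by
        calc g A ≤ g univ := measure_mono (subset_univ _)
          _ = ∫⁻ _, 1 ∂g := by simp
          _ ≤ _ := lintegral_mono hf1
      have h2 : (n : ℝ≥0∞) * (1 - negExp ((n : ℝ≥0∞)⁻¹ * g A)) ≤ g A := by
        rcases Nat.eq_zero_or_pos n with rfl | hn
        · simp
        · calc (n : ℝ≥0∞) * (1 - negExp ((n : ℝ≥0∞)⁻¹ * g A))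
              ≤ n * ((n : ℝ≥0∞)⁻¹ * g A) := by gcongr; exact one_sub_negExp_le _
            _ = g A := by
              rw [← mul_assoc, ENNReal.mul_inv_cancel (by simp; lia) (by simp), one_mul]
      calc negExp (∫⁻ x, f x ∂g) * (n * (1 - negExp ((n : ℝ≥0∞)⁻¹ * g A)))
          ≤ negExp (g A) * g A := mul_le_mul' (negExp_antitone h1) h2
        _ ≤ 1 := by
          rw [mul_comm]; exact (mul_negExp_le_one_sub _).trans tsub_le_self
    · filter_upwards [h.ae_lt_top] with g hg
      have hgA : g A ≠ ∞ := ((measure_mono (subset_univ _)).trans_lt hg).ne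
      refine ENNReal.Tendsto.const_mul (tendsto_natCast_mul_one_sub_negExp hgA ?_)
        (Or.inr (negExp_ne_top _))
      refine tendsto_const_nhds.congr' ?_
      filter_upwards [eventually_ge_atTop 1] with n hn
      rw [← mul_assoc, ENNReal.mul_inv_cancel (by simp; lia) (by simp), one_mul]
  -- the increment of the Laplace exponent
  let D : ℕ → ℝ≥0∞ := fun n => ∫⁻ p, negExp (ENNReal.ofReal p.1 * f p.2) *
    (1 - negExp (ENNReal.ofReal p.1 * ((n : ℝ≥0∞)⁻¹ * A.indicator 1 p.2)))
      ∂(jumpMeasure lam).prod H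
  have hmfp : Measurable fun p : ℝ × X => negExp (ENNReal.ofReal p.1 * f p.2) := by fun_prop
  have hmD : ∀ n : ℕ, Measurable fun p : ℝ × X =>
      1 - negExp (ENNReal.ofReal p.1 * ((n : ℝ≥0∞)⁻¹ * A.indicator 1 p.2)) := fun n =>
    measurable_one_sub_negExp_comp ((by fun_prop : Measurable fun p : ℝ × X =>
      ENNReal.ofReal p.1).mul (hind.const_mul _))
  have hstep : ∀ n : ℕ, ∫⁻ g, negExp (∫⁻ x, f x ∂g) * (1 - negExp ((n : ℝ≥0∞)⁻¹ * g A)) ∂μ =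
      negExp (laplaceExponent lam H f) * (1 - negExp (D n)) := by
    intro n
    have hi : Measurable fun x => (n : ℝ≥0∞)⁻¹ * A.indicator (1 : X → ℝ≥0∞) x :=
      (measurable_one.indicator hA).const_mul _
    have hfi : Measurable fun x => f x + (n : ℝ≥0∞)⁻¹ * A.indicator 1 x := hf.add hi
    have h1 : ∀ g : Measure X, negExp (∫⁻ x, f x ∂g) * (1 - negExp ((n : ℝ≥0∞)⁻¹ * g A)) =
        negExp (∫⁻ x, f x ∂g) - negExp (∫⁻ x, f x + (n : ℝ≥0∞)⁻¹ * A.indicator 1 x ∂g) := by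
      intro g
      rw [lintegral_add_left hf, lintegral_const_mul _ (measurable_one.indicator hA),
        lintegral_indicator_one hA, negExp_add, ENNReal.mul_sub fun _ _ => negExp_ne_top _,
        mul_one]
    have h2 : laplaceExponent lam H (fun x => f x + (n : ℝ≥0∞)⁻¹ * A.indicator 1 x) =
        laplaceExponent lam H f + D n := by
      rw [laplaceExponent]
      simp_rw [mul_add, one_sub_negExp_add]
      rw [lintegral_add_left (measurable_one_sub_negExp_comp (by fun_prop))]
      rfl
    simp_rw [h1]
    rw [lintegral_sub (measurable_negExp_comp (measurable_lintegral_measure hfi))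
      (by rw [h.laplace hfi]; exact negExp_ne_top _)
      (ae_of_all _ fun g => negExp_antitone (lintegral_mono fun x => le_self_add)),
      h.laplace hf, h.laplace hfi, h2, negExp_add, ENNReal.mul_sub fun _ _ => negExp_ne_top _, mul_one]
  set E := ∫⁻ p, ENNReal.ofReal p.1 *
    (negExp (ENNReal.ofReal p.1 * f p.2) * A.indicator 1 p.2) ∂(jumpMeasure lam).prod H with hE
  have hbound : ∀ p : ℝ × X, ENNReal.ofReal p.1 *
      (negExp (ENNReal.ofReal p.1 * f p.2) * A.indicator 1 p.2) ≤
        1 - negExp (ENNReal.ofReal p.1 * 1) := fun p => by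
    rw [mul_one]
    refine le_trans ?_ (mul_negExp_le_one_sub _)
    gcongr
    calc negExp (ENNReal.ofReal p.1 * f p.2) * A.indicator 1 p.2
        ≤ negExp (ENNReal.ofReal p.1 * f p.2) * 1 := by gcongr; exact hle1 _
      _ ≤ negExp (ENNReal.ofReal p.1) := by
        rw [mul_one]
        exact negExp_antitone (le_mul_of_one_le_right' (hf1 _))
  have hbd : ∫⁻ p : ℝ × X, (1 - negExp (ENNReal.ofReal p.1 * 1)) ∂(jumpMeasure lam).prod H ≠ ∞ :=
    (laplaceExponent_const_lt_top h.1 (s := 1) (by simp)).ne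
  have hEtop : E ≠ ∞ := ne_top_of_le_ne_top hbd (lintegral_mono hbound)
  have limD : Tendsto (fun n : ℕ => n * D n) atTop (𝓝 E) := by
    have hn : ∀ n : ℕ, n * D n = ∫⁻ p, negExp (ENNReal.ofReal p.1 * f p.2) *
        (n * (1 - negExp (ENNReal.ofReal p.1 * ((n : ℝ≥0∞)⁻¹ * A.indicator 1 p.2))))
          ∂(jumpMeasure lam).prod H := fun n => by
      have hm : Measurable fun p : ℝ × X => negExp (ENNReal.ofReal p.1 * f p.2) *
          (1 - negExp (ENNReal.ofReal p.1 * ((n : ℝ≥0∞)⁻¹ * A.indicator 1 p.2))) :=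
        hmfp.mul (hmD n)
      refine (lintegral_const_mul _ hm).symm.trans ?_
      exact lintegral_congr fun g => mul_left_comm _ _ _
    simp_rw [hn]
    have hcancel : ∀ n : ℕ, 1 ≤ n → ∀ p : ℝ × X, (n : ℝ≥0∞) *
        (ENNReal.ofReal p.1 * ((n : ℝ≥0∞)⁻¹ * A.indicator 1 p.2)) =
          ENNReal.ofReal p.1 * A.indicator 1 p.2 := fun n hn p => by
      rw [mul_left_comm, ← mul_assoc (n : ℝ≥0∞), ENNReal.mul_inv_cancel (by simp; lia) (by simp),
        one_mul]
    refine tendsto_lintegral_of_dominated_convergence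
      (fun p => 1 - negExp (ENNReal.ofReal p.1 * 1))
      (fun n => hmfp.mul ((hmD n).const_mul _)) (fun n => ae_of_all _ fun p => ?_) hbd
      (ae_of_all _ fun p => ?_)
    · rcases Nat.eq_zero_or_pos n with rfl | hn
      · simp
      · refine le_trans ?_ (hbound p)
        rw [mul_left_comm (ENNReal.ofReal p.1), ← hcancel n hn]
        exact mul_le_mul' le_rfl (mul_le_mul' le_rfl (one_sub_negExp_le _))
    · rw [mul_left_comm (ENNReal.ofReal p.1)]
      refine ENNReal.Tendsto.const_mul (tendsto_natCast_mul_one_sub_negExp ?_ ?_)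
        (Or.inr (negExp_ne_top _))
      · exact ENNReal.mul_ne_top (by simp) (ne_top_of_le_ne_top (by simp) (hle1 _))
      · refine tendsto_const_nhds.congr' ?_
        filter_upwards [eventually_ge_atTop 1] with n hn
        exact (hcancel n hn p).symm
  have limR : Tendsto (fun n : ℕ => n * ∫⁻ g, negExp (∫⁻ x, f x ∂g) *
      (1 - negExp ((n : ℝ≥0∞)⁻¹ * g A)) ∂μ) atTop
      (𝓝 (negExp (laplaceExponent lam H f) * E)) := by
    simp_rw [hstep, mul_left_comm _ (negExp _)]
    exact ENNReal.Tendsto.const_mul (tendsto_natCast_mul_one_sub_negExp hEtop limD)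
      (Or.inr (negExp_ne_top _))
  exact tendsto_nhds_unique limL limR

lemma measurable_add_smul_dirac : Measurable fun q : (ℝ × X) × Measure X =>
    q.2 + ENNReal.ofReal q.1.1 • Measure.dirac q.1.2 := by
  refine Measure.measurable_of_measurable_coe _ fun B hB => ?_
  have h1 : ∀ q : (ℝ × X) × Measure X, (q.2 + ENNReal.ofReal q.1.1 • Measure.dirac q.1.2) B =
      q.2 B + ENNReal.ofReal q.1.1 * B.indicator 1 q.1.2 := fun q => by
    rw [Measure.add_apply, Measure.smul_apply, Measure.dirac_apply' _ hB, smul_eq_mul]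
  simp_rw [h1]
  exact ((Measure.measurable_coe hB).comp measurable_snd).add
    ((by fun_prop : Measurable fun q : (ℝ × X) × Measure X => ENNReal.ofReal q.1.1).mul
      ((measurable_one.indicator hB).comp (by fun_prop)))

/-- The weight `e^{-g(X)}` makes both measures on pairs finite, so Laplace uniqueness applies. It
also replaces the test function `f` by `1 + f`, which meets the lower bound required by
`lintegral_negExp_mul_apply`. -/
lemma IsCRMLaw.palm_weighted (h : IsCRMLaw lam H μ) {F : Measure X × X → ℝ≥0∞}
    (hF : Measurable F) :
    ∫⁻ g, ∫⁻ x, negExp (g univ) * F (g, x) ∂finKernel X g ∂μ =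
      ∫⁻ p, ENNReal.ofReal p.1 * ∫⁻ g, (negExp ((g + ENNReal.ofReal p.1 • Measure.dirac p.2) univ) *
        F (g + ENNReal.ofReal p.1 • Measure.dirac p.2, p.2)) ∂μ ∂(jumpMeasure lam).prod H := by
  have hμ := h.isProbabilityMeasure
  have hσ := h.1.sigmaFinite
  let W : Measure X × X → ℝ≥0∞ := fun p => negExp (p.1 univ)
  have hW : Measurable W := measurable_negExp_comp (measurable_measure_univ.comp measurable_fst)
  let T : (ℝ × X) × Measure X → Measure X × X := fun q =>
    (q.2 + ENNReal.ofReal q.1.1 • Measure.dirac q.1.2, q.1.2)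
  have hT : Measurable T := measurable_add_smul_dirac.prodMk (by fun_prop)
  let ρ : Measure (ℝ × X) := ((jumpMeasure lam).prod H).withDensity fun p => ENNReal.ofReal p.1
  let M₁ : Measure (Measure X × X) := (μ ⊗ₘ finKernel X).withDensity W
  let M₂ : Measure (Measure X × X) := ((ρ.prod μ).map T).withDensity W
  have hM₁ : ∀ F : Measure X × X → ℝ≥0∞, Measurable F → ∫⁻ p, F p ∂M₁ =
      ∫⁻ g, ∫⁻ x, negExp (g univ) * F (g, x) ∂finKernel X g ∂μ := fun F hF => by
    rw [lintegral_withDensity_eq_lintegral_mul _ hW hF, Measure.lintegral_compProd (hW.mul hF)]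
    rfl
  have hM₂ : ∀ F : Measure X × X → ℝ≥0∞, Measurable F → ∫⁻ p, F p ∂M₂ =
      ∫⁻ p, ENNReal.ofReal p.1 * ∫⁻ g, (negExp ((g + ENNReal.ofReal p.1 • Measure.dirac p.2) univ) *
        F (g + ENNReal.ofReal p.1 • Measure.dirac p.2, p.2)) ∂μ
          ∂(jumpMeasure lam).prod H := fun F hF => by
    have hm : Measurable fun q => (W * F) (T q) := (hW.mul hF).comp hT
    rw [lintegral_withDensity_eq_lintegral_mul _ hW hF, lintegral_map (hW.mul hF) hT,
      lintegral_prod _ hm.aemeasurable, lintegral_withDensity_eq_lintegral_mul _ (by fun_prop)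
      hm.lintegral_prod_right']
    rfl
  have hlap : ∀ f : X → ℝ≥0∞, Measurable f → ∀ A : Set X, MeasurableSet A →
      ∫⁻ p, negExp (∫⁻ x, f x ∂p.1) * A.indicator 1 p.2 ∂M₁ =
        ∫⁻ p, negExp (∫⁻ x, f x ∂p.1) * A.indicator 1 p.2 ∂M₂ := by
    intro f hf A hA
    have hm : Measurable fun p : Measure X × X => negExp (∫⁻ x, f x ∂p.1) * A.indicator 1 p.2 :=
      (measurable_negExp_comp ((measurable_lintegral_measure hf).comp measurable_fst)).mul
        ((measurable_one.indicator hA).comp measurable_snd)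
    have hf1 : Measurable fun x => 1 + f x := hf.const_add 1
    have hone : ∀ g : Measure X, negExp (g univ) * negExp (∫⁻ x, f x ∂g) =
        negExp (∫⁻ x, 1 + f x ∂g) := fun g => by
      rw [lintegral_add_left measurable_const, ← negExp_add]
      simp
    rw [hM₁ _ hm, hM₂ _ hm]
    have hL : ∫⁻ g, ∫⁻ x, negExp (g univ) * (negExp (∫⁻ x, f x ∂g) * A.indicator 1 x)
        ∂finKernel X g ∂μ = ∫⁻ g, negExp (∫⁻ x, 1 + f x ∂g) * g A ∂μ := by
      refine lintegral_congr_ae ?_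
      filter_upwards [h.ae_lt_top] with g hg
      simp_rw [← mul_assoc, hone]
      rw [lintegral_const_mul _ (measurable_one.indicator hA), lintegral_indicator_one hA,
        finKernel_of_lt_top hg]
    rw [hL, h.lintegral_negExp_mul_apply hf1 (fun x => le_self_add) hA, ← h.laplace hf1,
      ← lintegral_const_mul' _ _ (by rw [h.laplace hf1]; exact negExp_ne_top _)]
    refine lintegral_congr fun p => ?_
    rw [mul_left_comm]
    congr 1
    rw [mul_comm, ← lintegral_const_mul _
      (measurable_negExp_comp (measurable_lintegral_measure hf1))]
    refine lintegral_congr fun g => ?_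
    rw [← mul_assoc, hone, lintegral_add_measure, lintegral_smul_measure,
      lintegral_dirac' _ hf1, negExp_add, smul_eq_mul]
    ring
  have hfin₁ : IsFiniteMeasure M₁ := ⟨by
    have h1 := hM₁ (fun _ => 1) measurable_const
    rw [← lintegral_one, h1]
    refine lt_of_le_of_lt (lintegral_mono (g := fun _ => 1) fun g => ?_) (by simp)
    simp only [mul_one, lintegral_const]
    by_cases hg : g univ < ∞
    · rw [finKernel_of_lt_top hg, mul_comm]
      exact (mul_negExp_le_one_sub _).trans tsub_le_self
    · have : g univ = ∞ := by simpa using hg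
      simp [this]⟩
  -- Testing the Laplace identity with `f = 0` and the whole space equates the total masses.
  have hfin₂ : IsFiniteMeasure M₂ := ⟨by
    have h1 := hlap 0 measurable_const univ MeasurableSet.univ
    simp only [Pi.zero_apply, lintegral_zero, negExp_zero, indicator_univ, Pi.one_apply, mul_one,
      lintegral_one] at h1
    rw [← h1]
    exact measure_lt_top _ _⟩
  rw [← hM₁ F hF, ← hM₂ F hF, ext_prod_of_laplace hlap]

/-- The Palm formula for a homogeneous completely random measure. -/
lemma IsCRMLaw.palm (h : IsCRMLaw lam H μ) {F : Measure X × X → ℝ≥0∞} (hF : Measurable F) :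
    ∫⁻ g, ∫⁻ x, F (g, x) ∂finKernel X g ∂μ =
      ∫⁻ p, ENNReal.ofReal p.1 *
        ∫⁻ g, F (g + ENNReal.ofReal p.1 • Measure.dirac p.2, p.2) ∂μ
          ∂(jumpMeasure lam).prod H := by
  have hW : Measurable fun p : Measure X × X => negExp (p.1 univ) :=
    measurable_negExp_comp (measurable_measure_univ.comp measurable_fst)
  -- The weight is removed by dividing the integrand by it; it is nonzero because the total mass is
  -- almost surely finite, also after adding an atom.
  have h1 := h.palm_weighted (F := fun p => (negExp (p.1 univ))⁻¹ * F p) (hW.inv.mul hF)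
  have hc : ∀ g : Measure X, g univ < ∞ → ∀ x,
      negExp (g univ) * ((negExp (g univ))⁻¹ * F (g, x)) = F (g, x) := fun g hg x => by
    rw [← mul_assoc, ENNReal.mul_inv_cancel (by rw [Ne, negExp_eq_zero_iff]; exact hg.ne)
      (negExp_ne_top _), one_mul]
  have hL : ∫⁻ g, ∫⁻ x, negExp (g univ) * ((negExp (g univ))⁻¹ * F (g, x)) ∂finKernel X g ∂μ =
      ∫⁻ g, ∫⁻ x, F (g, x) ∂finKernel X g ∂μ := by
    refine lintegral_congr_ae ?_
    filter_upwards [h.ae_lt_top] with g hg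
    exact lintegral_congr fun x => hc g hg x
  rw [← hL, h1]
  refine lintegral_congr fun p => ?_
  congr 1
  refine lintegral_congr_ae ?_
  filter_upwards [h.ae_lt_top] with g hg
  refine hc _ ?_ _
  rw [Measure.add_apply, Measure.smul_apply]
  exact ENNReal.add_lt_top.2 ⟨hg, by simp⟩

end Palm

/-! ### Integrals against a completely random measure with fixed atoms -/

/-- The measure `w^n λ(w) dw` on `(0, ∞)`. -/
def powJump (lam : ℝ → ℝ≥0∞) (n : ℕ) : Measure ℝ :=
  (jumpMeasure lam).withDensity fun w => ENNReal.ofReal w ^ n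

section PowJump

variable {lam : ℝ → ℝ≥0∞}

lemma IsLevyIntensity.sigmaFinite_powJump (h : IsLevyIntensity lam) (n : ℕ) :
    SigmaFinite (powJump lam n) := by
  have := h.sigmaFinite
  exact SigmaFinite.withDensity_of_ne_top (ae_of_all _ fun w => by simp)

lemma lintegral_powJump (n : ℕ) {f : ℝ → ℝ≥0∞} (hf : Measurable f) :
    ∫⁻ w, f w ∂powJump lam n = ∫⁻ w, ENNReal.ofReal w ^ n * f w ∂jumpMeasure lam := by
  rw [powJump, lintegral_withDensity_eq_lintegral_mul _ (by fun_prop) hf]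
  rfl

lemma lintegral_powJump_succ (n : ℕ) {f : ℝ → ℝ≥0∞} (hf : Measurable f) :
    ∫⁻ w, f w ∂powJump lam (n + 1) = ∫⁻ w, ENNReal.ofReal w * f w ∂powJump lam n := by
  rw [lintegral_powJump _ hf, lintegral_powJump _ (by fun_prop)]
  exact lintegral_congr fun w => by ring

end PowJump

section Lmarginal

open Classical in
lemma lmarginal_congr_measure {ι : Type*} {E : ι → Type*} [∀ i, MeasurableSpace (E i)]
    {μ ν : ∀ i, Measure (E i)} {s : Finset ι} (h : ∀ i ∈ s, μ i = ν i)
    (f : (∀ i, E i) → ℝ≥0∞) : lmarginal μ s f = lmarginal ν s f := by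
  ext x
  have h1 : (fun i : s => μ i) = fun i : s => ν i := funext fun i => h i i.2
  simp only [lmarginal, h1]

end Lmarginal

section FixedAtoms

variable {X : Type*} [MeasurableSpace X]

/-- The discrete measure with mass `w x` at the points `x` of `s`. -/
def atomSum (s : Finset X) (w : X → ℝ) : Measure X :=
  ∑ x ∈ s, ENNReal.ofReal (w x) • Measure.dirac x

lemma measurable_add_atomSum (s : Finset X) :
    Measurable fun q : (X → ℝ) × Measure X => q.2 + atomSum s q.1 := by
  refine Measure.measurable_of_measurable_coe _ fun B hB => ?_
  have h1 : ∀ q : (X → ℝ) × Measure X, (q.2 + atomSum s q.1) B =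
      q.2 B + ∑ x ∈ s, ENNReal.ofReal (q.1 x) * Measure.dirac x B := fun q => by
    simp [atomSum]
  simp_rw [h1]
  refine ((Measure.measurable_coe hB).comp measurable_snd).add
    (Finset.measurable_sum _ fun x _ => Measurable.mul_const ?_ _)
  fun_prop

lemma atomSum_univ_lt_top (s : Finset X) (w : X → ℝ) : atomSum s w univ < ∞ := by
  simp [atomSum, ENNReal.sum_lt_top]

lemma add_atomSum_univ_lt_top {g : Measure X} (hg : g univ < ∞) (s : Finset X) (w : X → ℝ) :
    (g + atomSum s w) univ < ∞ := by
  rw [Measure.add_apply]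
  exact ENNReal.add_lt_top.2 ⟨hg, atomSum_univ_lt_top s w⟩

open Classical in
/-- The integral of `F (G + ∑ₓ wₓ δₓ)`, the sum over the distinct elements `x` of `M`, where `G`
has law `μ` and the `wₓ` are integrated against `w^{n(x)} λ(w) dw`, with `n(x)` the multiplicity
of `x` in `M`. -/
def atomLIntegral (lam : ℝ → ℝ≥0∞) (μ : Measure (Measure X)) (M : Multiset X)
    (F : Measure X → ℝ≥0∞) : ℝ≥0∞ :=
  lmarginal (fun x => powJump lam (M.count x)) M.toFinset
    (fun w => ∫⁻ g, F (g + atomSum M.toFinset w) ∂μ) 0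

variable {lam : ℝ → ℝ≥0∞} {H : Measure X} [IsProbabilityMeasure H]
  {μ : Measure (Measure X)}

lemma measurable_lintegral_add_atomSum [SFinite μ] (s : Finset X) {F : Measure X → ℝ≥0∞}
    (hF : Measurable F) : Measurable fun w : X → ℝ => ∫⁻ g, F (g + atomSum s w) ∂μ :=
  Measurable.lintegral_prod_right' (f := fun q : (X → ℝ) × Measure X => F (q.2 + atomSum s q.1))
    (hF.comp (measurable_add_atomSum s))

open Classical in
lemma atomSum_insert_update {s : Finset X} {y : X} (hy : y ∉ s) (w : X → ℝ) (v : ℝ) :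
    atomSum (insert y s) (Function.update w y v) =
      ENNReal.ofReal v • Measure.dirac y + atomSum s w := by
  rw [atomSum, Finset.sum_insert hy, Function.update_self]
  congr 1
  refine Finset.sum_congr rfl fun x hx => ?_
  rw [Function.update_of_ne (ne_of_mem_of_not_mem hx hy)]

-- Drawing an existing atom again contributes its mass `w`, which raises its power in the
-- integrating measure by one; the set of atoms is unchanged.
open Classical in
lemma IsLevyIntensity.atomLIntegral_cons_of_mem (h : IsLevyIntensity lam) [SFinite μ]
    {M : Multiset X} {x : X} (hx : x ∈ M) {F : Measure X → ℝ≥0∞} (hF : Measurable F) :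
    atomLIntegral lam μ (x ::ₘ M) F =
      lmarginal (fun x => powJump lam (M.count x)) M.toFinset
        (fun w => ENNReal.ofReal (w x) * ∫⁻ g, F (g + atomSum M.toFinset w) ∂μ) 0 := by
  have hσ := h.sigmaFinite_powJump
  have hx' : x ∈ M.toFinset := Multiset.mem_toFinset.2 hx
  have hs : (x ::ₘ M).toFinset = M.toFinset := by
    rw [Multiset.toFinset_cons, Finset.insert_eq_of_mem hx']
  have hm := measurable_lintegral_add_atomSum (μ := μ) M.toFinset hF
  rw [atomLIntegral, hs, lmarginal_erase' _ hm hx', lmarginal_erase' _ (by fun_prop) hx']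
  rw [lmarginal_congr_measure (ν := fun x => powJump lam (M.count x))]
  · congr 1
    ext w
    simp only [Multiset.count_cons_self, Function.update_self]
    exact lintegral_powJump_succ _ (hm.comp (measurable_update w))
  · intro i hi
    rw [Multiset.count_cons_of_ne (Finset.ne_of_mem_erase hi)]

-- A new item enters with multiplicity one, so its weight is integrated against `w λ(w) dw`, and the
-- other multiplicities stay as they were.
open Classical in
lemma IsLevyIntensity.atomLIntegral_cons_of_notMem (h : IsLevyIntensity lam) [SFinite μ]
    {M : Multiset X} {y : X} (hy : y ∉ M) {F : Measure X → ℝ≥0∞} (hF : Measurable F) :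
    atomLIntegral lam μ (y ::ₘ M) F =
      lmarginal (fun x => powJump lam (M.count x)) M.toFinset
        (fun w => ∫⁻ v, ∫⁻ g, F (g + ENNReal.ofReal v • Measure.dirac y +
          atomSum M.toFinset w) ∂μ ∂powJump lam 1) 0 := by
  have hσ := h.sigmaFinite_powJump
  have hy' : y ∉ M.toFinset := fun h => hy (Multiset.mem_toFinset.1 h)
  have hm := measurable_lintegral_add_atomSum (μ := μ) (insert y M.toFinset) hF
  rw [atomLIntegral, Multiset.toFinset_cons, lmarginal_insert' _ hm hy',
    lmarginal_congr_measure (ν := fun x => powJump lam (M.count x))]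
  · congr 1
    ext w
    rw [Multiset.count_cons_self, Multiset.count_eq_zero_of_notMem hy]
    simp_rw [atomSum_insert_update hy', ← add_assoc]
  · intro i hi
    rw [Multiset.count_cons_of_ne (ne_of_mem_of_not_mem hi hy')]

open Classical in
/-- Drawing a further point from a completely random measure with fixed atoms: the point is either
a new one, or one of the fixed atoms. -/
lemma IsCRMLaw.atomLIntegral_lintegral [NullSingletonClass H] [MeasurableSingletonClass X]
    (h : IsCRMLaw lam H μ) (M : Multiset X) {F : Measure X × X → ℝ≥0∞} (hF : Measurable F) :
    atomLIntegral lam μ M (fun g => ∫⁻ y, F (g, y) ∂finKernel X g) =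
      ∫⁻ y, atomLIntegral lam μ (y ::ₘ M) (fun g => F (g, y)) ∂H +
        ∑ x ∈ M.toFinset, atomLIntegral lam μ (x ::ₘ M) fun g => F (g, x) := by
  have hμ := h.isProbabilityMeasure
  have hσ := h.1.sigmaFinite
  have hσ' := h.1.sigmaFinite_powJump
  set s := M.toFinset with hs
  let ρ : X → Measure ℝ := fun x => powJump lam (M.count x)
  have hFx : ∀ x, Measurable fun g => F (g, x) := fun x => hF.comp (by fun_prop)
  let Ψ : X → (X → ℝ) → ℝ≥0∞ := fun y w =>
    ∫⁻ v, ∫⁻ g, F (g + ENNReal.ofReal v • Measure.dirac y + atomSum s w, y) ∂μ ∂powJump lam 1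
  have hshift : ∀ w : X → ℝ, Measurable fun q : Measure X × X => F (q.1 + atomSum s w, q.2) :=
    fun w => hF.comp (((measurable_add_atomSum s).comp
      (measurable_const.prodMk measurable_fst)).prodMk measurable_snd)
  have hT : Measurable fun q : ((X × (X → ℝ)) × ℝ) × Measure X =>
      F (q.2 + ENNReal.ofReal q.1.2 • Measure.dirac q.1.1.1 + atomSum s q.1.1.2, q.1.1.1) := by
    refine hF.comp (Measurable.prodMk ?_ (by fun_prop))
    refine (measurable_add_atomSum s).comp (Measurable.prodMk (by fun_prop) ?_)
    exact measurable_add_smul_dirac.comp (g := fun q : (ℝ × X) × Measure X =>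
      q.2 + ENNReal.ofReal q.1.1 • Measure.dirac q.1.2)
      (f := fun q : ((X × (X → ℝ)) × ℝ) × Measure X => ((q.1.2, q.1.1.1), q.2)) (by fun_prop)
  have hΨ : Measurable (Function.uncurry Ψ) :=
    (hT.lintegral_prod_right').lintegral_prod_right'
  -- For fixed weights, integration against `g + ∑ w_x δ_x` splits: each atom contributes `w_x`, and
  -- the part under `g` becomes a new atom by the Palm formula.
  have key : ∀ w : X → ℝ, ∫⁻ g, ∫⁻ y, F (g + atomSum s w, y) ∂finKernel X (g + atomSum s w) ∂μ =
      ∫⁻ y, Ψ y w ∂H +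
        ∑ x ∈ s, ENNReal.ofReal (w x) * ∫⁻ g, F (g + atomSum s w, x) ∂μ := by
    intro w
    have h1 : ∫⁻ g, ∫⁻ y, F (g + atomSum s w, y) ∂finKernel X (g + atomSum s w) ∂μ =
        ∫⁻ g, (∫⁻ y, F (g + atomSum s w, y) ∂finKernel X g +
          ∑ x ∈ s, ENNReal.ofReal (w x) * F (g + atomSum s w, x)) ∂μ := by
      refine lintegral_congr_ae ?_
      filter_upwards [h.ae_lt_top] with g hg
      rw [finKernel_of_lt_top (add_atomSum_univ_lt_top hg s w), finKernel_of_lt_top hg,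
        lintegral_add_measure]
      congr 1
      rw [atomSum, lintegral_finsetSum_measure]
      refine Finset.sum_congr rfl fun x _ => ?_
      rw [lintegral_smul_measure, lintegral_dirac, smul_eq_mul]
    have hm1 : Measurable fun g => ∫⁻ y, F (g + atomSum s w, y) ∂finKernel X g :=
      measurable_lintegral_finKernel measurable_id
        (F := fun g y => F (g + atomSum s w, y)) (hshift w)
    have hm2 : ∀ x, Measurable fun g => F (g + atomSum s w, x) := fun x =>
      (hshift w).comp (by fun_prop : Measurable fun g : Measure X => (g, x))
    rw [h1, lintegral_add_left hm1, lintegral_finsetSum _ fun x _ => (hm2 x).const_mul _]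
    congr 1
    · rw [h.palm (hshift w), lintegral_prod_symm]
      · refine lintegral_congr fun y => ?_
        rw [show Ψ y w = ∫⁻ v, ∫⁻ g, F (g + ENNReal.ofReal v • Measure.dirac y + atomSum s w, y)
          ∂μ ∂powJump lam 1 from rfl, lintegral_powJump]
        · simp
        · exact (hT.comp (by fun_prop : Measurable fun q : ℝ × Measure X =>
            ((((y, w), q.1), q.2) : ((X × (X → ℝ)) × ℝ) × Measure X))).lintegral_prod_right'
      · refine (Measurable.mul (by fun_prop) ?_).aemeasurable
        exact (hT.comp (by fun_prop : Measurable fun q : (ℝ × X) × Measure X =>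
          ((((q.1.2, w), q.1.1), q.2) : ((X × (X → ℝ)) × ℝ) × Measure X))).lintegral_prod_right'
    · refine Finset.sum_congr rfl fun x _ => ?_
      rw [lintegral_const_mul _ (hm2 x)]
  rw [atomLIntegral, ← hs]
  simp_rw [key]
  have hupd : Measurable fun q : s → ℝ => Function.updateFinset (0 : X → ℝ) s q :=
    measurable_updateFinset
  have hmΨ : Measurable fun w => ∫⁻ y, Ψ y w ∂H :=
    Measurable.lintegral_prod_left' hΨ
  have hmx : ∀ x, Measurable fun w : X → ℝ =>
      ENNReal.ofReal (w x) * ∫⁻ g, F (g + atomSum s w, x) ∂μ := fun x =>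
    (by fun_prop : Measurable fun w : X → ℝ => ENNReal.ofReal (w x)).mul
      (measurable_lintegral_add_atomSum s (hFx x))
  have hmΨ' : Measurable fun q : s → ℝ => ∫⁻ y, Ψ y (Function.updateFinset 0 s q) ∂H :=
    hmΨ.comp hupd
  have hmx' : ∀ x, Measurable fun q : s → ℝ =>
      ENNReal.ofReal (Function.updateFinset (0 : X → ℝ) s q x) *
        ∫⁻ g, F (g + atomSum s (Function.updateFinset 0 s q), x) ∂μ := fun x => (hmx x).comp hupd
  rw [lmarginal, lintegral_add_left hmΨ', lintegral_finsetSum _ fun x _ => hmx' x]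
  congr 1
  · rw [lintegral_lintegral_swap]
    · refine lintegral_congr_ae ?_
      -- As `H` has no atoms, the new point almost surely avoids the finitely many existing items.
      have hnull : ∀ᵐ y ∂H, y ∉ (M.toFinset : Set X) :=
        M.toFinset.countable_toSet.ae_notMem H
      filter_upwards [hnull] with y hy
      rw [h.1.atomLIntegral_cons_of_notMem (by simpa using hy) (hFx y)]
      rfl
    · exact (hΨ.comp ((measurable_snd).prodMk (hupd.comp measurable_fst))).aemeasurable
  · refine Finset.sum_congr rfl fun x hx => ?_
    rw [h.1.atomLIntegral_cons_of_mem (Multiset.mem_toFinset.1 hx) (hFx x)]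
    rfl

end FixedAtoms

/-! ### Repeated draws from a completely random measure -/

section ItemMultiset

variable {X : Type*}

/-- The multiset of the values of a finite family. -/
def itemMultiset {ι : Type*} [Fintype ι] (y : ι → X) : Multiset X := Finset.univ.val.map y

lemma itemMultiset_cons {n : ℕ} (x : X) (y : Fin n → X) :
    itemMultiset (Fin.cons x y : Fin (n + 1) → X) = x ::ₘ itemMultiset y := by
  simp [itemMultiset, Fin.univ_succ, Function.comp_def]

lemma itemMultiset_comp_equiv {ι κ : Type*} [Fintype ι] [Fintype κ] (e : ι ≃ κ) (y : κ → X) :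
    itemMultiset (y ∘ e) = itemMultiset y := by
  rw [itemMultiset, itemMultiset, ← Multiset.map_map, Multiset.map_univ_val_equiv]

end ItemMultiset

section Draws

variable {X : Type*} [MeasurableSpace X] {lam : ℝ → ℝ≥0∞} {H : Measure X}
  [IsProbabilityMeasure H] {μ : Measure (Measure X)}

lemma atomLIntegral_zero (F : Measure X → ℝ≥0∞) :
    atomLIntegral lam μ 0 F = ∫⁻ g, F g ∂μ := by
  simp [atomLIntegral, atomSum]

/-- Integrals over a completely random measure and `n` points drawn from it are a functional of
the integrals over the completely random measure with the drawn points as fixed atoms. -/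
lemma IsCRMLaw.exists_functional_fin [NullSingletonClass H] [MeasurableSingletonClass X]
    (h : IsCRMLaw lam H μ) (n : ℕ) :
    ∃ b : ((Fin n → X) → ℝ≥0∞) → ℝ≥0∞, ∀ F : Measure X × (Fin n → X) → ℝ≥0∞, Measurable F →
      ∫⁻ g, ∫⁻ y, F (g, y) ∂(Measure.pi fun _ => finKernel X g) ∂μ =
        b fun y => atomLIntegral lam μ (itemMultiset y) fun g => F (g, y) := by
  classical
  induction n with
  | zero =>
    refine ⟨fun φ => φ default, fun F hF => ?_⟩
    have h1 : itemMultiset (default : Fin 0 → X) = 0 := rfl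
    beta_reduce
    rw [h1, atomLIntegral_zero]
    refine lintegral_congr fun g => ?_
    have hm : Measurable fun y : Fin 0 → X => F (g, y) := hF.comp measurable_prodMk_left
    rw [Measure.pi_of_empty _ (default : Fin 0 → X), lintegral_dirac' _ hm]
  | succ n ih =>
    obtain ⟨b, hb⟩ := ih
    -- The point in front is either fresh, which gives the integral against `H`, or a repeat of one
    -- of the other items, which gives the sum.
    refine ⟨fun φ => b fun y => ∫⁻ x, φ (Fin.cons x y) ∂H +
      ∑ x ∈ (itemMultiset y).toFinset, φ (Fin.cons x y), fun F hF => ?_⟩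
    have hcons : Measurable fun q : (Measure X × (Fin n → X)) × X =>
        (q.1.1, (Fin.cons q.2 q.1.2 : Fin (n + 1) → X)) := by
      refine Measurable.prodMk (by fun_prop) (measurable_pi_lambda _ fun i => ?_)
      refine Fin.cases ?_ (fun j => ?_) i
      · simpa using measurable_snd
      · simp only [Fin.cons_succ]; fun_prop
    have hF' : Measurable fun q : Measure X × (Fin n → X) =>
        ∫⁻ x, F (q.1, Fin.cons x q.2) ∂finKernel X q.1 :=
      measurable_lintegral_finKernel measurable_fst
        (F := fun q x => F (q.1, Fin.cons x q.2)) (hF.comp hcons)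
    have h1 : ∀ g, ∫⁻ y, F (g, y) ∂(Measure.pi fun _ => finKernel X g) =
        ∫⁻ y, ∫⁻ x, F (g, Fin.cons x y) ∂finKernel X g ∂(Measure.pi fun _ => finKernel X g) := by
      intro g
      have hmp := measurePreserving_piFinSuccAbove (fun _ : Fin (n + 1) => finKernel X g) 0
      have hm : Measurable fun q : X × (Fin n → X) => F (g, Fin.cons q.1 q.2) :=
        hF.comp (hcons.comp (by fun_prop : Measurable fun q : X × (Fin n → X) => ((g, q.2), q.1)))
      rw [← lintegral_prod_symm _ hm.aemeasurable, ← hmp.lintegral_comp hm]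
      refine lintegral_congr fun y => ?_
      congr 2
      exact (Fin.cons_self_tail y).symm
    simp_rw [h1]
    rw [hb _ hF']
    congr 1
    ext y
    have hFy : Measurable fun q : Measure X × X => F (q.1, Fin.cons q.2 y) :=
      hF.comp (hcons.comp (by fun_prop : Measurable fun q : Measure X × X => ((q.1, y), q.2)))
    rw [h.atomLIntegral_lintegral (itemMultiset y) hFy]
    simp_rw [itemMultiset_cons]

lemma pi_pi_map_equiv {ι : Type*} [Fintype ι] {L m : ℕ} (e : Fin L × Fin m ≃ ι) (g : Measure X)
    [IsFiniteMeasure g] :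
    (Measure.pi fun _ : Fin L => Measure.pi fun _ : Fin m => g).map
      (fun y k => y (e.symm k).1 (e.symm k).2) = Measure.pi fun _ : ι => g := by
  refine (Measure.pi_eq fun s hs => ?_).symm
  have hm : Measurable fun (y : Fin L → Fin m → X) (k : ι) => y (e.symm k).1 (e.symm k).2 := by
    fun_prop
  rw [Measure.map_apply hm (MeasurableSet.univ_pi hs)]
  have h1 : (fun (y : Fin L → Fin m → X) (k : ι) => y (e.symm k).1 (e.symm k).2) ⁻¹' univ.pi s =
      univ.pi fun l => univ.pi fun i => s (e (l, i)) := by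
    ext y
    simp only [mem_preimage, Set.mem_pi, mem_univ, true_implies]
    refine ⟨fun hy l i => by simpa using hy (e (l, i)), fun hy k => by
      simpa using hy (e.symm k).1 (e.symm k).2⟩
  rw [h1, Measure.pi_pi]
  simp_rw [Measure.pi_pi]
  rw [← e.prod_comp, Fintype.prod_prod_type]

/-- The lists are flattened into one sequence of draws; the multiset of items does not depend on the
order. -/
lemma IsCRMLaw.exists_functional [NullSingletonClass H] [MeasurableSingletonClass X]
    (h : IsCRMLaw lam H μ) (L m : ℕ) :
    ∃ b : ((Fin L → Fin m → X) → ℝ≥0∞) → ℝ≥0∞,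
      ∀ F : Measure X × (Fin L → Fin m → X) → ℝ≥0∞, Measurable F →
      ∫⁻ g, ∫⁻ y, F (g, y) ∂(Measure.pi fun _ => Measure.pi fun _ => finKernel X g) ∂μ =
        b fun y => atomLIntegral lam μ (itemMultiset fun p : Fin L × Fin m => y p.1 p.2)
          fun g => F (g, y) := by
  obtain ⟨b, hb⟩ := h.exists_functional_fin (Fintype.card (Fin L × Fin m))
  let e := Fintype.equivFin (Fin L × Fin m)
  refine ⟨fun φ => b fun y => φ fun l i => y (e (l, i)), fun F hF => ?_⟩
  have hF' : Measurable fun q : Measure X × (Fin (Fintype.card (Fin L × Fin m)) → X) =>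
      F (q.1, fun l i => q.2 (e (l, i))) := hF.comp (by fun_prop)
  have h1 := hb _ hF'
  have h2 : ∀ g, ∫⁻ y, F (g, y) ∂(Measure.pi fun _ => Measure.pi fun _ => finKernel X g) =
      ∫⁻ y, F (g, fun l i => y (e (l, i))) ∂(Measure.pi fun _ => finKernel X g) := by
    intro g
    have hm : Measurable fun y : Fin (Fintype.card (Fin L × Fin m)) → X =>
        F (g, fun l i => y (e (l, i))) := hF.comp (by fun_prop)
    rw [← pi_pi_map_equiv e, lintegral_map hm (by fun_prop)]
    simp
  simp_rw [h2]
  rw [h1]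
  congr 1
  ext y
  have h3 : (fun p : Fin L × Fin m => y (e (p.1, p.2))) = y ∘ e := rfl
  rw [h3, itemMultiset_comp_equiv]

lemma measurable_add_atomSum_updateFinset (s : Finset X) [DecidableEq X] :
    Measurable fun q : (s → ℝ) × Measure X =>
      q.2 + atomSum s (Function.updateFinset (0 : X → ℝ) s q.1) :=
  (measurable_add_atomSum s).comp
    (Measurable.prodMk (measurable_updateFinset.comp measurable_fst) measurable_snd)

/-- Used to bring the integral over the arrival times outside, so that the posterior can be
identified for fixed lists and times. -/
lemma IsLevyIntensity.atomLIntegral_lintegral_swap (h : IsLevyIntensity lam) [SFinite μ]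
    {β : Type*} [MeasurableSpace β] (ν : Measure β) [SFinite ν] (M : Multiset X)
    {F : Measure X × β → ℝ≥0∞} (hF : Measurable F) :
    atomLIntegral lam μ M (fun g => ∫⁻ b, F (g, b) ∂ν) =
      ∫⁻ b, atomLIntegral lam μ M (fun g => F (g, b)) ∂ν := by
  classical
  have hσ := h.sigmaFinite_powJump
  have hm := measurable_add_atomSum_updateFinset M.toFinset
  have hm2 : Measurable fun q : ((M.toFinset → ℝ) × β) × Measure X =>
      F (q.2 + atomSum M.toFinset (Function.updateFinset (0 : X → ℝ) M.toFinset q.1.1), q.1.2) :=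
    hF.comp (Measurable.prodMk (hm.comp (by fun_prop : Measurable
      fun q : ((M.toFinset → ℝ) × β) × Measure X => (q.1.1, q.2))) (by fun_prop))
  simp only [atomLIntegral, lmarginal]
  refine (lintegral_congr fun q => lintegral_lintegral_swap ?_).trans
    (lintegral_lintegral_swap hm2.lintegral_prod_right'.aemeasurable)
  exact (hm2.comp (by fun_prop : Measurable fun r : Measure X × β => ((q, r.2), r.1))).aemeasurable

end Draws

/-! ### The joint law of the completely random measure and the observations -/

section Arrival

variable {X : Type*} [MeasurableSpace X]

lemma measurable_exponentialPDF :
    Measurable fun q : ℝ × ℝ => exponentialPDF q.1 q.2 := by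
  simp_rw [exponentialPDF_eq]
  refine ENNReal.measurable_ofReal.comp (Measurable.ite ?_ (by fun_prop) measurable_const)
  exact measurableSet_le measurable_const measurable_snd

/-- The density of the arrival times with respect to the Lebesgue measure. -/
def arrivalDensity (g : Measure X) {L m : ℕ} (y : Fin L → Fin m → X) (z : Fin L → Fin m → ℝ) :
    ℝ≥0∞ :=
  ∏ l, ∏ i, exponentialPDF ((finKernel X g).real (remaining (y l) i)) (z l i)

lemma expMeasure_eq_withDensity (r : ℝ) :
    expMeasure r = volume.withDensity (exponentialPDF r) := rfl

lemma pi_arrivalMeasure (g : Measure X) (hg : g univ < ∞) {L m : ℕ} (y : Fin L → Fin m → X) :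
    (Measure.pi fun l : Fin L => arrivalMeasure g (y l)) =
      (Measure.pi fun _ : Fin L => Measure.pi fun _ : Fin m => (volume : Measure ℝ)).withDensity
        (arrivalDensity g y) := by
  have hm : ∀ r, Measurable (exponentialPDF r) := fun r =>
    measurable_exponentialPDF.comp measurable_prodMk_left
  -- A rate may be zero here, and the exponential measure is then the zero measure; σ-finiteness
  -- holds for every rate because the density is finite.
  have hs : ∀ r, SigmaFinite ((volume : Measure ℝ).withDensity (exponentialPDF r)) := fun r =>
    SigmaFinite.withDensity_of_ne_top (ae_of_all _ fun x => ENNReal.ofReal_ne_top)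
  have h1 : ∀ l, arrivalMeasure g (y l) =
      (Measure.pi fun _ : Fin m => (volume : Measure ℝ)).withDensity
        fun z => ∏ i, exponentialPDF (g.real (remaining (y l) i)) (z i) := fun l => by
    unfold arrivalMeasure
    simp_rw [expMeasure_eq_withDensity]
    exact pi_withDensity _ _ fun i => hm _
  have hs2 : ∀ l, SigmaFinite ((Measure.pi fun _ : Fin m => (volume : Measure ℝ)).withDensity
        fun z => ∏ i, exponentialPDF (g.real (remaining (y l) i)) (z i)) := fun l =>
    SigmaFinite.withDensity_of_ne_top (ae_of_all _ fun z =>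
      ENNReal.prod_ne_top fun i _ => ENNReal.ofReal_ne_top)
  simp_rw [h1]
  have hm2 : ∀ l, Measurable fun z : Fin m → ℝ =>
      ∏ i, exponentialPDF (g.real (remaining (y l) i)) (z i) := fun l =>
    Finset.measurable_prod _ fun i _ => (hm _).comp (measurable_pi_apply i)
  rw [pi_withDensity _ _ hm2]
  unfold arrivalDensity
  rw [finKernel_of_lt_top hg]

end Arrival

/-! ### Measurability and densities of Plackett–Luce lists. -/

section Joint

variable {X : Type*}

lemma remaining_update {m : ℕ} (y : Fin m → X) (i : Fin m) (x : X) :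
    remaining (Function.update y i x) i = remaining y i := by
  ext x'
  simp only [remaining, mem_ofPred_eq]
  refine forall₂_congr fun j hj => ?_
  rw [Function.update_of_ne hj.ne]

variable [MeasurableSpace X] [MeasurableEq X]

lemma measurableSet_remaining {m : ℕ} (y : Fin m → X) (i : Fin m) :
    MeasurableSet (remaining y i) := by
  have h : remaining y i = ⋂ j, ⋂ (_ : j < i), {y j}ᶜ := by
    ext x; simp [remaining, eq_comm]
  rw [h]
  exact MeasurableSet.iInter fun j => MeasurableSet.iInter fun _ =>
    (measurableSet_singleton _).compl

lemma measurableSet_mem_remaining {m : ℕ} (i : Fin m) :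
    MeasurableSet {q : (Fin m → X) × X | q.2 ∈ remaining q.1 i} := by
  have h : {q : (Fin m → X) × X | q.2 ∈ remaining q.1 i} =
      ⋂ j, ⋂ (_ : j < i), {q : (Fin m → X) × X | q.1 j = q.2}ᶜ := by
    ext x; simp [remaining]
  rw [h]
  exact MeasurableSet.iInter fun j => MeasurableSet.iInter fun _ =>
    (measurableSet_eq_fun (by fun_prop) (by fun_prop)).compl

lemma measurableSet_injective (m : ℕ) :
    MeasurableSet {y : Fin m → X | Function.Injective y} := by
  have h : {y : Fin m → X | Function.Injective y} =
      ⋂ i, ⋂ j, ⋂ (_ : i ≠ j), {y : Fin m → X | y i = y j}ᶜ := by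
    ext y
    simp only [Function.Injective, mem_ofPred_eq, mem_iInter, mem_compl_iff]
    exact ⟨fun hy i j hij h => hij (hy h), fun hy i j h => by_contra fun hij => hy i j hij h⟩
  rw [h]
  exact MeasurableSet.iInter fun i => MeasurableSet.iInter fun j => MeasurableSet.iInter fun _ =>
    (measurableSet_eq_fun (by fun_prop) (by fun_prop)).compl

/-- The set varies with the list, so its mass is written as a kernel integral of the indicator of a
jointly measurable set; this is where the measurable diagonal enters. -/
lemma measurable_finKernel_remaining {m : ℕ} (i : Fin m) :
    Measurable fun q : Measure X × (Fin m → X) => finKernel X q.1 (remaining q.2 i) := by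
  have h1 : ∀ q : Measure X × (Fin m → X), finKernel X q.1 (remaining q.2 i) =
      ∫⁻ x, {p : (Fin m → X) × X | p.2 ∈ remaining p.1 i}.indicator 1 (q.2, x)
        ∂finKernel X q.1 := fun q => by
    rw [← lintegral_indicator_one (measurableSet_remaining q.2 i)]
    rfl
  simp_rw [h1]
  refine measurable_lintegral_finKernel measurable_fst (F := fun (q : Measure X × (Fin m → X)) x =>
    {p : (Fin m → X) × X | p.2 ∈ remaining p.1 i}.indicator 1 (q.2, x)) ?_
  exact (measurable_one.indicator (measurableSet_mem_remaining i)).comp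
    (by fun_prop : Measurable fun r : (Measure X × (Fin m → X)) × X => (r.1.2, r.2))

lemma measurable_measure_remaining (g : Measure X) (hg : g univ < ∞) {m : ℕ} (i : Fin m) :
    Measurable fun y : Fin m → X => g (remaining y i) := by
  have h1 := (measurable_finKernel_remaining (X := X) i).comp (measurable_prodMk_left (x := g))
  simpa [Function.comp_def, finKernel_of_lt_top hg] using h1

open Classical in
/-- The density of the Plackett--Luce lists with respect to the product measure. -/
def plDensity (g : Measure X) {L m : ℕ} (y : Fin L → Fin m → X) : ℝ≥0∞ :=
  ∏ l, if Function.Injective (y l) then ∏ i, (finKernel X g (remaining (y l) i))⁻¹ else 0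

lemma measurable_plDensity (L m : ℕ) :
    Measurable fun q : Measure X × (Fin L → Fin m → X) => plDensity q.1 q.2 := by
  unfold plDensity
  refine Finset.measurable_prod _ fun l _ => ?_
  refine Measurable.ite ?_ (Finset.measurable_prod _ fun i _ => ?_) measurable_const
  · exact (by fun_prop : Measurable fun q : Measure X × (Fin L → Fin m → X) => q.2 l)
      (measurableSet_injective m)
  · exact ((measurable_finKernel_remaining i).comp (by fun_prop : Measurable
      fun q : Measure X × (Fin L → Fin m → X) => (q.1, q.2 l))).inv

lemma measurable_arrivalDensity (L m : ℕ) :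
    Measurable fun q : (Measure X × (Fin L → Fin m → X)) × (Fin L → Fin m → ℝ) =>
      arrivalDensity q.1.1 q.1.2 q.2 := by
  unfold arrivalDensity
  refine Finset.measurable_prod _ fun l _ => Finset.measurable_prod _ fun i _ => ?_
  refine measurable_exponentialPDF.comp (Measurable.prodMk ?_ (by fun_prop))
  exact ((measurable_finKernel_remaining i).comp (by fun_prop : Measurable
      fun q : (Measure X × (Fin L → Fin m → X)) × (Fin L → Fin m → ℝ) =>
        (q.1.1, q.1.2 l))).ennreal_toReal

/-- In an injective list `y i` lies in its own remaining set. If that set is null, `y i` lies in a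
null set determined by the other coordinates. This makes the Plackett–Luce density finite almost
everywhere, even when `g` has fewer than `m` atoms. -/
lemma ae_measure_remaining_ne_zero (g : Measure X) [IsFiniteMeasure g] (m : ℕ) :
    ∀ᵐ y ∂(Measure.pi fun _ : Fin m => g), Function.Injective y → ∀ i, g (remaining y i) ≠ 0 := by
  rcases isEmpty_or_nonempty (Fin m → X) with hE | ⟨⟨y₀⟩⟩
  · exact Eventually.of_forall fun y => hE.elim y
  have key : ∀ i : Fin m, ∀ᵐ y ∂(Measure.pi fun _ : Fin m => g),
      ¬ (y i ∈ remaining y i ∧ g (remaining y i) = 0) := by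
    intro i
    have hg := measurable_measure_remaining g (measure_lt_top g univ) i
    have hS : MeasurableSet {y : Fin m → X | y i ∈ remaining y i ∧ g (remaining y i) = 0} := by
      refine MeasurableSet.inter ?_ (hg (measurableSet_singleton 0))
      exact (by fun_prop : Measurable fun y : Fin m → X => (y, y i)) (measurableSet_mem_remaining i)
    rw [ae_iff]
    simp only [not_not]
    rw [← lintegral_indicator_one hS, lintegral_eq_lmarginal_univ y₀,
      lmarginal_erase' _ (measurable_one.indicator hS) (Finset.mem_univ i)]
    -- Coordinate `i` is integrated out first: the remaining set at stage `i` does not involve it.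
    have h0 : (fun y : Fin m → X => ∫⁻ x, {y : Fin m → X | y i ∈ remaining y i ∧
        g (remaining y i) = 0}.indicator 1 (Function.update y i x) ∂g) = fun _ => (0 : ℝ≥0∞) := by
      ext y
      by_cases hy : g (remaining y i) = 0
      · rw [← nonpos_iff_eq_zero, ← hy, ← lintegral_indicator_one (measurableSet_remaining y i)]
        refine lintegral_mono fun x => ?_
        by_cases hx : x ∈ remaining y i
        · rw [indicator_of_mem hx]
          exact indicator_le_self' (by simp) _
        · rw [indicator_of_notMem]
          · exact zero_le
          · simp [remaining_update, hx]
      · simp [indicator, remaining_update, hy]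
    rw [h0]
    simp [lmarginal]
  filter_upwards [ae_all_iff.2 key] with y hy hinj i h0
  exact hy i ⟨fun j hj h => hj.ne (hinj h), h0⟩

open Classical in
lemma sigmaFinite_plMeasure (g : Measure X) [IsFiniteMeasure g] (m : ℕ) :
    SigmaFinite (plMeasure g m) := by
  refine SigmaFinite.withDensity_of_ne_top ?_
  filter_upwards [ae_measure_remaining_ne_zero g m] with y hy
  split_ifs with h
  · exact ENNReal.prod_ne_top fun i _ => by simpa using hy h i
  · simp

lemma measurable_ite_injective (g : Measure X) (hg : g univ < ∞) (m : ℕ)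
    {_ : DecidablePred fun y : Fin m → X => Function.Injective y} :
    Measurable fun y : Fin m → X =>
      if Function.Injective y then ∏ i, (g (remaining y i))⁻¹ else 0 :=
  Measurable.ite (measurableSet_injective m) (Finset.measurable_prod _ fun i _ =>
    (measurable_measure_remaining g hg i).inv) measurable_const

lemma pi_plMeasure (g : Measure X) (hg : g univ < ∞) (L m : ℕ) :
    (Measure.pi fun _ : Fin L => plMeasure g m) =
      (Measure.pi fun _ : Fin L => Measure.pi fun _ : Fin m => finKernel X g).withDensity
        (plDensity g) := by
  have hgf : IsFiniteMeasure g := ⟨hg⟩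
  have h1 := sigmaFinite_plMeasure g m
  unfold plMeasure at h1 ⊢
  rw [pi_withDensity _ _ fun _ : Fin L => measurable_ite_injective g hg m]
  unfold plDensity
  rw [finKernel_of_lt_top hg]

end Joint

/-! ### The joint law in density form. -/

section Joint

lemma HasCondLaw.lintegral {Ω α β : Type*} [MeasurableSpace Ω] [MeasurableSpace α]
    [MeasurableSpace β] {U : Ω → α} {V : Ω → β} {P : Measure Ω} [IsProbabilityMeasure P]
    {p : β → Measure α → Prop}
    (h : HasCondLaw U V P p) (hU : Measurable U) (hV : Measurable V) {ρ : β → Measure α}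
    {f : β → α → ℝ≥0∞} (hf : Measurable (Function.uncurry f))
    (hp : ∀ᵐ b ∂P.map V, ∀ ξ, p b ξ → ξ = (ρ b).withDensity (f b))
    {F : β × α → ℝ≥0∞} (hF : Measurable F) :
    ∫⁻ ω, F (V ω, U ω) ∂P = ∫⁻ b, ∫⁻ a, f b a * F (b, a) ∂ρ b ∂(P.map V) := by
  obtain ⟨κ, hκ, hd, ha⟩ := h
  have hPV : IsProbabilityMeasure (P.map V) := Measure.isProbabilityMeasure_map hV.aemeasurable
  rw [← lintegral_map hF (hV.prodMk hU), hd.map_eq, Measure.lintegral_compProd hF]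
  refine lintegral_congr_ae ?_
  filter_upwards [hp, ha] with b hb hab
  have hm1 : Measurable (f b) := hf.comp measurable_prodMk_left
  have hm2 : Measurable fun a => F (b, a) := hF.comp measurable_prodMk_left
  rw [hb _ hab, lintegral_withDensity_eq_lintegral_mul _ hm1 hm2]
  rfl

variable {X : Type*} [MeasurableSpace X] [MeasurableEq X]

variable {Ω : Type*} [MeasurableSpace Ω] {P : Measure Ω} [IsProbabilityMeasure P] {L m : ℕ}
  {G : Ω → Measure X} {Y : Ω → Fin L → Fin m → X} {Z : Ω → Fin L → Fin m → ℝ}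

/-- The reference law is independent draws from `g` itself and Lebesgue measure for the times, so
that the Palm formula can act on the draws and the densities can be multiplied pointwise. -/
lemma lintegral_joint (hGm : Measurable G) (hYm : Measurable Y) (hZm : Measurable Z)
    (hfin : ∀ᵐ g ∂P.map G, g univ < ∞)
    (hY : HasCondLaw Y G P fun g ξ => ξ = Measure.pi fun _ : Fin L => plMeasure g m)
    (hZ : HasCondLaw Z (fun ω => (G ω, Y ω)) P fun b ξ =>
      ξ = Measure.pi fun l : Fin L => arrivalMeasure b.1 (b.2 l))
    {F : (Measure X × (Fin L → Fin m → X)) × (Fin L → Fin m → ℝ) → ℝ≥0∞} (hF : Measurable F) :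
    ∫⁻ ω, F ((G ω, Y ω), Z ω) ∂P =
      ∫⁻ g, ∫⁻ y, (∫⁻ z, plDensity g y * (arrivalDensity g y z * F ((g, y), z))
        ∂(Measure.pi fun _ : Fin L => Measure.pi fun _ : Fin m => (volume : Measure ℝ)))
          ∂(Measure.pi fun _ => Measure.pi fun _ => finKernel X g) ∂(P.map G) := by
  have hGY : Measurable fun ω => (G ω, Y ω) := hGm.prodMk hYm
  have hAF : Measurable fun q : (Measure X × (Fin L → Fin m → X)) × (Fin L → Fin m → ℝ) =>
      arrivalDensity q.1.1 q.1.2 q.2 * F q := (measurable_arrivalDensity L m).mul hF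
  have hfin' : ∀ᵐ b ∂P.map (fun ω => (G ω, Y ω)), b.1 univ < ∞ := by
    have h1 : (P.map fun ω => (G ω, Y ω)).map Prod.fst = P.map G := by
      rw [Measure.map_map measurable_fst hGY]; rfl
    rw [← h1] at hfin
    exact ae_of_ae_map measurable_fst.aemeasurable hfin
  have hpZ : ∀ᵐ b ∂P.map (fun ω => (G ω, Y ω)), ∀ ξ : Measure (Fin L → Fin m → ℝ),
      (ξ = Measure.pi fun l : Fin L => arrivalMeasure b.1 (b.2 l)) →
      ξ = (Measure.pi fun _ : Fin L => Measure.pi fun _ : Fin m =>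
        (volume : Measure ℝ)).withDensity (arrivalDensity b.1 b.2) := by
    filter_upwards [hfin'] with b hb ξ hξ
    rw [hξ, pi_arrivalMeasure b.1 hb]
  have hpY : ∀ᵐ g ∂P.map G, ∀ ξ : Measure (Fin L → Fin m → X),
      (ξ = Measure.pi fun _ : Fin L => plMeasure g m) →
      ξ = (Measure.pi fun _ : Fin L => Measure.pi fun _ : Fin m => finKernel X g).withDensity
        (plDensity g) := by
    filter_upwards [hfin] with g hg ξ hξ
    rw [hξ, pi_plMeasure g hg]
  have h1 := hZ.lintegral (f := fun b z => arrivalDensity b.1 b.2 z) hZm hGY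
    (measurable_arrivalDensity L m) hpZ hF
  have hJ := hAF.lintegral_prod_right'
    (ν := Measure.pi fun _ : Fin L => Measure.pi fun _ : Fin m => (volume : Measure ℝ))
  have h2 := hY.lintegral (f := fun g y => plDensity g y) hYm hGm (measurable_plDensity L m) hpY hJ
  have h3 : ∀ g y, plDensity g y * ∫⁻ z, arrivalDensity g y z * F ((g, y), z)
        ∂(Measure.pi fun _ : Fin L => Measure.pi fun _ : Fin m => (volume : Measure ℝ)) =
      ∫⁻ z, plDensity g y * (arrivalDensity g y z * F ((g, y), z))
        ∂(Measure.pi fun _ : Fin L => Measure.pi fun _ : Fin m => (volume : Measure ℝ)) := fun g y =>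
    (lintegral_const_mul _ (hAF.comp (measurable_prodMk_left (x := (g, y))))).symm
  simp_rw [← h3]
  exact h1.trans ((lintegral_map hJ hGY).trans h2)

end Joint

/-! ### The posterior law -/

section Statistics

variable {X : Type*} {L m : ℕ} (y : Fin L → Fin m → X)

open Classical in
lemma toFinset_itemMultiset :
    (itemMultiset fun p : Fin L × Fin m => y p.1 p.2).toFinset = uniqueItems y := by
  ext x
  simp [itemMultiset, uniqueItems]

open Classical in
lemma count_itemMultiset (x : X) :
    (itemMultiset fun p : Fin L × Fin m => y p.1 p.2).count x = occurrences y x := by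
  rw [itemMultiset, Multiset.count_map, occurrences, Finset.card_def, Finset.filter_val]
  simp_rw [eq_comm]

lemma mem_uniqueItems_iff {x : X} : x ∈ uniqueItems y ↔ ∃ l i, y l i = x := by
  simp [uniqueItems]

lemma occurrences_ne_zero {x : X} (hx : x ∈ uniqueItems y) : occurrences y x ≠ 0 := by
  classical
  rw [← count_itemMultiset]
  exact Multiset.count_ne_zero.2 (Multiset.mem_toFinset.1 (by rwa [toFinset_itemMultiset]))

lemma occIndicator_nonneg (l : Fin L) (i : Fin m) (x : X) : 0 ≤ occIndicator y l i x := by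
  unfold occIndicator; split_ifs <;> simp

lemma totalTime_nonneg {z : Fin L → Fin m → ℝ} (hz : ∀ l i, 0 < z l i) : 0 ≤ totalTime z :=
  Finset.sum_nonneg fun l _ => Finset.sum_nonneg fun i _ => (hz l i).le

lemma ofReal_totalTime {z : Fin L → Fin m → ℝ} (hz : ∀ l i, 0 < z l i) :
    ENNReal.ofReal (totalTime z) = ∑ l, ∑ i, ENNReal.ofReal (z l i) := by
  rw [totalTime, ENNReal.ofReal_sum_of_nonneg
    fun l _ => Finset.sum_nonneg fun i _ => (hz l i).le]
  exact Finset.sum_congr rfl fun l _ => ENNReal.ofReal_sum_of_nonneg fun i _ => (hz l i).le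

lemma ofReal_itemTime {z : Fin L → Fin m → ℝ} (hz : ∀ l i, 0 < z l i) (x : X) :
    ENNReal.ofReal (itemTime y z x) =
      ∑ l, ∑ i, ENNReal.ofReal (occIndicator y l i x) * ENNReal.ofReal (z l i) := by
  have h0 : ∀ l i, 0 ≤ occIndicator y l i x * z l i := fun l i =>
    mul_nonneg (occIndicator_nonneg y l i x) (hz l i).le
  rw [itemTime, ENNReal.ofReal_sum_of_nonneg fun l _ => Finset.sum_nonneg fun i _ => h0 l i]
  refine Finset.sum_congr rfl fun l _ => ?_
  rw [ENNReal.ofReal_sum_of_nonneg fun i _ => h0 l i]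
  exact Finset.sum_congr rfl fun i _ => ENNReal.ofReal_mul (occIndicator_nonneg y l i x)

lemma itemTime_pos {z : Fin L → Fin m → ℝ} (hz : ∀ l i, 0 < z l i) {x : X}
    (hx : x ∈ uniqueItems y) : 0 < itemTime y z x := by
  obtain ⟨l, i, hli⟩ := (mem_uniqueItems_iff y).1 hx
  have h0 : ∀ l i, 0 ≤ occIndicator y l i x * z l i := fun l i =>
    mul_nonneg (occIndicator_nonneg y l i x) (hz l i).le
  refine Finset.sum_pos' (fun l _ => Finset.sum_nonneg fun i _ => h0 l i) ⟨l, Finset.mem_univ _, ?_⟩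
  -- No item has been removed before stage `0`, so that stage always counts; it exists because the
  -- list contains `x`.
  refine Finset.sum_pos' (fun i _ => h0 l i) ⟨⟨0, i.pos⟩, Finset.mem_univ _, ?_⟩
  have h1 : occIndicator y l ⟨0, i.pos⟩ x = 1 := by
    rw [occIndicator, if_neg]
    rintro ⟨j, hj, -⟩
    exact absurd (Fin.lt_def.1 hj) (Nat.not_lt_zero _)
  rw [h1, one_mul]
  exact hz _ _

variable [MeasurableSpace X]

lemma measure_remaining_of_null {g : Measure X} (hg : ∀ l i, g {y l i} = 0) (l : Fin L)
    (i : Fin m) : g (remaining (y l) i) = g univ := by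
  refine measure_congr ?_
  have h1 : ∀ᵐ x ∂g, ∀ j, x ≠ y l j := ae_all_iff.2 fun j => by
    have h2 := measure_eq_zero_iff_ae_notMem.1 (hg l j)
    simpa using h2
  filter_upwards [h1] with x hx
  exact propext ⟨fun _ => trivial, fun _ j _ h => hx j h.symm⟩

variable [MeasurableEq X]

lemma dirac_remaining (l : Fin L) (i : Fin m) (x : X) :
    Measure.dirac x (remaining (y l) i) = ENNReal.ofReal (occIndicator y l i x) := by
  rw [Measure.dirac_apply' _ (measurableSet_remaining _ _), occIndicator]
  split_ifs with h
  · simpa [remaining] using h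
  · have h1 : x ∈ remaining (y l) i := fun j hj hjx => h ⟨j, hj, hjx⟩
    rw [indicator_of_mem h1]
    simp

lemma add_atomSum_remaining {g : Measure X} (hg : ∀ l i, g {y l i} = 0) (s : Finset X) (w : X → ℝ)
    (l : Fin L) (i : Fin m) :
    (g + atomSum s w) (remaining (y l) i) =
      g univ + ∑ x ∈ s, ENNReal.ofReal (w x) * ENNReal.ofReal (occIndicator y l i x) := by
  rw [Measure.add_apply, measure_remaining_of_null y hg, atomSum, Measure.finsetSum_apply]
  simp_rw [Measure.smul_apply, dirac_remaining, smul_eq_mul]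

end Statistics

/-! ### Cancellation and factorisation of the likelihood. -/

section Density

variable {X : Type*} [MeasurableSpace X] {L m : ℕ}

/-- The joint density of the lists and the arrival times, apart from the condition that the lists
consist of distinct items and the arrival times are positive. -/
def timeDensity (g : Measure X) (y : Fin L → Fin m → X) (z : Fin L → Fin m → ℝ) : ℝ≥0∞ :=
  negExp (∑ l, ∑ i, ENNReal.ofReal (z l i) * finKernel X g (remaining (y l) i))

/-- The exponential density has the rate as a prefactor, and it is this prefactor that cancels the
Plackett–Luce denominator. The latent times serve exactly this purpose. -/
lemma inv_mul_exponentialPDF {r : ℝ≥0∞} (h0 : r ≠ 0) (ht : r ≠ ∞) {z : ℝ} (hz : 0 < z) :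
    r⁻¹ * exponentialPDF r.toReal z = negExp (ENNReal.ofReal z * r) := by
  have h1 : negExp (ENNReal.ofReal z * r) = ENNReal.ofReal (Real.exp (-(r.toReal * z))) := by
    rw [← ENNReal.ofReal_toReal ht, ← ENNReal.ofReal_mul hz.le, negExp_ofReal (by positivity),
      ENNReal.toReal_ofReal ENNReal.toReal_nonneg, mul_comm]
  rw [h1, exponentialPDF_eq, if_pos hz.le, ENNReal.ofReal_mul ENNReal.toReal_nonneg,
    ENNReal.ofReal_toReal ht, ← mul_assoc, ENNReal.inv_mul_cancel h0 ht, one_mul]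

open Classical in
lemma plDensity_mul_arrivalDensity {g : Measure X} {y : Fin L → Fin m → X}
    (h0 : ∀ l i, finKernel X g (remaining (y l) i) ≠ 0) {z : Fin L → Fin m → ℝ}
    (hz : ∀ l i, 0 < z l i) :
    plDensity g y * arrivalDensity g y z =
      if ∀ l, Function.Injective (y l) then timeDensity g y z else 0 := by
  rw [plDensity, arrivalDensity, ← Finset.prod_mul_distrib]
  split_ifs with h
  · simp_rw [timeDensity, negExp_sum]
    refine Finset.prod_congr rfl fun l _ => ?_
    rw [if_pos (h l), ← Finset.prod_mul_distrib]
    exact Finset.prod_congr rfl fun i _ =>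
      inv_mul_exponentialPDF (h0 l i) (measure_ne_top _ _) (hz l i)
  · push Not at h
    obtain ⟨l, hl⟩ := h
    exact Finset.prod_eq_zero (Finset.mem_univ l) (by rw [if_neg hl, zero_mul])

lemma arrivalDensity_of_neg (g : Measure X) (y : Fin L → Fin m → X) {z : Fin L → Fin m → ℝ}
    {l : Fin L} {i : Fin m} (hz : z l i < 0) : arrivalDensity g y z = 0 :=
  Finset.prod_eq_zero (Finset.mem_univ l) (Finset.prod_eq_zero (Finset.mem_univ i) (by
    rw [exponentialPDF_eq, if_neg (not_le.2 hz), ENNReal.ofReal_zero]))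

variable [MeasurableEq X]

lemma measurable_timeDensity (L m : ℕ) :
    Measurable fun q : Measure X × (Fin L → Fin m → X) × (Fin L → Fin m → ℝ) =>
      timeDensity q.1 q.2.1 q.2.2 := by
  refine measurable_negExp_comp (Finset.measurable_sum _ fun l _ => Finset.measurable_sum _
    fun i _ => Measurable.mul (by fun_prop) ?_)
  exact (measurable_finKernel_remaining i).comp (by fun_prop : Measurable
    fun q : Measure X × (Fin L → Fin m → X) × (Fin L → Fin m → ℝ) => (q.1, q.2.1 l))

/-- The exponent is linear in the measure. The diffuse part of the draws sees every remaining set as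
the whole space because `g` gives no mass to the listed items, while the atom at `x` is counted only
at stages where `x` is still available. Posterior independence of the components comes from this
product. -/
lemma timeDensity_add_atomSum {g : Measure X} (hfin : g univ < ∞) {y : Fin L → Fin m → X}
    (hg : ∀ l i, g {y l i} = 0) (s : Finset X) (w : X → ℝ) {z : Fin L → Fin m → ℝ}
    (hz : ∀ l i, 0 < z l i) :
    timeDensity (g + atomSum s w) y z = negExp (ENNReal.ofReal (totalTime z) * g univ) *
      ∏ x ∈ s, negExp (ENNReal.ofReal (w x) * ENNReal.ofReal (itemTime y z x)) := by
  rw [timeDensity, finKernel_of_lt_top (add_atomSum_univ_lt_top hfin s w), ← negExp_sum,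
    ← negExp_add]
  congr 1
  simp_rw [add_atomSum_remaining y hg, ofReal_totalTime hz, ofReal_itemTime y hz, mul_add,
    Finset.sum_add_distrib, Finset.sum_mul, Finset.mul_sum]
  congr 1
  have h1 : ∀ l, ∑ i, ∑ x ∈ s, ENNReal.ofReal (z l i) *
      (ENNReal.ofReal (w x) * ENNReal.ofReal (occIndicator y l i x)) =
      ∑ x ∈ s, ∑ i, ENNReal.ofReal (w x) *
        (ENNReal.ofReal (occIndicator y l i x) * ENNReal.ofReal (z l i)) := fun l => by
    rw [Finset.sum_comm]
    exact Finset.sum_congr rfl fun x _ => Finset.sum_congr rfl fun i _ => by ring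
  simp_rw [h1]
  exact Finset.sum_comm

end Density

/-! ### Normalisation of the posterior. -/

section Posterior

open Classical in
lemma atomSum_updateFinset {X : Type*} [MeasurableSpace X] (s : Finset X) (q : s → ℝ) :
    atomSum s (Function.updateFinset (0 : X → ℝ) s q) =
      ∑ x : s, ENNReal.ofReal (q x) • Measure.dirac (x : X) := by
  rw [atomSum, ← Finset.sum_coe_sort]
  exact Finset.sum_congr rfl fun x _ => by simp [Function.updateFinset]

lemma massLaw_eq_withDensity_powJump {lam : ℝ → ℝ≥0∞} (h : IsLevyIntensity lam) (n : ℕ) {s : ℝ}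
    (hs : 0 ≤ s) :
    massLaw lam n s = (powJump lam n).withDensity fun w =>
      negExp (ENNReal.ofReal w * ENNReal.ofReal s) * (kappa lam n s)⁻¹ := by
  rw [massLaw_eq h, powJump, ← withDensity_mul _ (by fun_prop) (by fun_prop)]
  refine withDensity_congr_ae ?_
  filter_upwards [ae_jumpMeasure_pos lam] with w hw
  rw [Pi.mul_apply, ← mul_assoc, ← ENNReal.ofReal_mul hw.le, negExp_ofReal (by positivity),
    ← ENNReal.ofReal_pow hw.le, ← ENNReal.ofReal_mul (by positivity)]

lemma IsLevyIntensity.isProbabilityMeasure_massLaw_item {lam : ℝ → ℝ≥0∞} {X : Type*} {L m : ℕ}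
    {y : Fin L → Fin m → X} {z : Fin L → Fin m → ℝ} (h : IsLevyIntensity lam)
    (hz : ∀ l i, 0 < z l i) (x : uniqueItems y) :
    IsProbabilityMeasure (massLaw lam (occurrences y (x : X)) (itemTime y z (x : X))) :=
  h.isProbabilityMeasure_massLaw (occurrences_ne_zero y x.2) (itemTime_pos y hz x.2)

/-- Each `κ` is the normalising constant of one tilted jump measure; positive times and positive
multiplicities make it finite, so it can be cancelled. -/
lemma IsLevyIntensity.lintegral_pi_massLaw {lam : ℝ → ℝ≥0∞} {X : Type*} {L m : ℕ}
    {y : Fin L → Fin m → X} {z : Fin L → Fin m → ℝ} (h : IsLevyIntensity lam) (hz : ∀ l i, 0 < z l i)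
    {Φ : (uniqueItems y → ℝ) → ℝ≥0∞} (hΦ : Measurable Φ) :
    (∏ x : uniqueItems y, kappa lam (occurrences y x) (itemTime y z x)) *
      ∫⁻ w, Φ w ∂(Measure.pi fun x : uniqueItems y =>
        massLaw lam (occurrences y x) (itemTime y z x)) =
      ∫⁻ w, (∏ x, negExp (ENNReal.ofReal (w x) * ENNReal.ofReal (itemTime y z x))) * Φ w
        ∂(Measure.pi fun x : uniqueItems y => powJump lam (occurrences y x)) := by
  have hσ := h.sigmaFinite_powJump
  have hP := h.isProbabilityMeasure_massLaw_item (y := y) hz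
  have he : ∀ x : uniqueItems y, massLaw lam (occurrences y (x : X)) (itemTime y z (x : X)) = _ :=
    fun x => massLaw_eq_withDensity_powJump h _ (itemTime_pos y hz x.2).le
  simp_rw [he] at hP ⊢
  have hm : ∀ x : uniqueItems y, Measurable fun w : ℝ => negExp (ENNReal.ofReal w *
      ENNReal.ofReal (itemTime y z x)) * (kappa lam (occurrences y (x : X)) (itemTime y z x))⁻¹ :=
    fun x => by fun_prop
  have hm' : Measurable fun w : uniqueItems y → ℝ => ∏ x : uniqueItems y,
      negExp (ENNReal.ofReal (w x) * ENNReal.ofReal (itemTime y z x)) *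
        (kappa lam (occurrences y (x : X)) (itemTime y z x))⁻¹ :=
    Finset.measurable_prod _ fun x _ => (hm x).comp (measurable_pi_apply x)
  rw [pi_withDensity _ _ hm, lintegral_withDensity_eq_lintegral_mul _ hm' hΦ,
    ← lintegral_const_mul _ (hm'.mul hΦ)]
  refine lintegral_congr fun w => ?_
  rw [Pi.mul_apply, ← mul_assoc, ← Finset.prod_mul_distrib]
  congr 1
  refine Finset.prod_congr rfl fun x _ => ?_
  rw [mul_left_comm, ENNReal.mul_inv_cancel (h.kappa_ne_zero _ _)
    (h.kappa_ne_top (occurrences_ne_zero y x.2) (itemTime_pos y hz x.2)), mul_one]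

variable {X : Type*} [MeasurableSpace X] {L m : ℕ}

/-- The law of `G* + ∑ₓ wₓ δₓ`, the sum running over the unique items `x` of the lists `y`, for
independent `G*` and `wₓ`, where `G*` has the tilted law. -/
def posteriorLaw (lam : ℝ → ℝ≥0∞) (μ : Measure (Measure X)) (y : Fin L → Fin m → X)
    (z : Fin L → Fin m → ℝ) : Measure (Measure X) :=
  ((tiltLaw μ (totalTime z)).prod (Measure.pi fun x : uniqueItems y =>
    massLaw lam (occurrences y x) (itemTime y z x))).map
      fun p => p.1 + ∑ x : uniqueItems y, ENNReal.ofReal (p.2 x) • Measure.dirac (x : X)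

/-- The density of the lists and the arrival times with respect to the law of lists drawn
independently and the Lebesgue measure. -/
def evidence (lam : ℝ → ℝ≥0∞) (μ : Measure (Measure X)) (y : Fin L → Fin m → X)
    (z : Fin L → Fin m → ℝ) : ℝ≥0∞ :=
  (∫⁻ g, negExp (ENNReal.ofReal (totalTime z) * g univ) ∂μ) *
    ∏ x : uniqueItems y, kappa lam (occurrences y x) (itemTime y z x)

lemma measurable_add_sum_dirac (s : Finset X) :
    Measurable fun p : Measure X × (s → ℝ) =>
      p.1 + ∑ x : s, ENNReal.ofReal (p.2 x) • Measure.dirac (x : X) := by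
  classical
  simp_rw [← atomSum_updateFinset]
  exact (measurable_add_atomSum_updateFinset s).comp measurable_swap

variable {lam : ℝ → ℝ≥0∞} {H : Measure X} [IsProbabilityMeasure H] {μ : Measure (Measure X)}
  {y : Fin L → Fin m → X} {z : Fin L → Fin m → ℝ}

lemma IsCRMLaw.isPosteriorLaw_posteriorLaw (h : IsCRMLaw lam H μ) (hz : ∀ l i, 0 < z l i) :
    IsPosteriorLaw lam H y z (posteriorLaw lam μ y z) :=
  ⟨_, h.tiltLaw (totalTime_nonneg hz), rfl⟩

lemma IsCRMLaw.isProbabilityMeasure_posteriorLaw (h : IsCRMLaw lam H μ)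
    (hz : ∀ l i, 0 < z l i) : IsProbabilityMeasure (posteriorLaw lam μ y z) := by
  have h1 := h.isProbabilityMeasure_tiltLaw (totalTime_nonneg hz)
  have h2 := h.1.isProbabilityMeasure_massLaw_item (y := y) hz
  exact Measure.isProbabilityMeasure_map (measurable_add_sum_dirac _).aemeasurable

lemma IsCRMLaw.evidence_ne_zero (h : IsCRMLaw lam H μ) : evidence lam μ y z ≠ 0 :=
  mul_ne_zero (h.lintegral_negExp_univ_ne_zero _)
    (Finset.prod_ne_zero_iff.2 fun _ _ => h.1.kappa_ne_zero _ _)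

lemma IsCRMLaw.evidence_ne_top (h : IsCRMLaw lam H μ) (hz : ∀ l i, 0 < z l i) :
    evidence lam μ y z ≠ ∞ :=
  ENNReal.mul_ne_top (h.lintegral_negExp_univ_ne_top _) (ENNReal.prod_ne_top fun x _ =>
    h.1.kappa_ne_top (occurrences_ne_zero y x.2) (itemTime_pos y hz x.2))

variable [NullSingletonClass H] [MeasurableEq X]

/-- Bayes' rule for fixed lists and times. The factorised likelihood is distributed over the random
measure and the weights, and the normalising constants collected along the way form the evidence. -/
lemma IsCRMLaw.atomLIntegral_timeDensity_mul (h : IsCRMLaw lam H μ) (hz : ∀ l i, 0 < z l i)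
    {F : Measure X → ℝ≥0∞} (hF : Measurable F) :
    atomLIntegral lam μ (itemMultiset fun p : Fin L × Fin m => y p.1 p.2)
      (fun g => timeDensity g y z * F g) =
      evidence lam μ y z * ∫⁻ g, F g ∂posteriorLaw lam μ y z := by
  classical
  have hμ := h.isProbabilityMeasure
  have h1 := h.isProbabilityMeasure_tiltLaw (totalTime_nonneg hz)
  have h2 := h.1.isProbabilityMeasure_massLaw_item (y := y) hz
  set s := uniqueItems y with hs
  set C := ∫⁻ g, negExp (ENNReal.ofReal (totalTime z) * g univ) ∂μ with hC
  have hC0 : C ≠ 0 := h.lintegral_negExp_univ_ne_zero _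
  have hCt : C ≠ ∞ := h.lintegral_negExp_univ_ne_top _
  have hFs : Measurable fun p : Measure X × (s → ℝ) =>
      F (p.1 + ∑ x : s, ENNReal.ofReal (p.2 x) • Measure.dirac (x : X)) :=
    hF.comp (measurable_add_sum_dirac s)
  have hsing : ∀ᵐ g ∂μ, ∀ l i, g {y l i} = 0 :=
    ae_all_iff.2 fun l => ae_all_iff.2 fun i => h.ae_singleton_eq_zero (y l i)
  have hinner : ∀ w : s → ℝ, ∫⁻ g, timeDensity (g + atomSum s (Function.updateFinset 0 s w)) y z *
      F (g + atomSum s (Function.updateFinset 0 s w)) ∂μ =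
      (∏ x : s, negExp (ENNReal.ofReal (w x) * ENNReal.ofReal (itemTime y z x))) *
        (C * ∫⁻ g, F (g + ∑ x : s, ENNReal.ofReal (w x) • Measure.dirac (x : X))
          ∂PlackettLuce.tiltLaw μ (totalTime z)) := by
    intro w
    have hFw : Measurable fun g =>
        F (g + ∑ x : s, ENNReal.ofReal (w x) • Measure.dirac (x : X)) :=
      hFs.comp (by fun_prop : Measurable fun g : Measure X => (g, w))
    have hE : Measurable fun g : Measure X => negExp (ENNReal.ofReal (totalTime z) * g univ) *
        F (g + ∑ x : s, ENNReal.ofReal (w x) • Measure.dirac (x : X)) :=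
      (measurable_negExp_mul_univ _).mul hFw
    rw [lintegral_tiltLaw _ hFw, ← mul_assoc C, ENNReal.mul_inv_cancel hC0 hCt, one_mul,
      ← lintegral_const_mul _ hE]
    refine lintegral_congr_ae ?_
    filter_upwards [h.ae_lt_top, hsing] with g hg hg0
    rw [timeDensity_add_atomSum hg hg0 _ _ hz, atomSum_updateFinset, ← Finset.prod_coe_sort,
      mul_comm (negExp _), mul_assoc]
    congr 1
    exact Finset.prod_congr rfl fun x _ => by simp [Function.updateFinset]
  have hT : Measurable fun w : s → ℝ =>
      ∫⁻ g, F (g + ∑ x : s, ENNReal.ofReal (w x) • Measure.dirac (x : X))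
        ∂PlackettLuce.tiltLaw μ (totalTime z) := hFs.lintegral_prod_left'
  rw [atomLIntegral, toFinset_itemMultiset, ← hs]
  simp only [lmarginal, count_itemMultiset]
  simp_rw [hinner]
  rw [← h.1.lintegral_pi_massLaw hz (hT.const_mul C), lintegral_const_mul _ hT, posteriorLaw,
    lintegral_map hF (measurable_add_sum_dirac _), lintegral_prod_symm _ hFs.aemeasurable, evidence,
    mul_left_comm, ← mul_assoc]

end Posterior

/-! ### Measurability in the positions of the atoms -/

section Coincidences

variable {X ι : Type*} [Fintype ι]

open Classical in
/-- The pairs of indices at which a family takes the same value. -/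
def coincidences (y : ι → X) : Finset (ι × ι) := Finset.univ.filter fun r => y r.1 = y r.2

lemma mem_coincidences {y : ι → X} {r : ι × ι} : r ∈ coincidences y ↔ y r.1 = y r.2 := by
  simp [coincidences]

lemma coincidences_eq_iff {y y' : ι → X} (h : coincidences y = coincidences y') (p q : ι) :
    y p = y q ↔ y' p = y' q := by
  rw [← mem_coincidences (r := (p, q)), h, mem_coincidences]

end Coincidences

section AtomMeasurability

variable {X : Type*} [MeasurableSpace X] {lam : ℝ → ℝ≥0∞} {μ : Measure (Measure X)} {ι : Type*}

-- Atoms are indexed by representative positions in the list instead of by the items, so that the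
-- index set no longer changes when the items move.
open Classical in
lemma IsLevyIntensity.atomLIntegral_eq_of_bijOn (h : IsLevyIntensity lam) {M : Multiset X}
    {y : ι → X} {T : Finset ι} (hT : BijOn y T M.toFinset) {n : ι → ℕ}
    (hn : ∀ p ∈ T, M.count (y p) = n p) (F : Measure X → ℝ≥0∞) :
    atomLIntegral lam μ M F = ∫⁻ w : T → ℝ, ∫⁻ g,
      F (g + ∑ p : T, ENNReal.ofReal (w p) • Measure.dirac (y p)) ∂μ
        ∂(Measure.pi fun p : T => powJump lam (n p)) := by
  have hσ := h.sigmaFinite_powJump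
  let e : T ≃ M.toFinset := Equiv.ofBijective (fun p => ⟨y p, hT.mapsTo p.2⟩)
    ⟨fun p q hpq => Subtype.ext (hT.injOn p.2 q.2 (congrArg Subtype.val hpq)), fun x => by
      obtain ⟨p, hp, hpx⟩ := hT.surjOn x.2
      exact ⟨⟨p, hp⟩, Subtype.ext hpx⟩⟩
  have he : ∀ p : T, (e p : X) = y p := fun p => rfl
  have hν : (fun p : T => powJump lam (n p)) = fun p : T => powJump lam (M.count (e p : X)) :=
    funext fun p => by rw [he, hn p p.2]
  rw [atomLIntegral]
  simp only [lmarginal]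
  rw [hν, ← (measurePreserving_piCongrLeft (fun x : M.toFinset => powJump lam (M.count (x : X)))
    e).lintegral_comp_emb (MeasurableEquiv.measurableEmbedding _)]
  refine lintegral_congr fun w => lintegral_congr fun g => ?_
  rw [atomSum_updateFinset, ← e.sum_comp]
  congr 3
  ext1 p
  rw [he, MeasurableEquiv.coe_piCongrLeft, Equiv.piCongrLeft_apply_apply]

lemma measurable_add_sum_dirac_comp {β : Type*} [MeasurableSpace β] {y : β → ι → X}
    (hy : Measurable y) (T : Finset ι) :
    Measurable fun q : (β × (T → ℝ)) × Measure X =>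
      q.2 + ∑ p : T, ENNReal.ofReal (q.1.2 p) • Measure.dirac (y q.1.1 p) := by
  refine Measure.measurable_of_measurable_coe _ fun B hB => ?_
  simp only [Measure.add_apply, Measure.finsetSum_apply, Measure.smul_apply, smul_eq_mul]
  refine ((Measure.measurable_coe hB).comp measurable_snd).add
    (Finset.measurable_sum _ fun p _ => Measurable.mul (by fun_prop) ?_)
  have h1 : Measurable fun q : (β × (T → ℝ)) × Measure X => y q.1.1 p :=
    (measurable_pi_apply _).comp (hy.comp (measurable_fst.comp measurable_fst))
  exact (Measure.measurable_coe hB).comp (Measure.measurable_dirac.comp h1)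

variable [Fintype ι]

lemma measurableSet_coincidences_eq [MeasurableEq X] {β : Type*} [MeasurableSpace β]
    {y : β → ι → X} (hy : Measurable y) (E : Finset (ι × ι)) :
    MeasurableSet {b | coincidences (y b) = E} := by
  have h1 : {b | coincidences (y b) = E} = ⋂ r, {b | y b r.1 = y b r.2 ↔ r ∈ E} := by
    ext b
    simp only [Finset.ext_iff, mem_coincidences, mem_ofPred_eq, mem_iInter]
  rw [h1]
  refine MeasurableSet.iInter fun r => ?_
  have h2 : MeasurableSet {b | y b r.1 = y b r.2} :=
    measurableSet_eq_fun ((measurable_pi_apply _).comp hy) ((measurable_pi_apply _).comp hy)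
  by_cases hr : r ∈ E
  · simp only [hr, iff_true]
    exact h2
  · simp only [hr, iff_false]
    exact h2.compl

/-- The domain of integration depends on which entries coincide. There are finitely many coincidence
patterns, each a measurable event, and on each of them one fixed set of representative positions and
multiplicities serves. -/
lemma IsLevyIntensity.measurable_atomLIntegral [MeasurableEq X] (h : IsLevyIntensity lam)
    [SFinite μ] {β : Type*} [MeasurableSpace β] {y : β → ι → X} (hy : Measurable y)
    {F : Measure X × β → ℝ≥0∞} (hF : Measurable F) :
    Measurable fun b => atomLIntegral lam μ (itemMultiset (y b)) fun g => F (g, b) := by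
  classical
  have hσ := h.sigmaFinite_powJump
  have key : ∀ E : Finset (ι × ι), ∃ Ψ : β → ℝ≥0∞, Measurable Ψ ∧ ∀ b, coincidences (y b) = E →
      atomLIntegral lam μ (itemMultiset (y b)) (fun g => F (g, b)) = Ψ b := by
    intro E
    by_cases hE : ∃ b₀, coincidences (y b₀) = E
    swap
    · exact ⟨0, measurable_zero, fun b hb => absurd ⟨b, hb⟩ hE⟩
    obtain ⟨b₀, hb₀⟩ := hE
    -- One position is chosen for each distinct item of a reference list with pattern `E`; the
    -- choice is valid for every list with the same pattern.
    obtain ⟨T', -, hT'⟩ := (univ : Set ι).exists_subset_bijOn (y b₀)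
    obtain ⟨T, rfl⟩ := T'.toFinite.exists_finset_coe
    refine ⟨fun b => ∫⁻ w : T → ℝ, ∫⁻ g,
      F (g + ∑ p : T, ENNReal.ofReal (w p) • Measure.dirac (y b p), b) ∂μ
        ∂(Measure.pi fun p : T => powJump lam ((itemMultiset (y b₀)).count (y b₀ p))), ?_, ?_⟩
    · have h1 : Measurable fun q : (β × (T → ℝ)) × Measure X =>
          F (q.2 + ∑ p : T, ENNReal.ofReal (q.1.2 p) • Measure.dirac (y q.1.1 p), q.1.1) :=
        hF.comp ((measurable_add_sum_dirac_comp hy T).prodMk (by fun_prop))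
      exact h1.lintegral_prod_right'.lintegral_prod_right'
    · intro b hb
      have hbb := coincidences_eq_iff (hb.trans hb₀.symm)
      refine h.atomLIntegral_eq_of_bijOn (n := fun p => (itemMultiset (y b₀)).count (y b₀ p))
        ?_ ?_ _
      · refine ⟨fun p _ => by simp [itemMultiset], fun p hp q hq hpq =>
          hT'.injOn hp hq ((hbb p q).1 hpq), fun x hx => ?_⟩
        obtain ⟨q, rfl⟩ : ∃ q, y b q = x := by simpa [itemMultiset] using hx
        obtain ⟨p, hp, hpq⟩ := hT'.surjOn (mem_image_of_mem _ (mem_univ q))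
        exact ⟨p, hp, (hbb p q).2 hpq⟩
      · intro p _
        simp only [itemMultiset, Multiset.count_map, hbb]
  choose Ψ hΨ hΨeq using key
  have h1 : (fun b => atomLIntegral lam μ (itemMultiset (y b)) fun g => F (g, b)) =
      fun b => ∑ E : Finset (ι × ι), {b | coincidences (y b) = E}.indicator (Ψ E) b := by
    ext b
    rw [Finset.sum_eq_single (coincidences (y b)), indicator_of_mem (by rfl)]
    · exact hΨeq _ b rfl
    · intro E _ hE
      have hb : b ∉ {b | coincidences (y b) = E} := fun h => hE (Eq.symm h)
      exact indicator_of_notMem hb _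
    · exact fun h => absurd (Finset.mem_univ _) h
  rw [h1]
  exact Finset.measurable_sum _ fun E _ =>
    (hΨ E).indicator (measurableSet_coincidences_eq hy E)

end AtomMeasurability

/-! ### The conditional law -/

section AtomCongr

variable {X : Type*} [MeasurableSpace X] {lam : ℝ → ℝ≥0∞} {μ : Measure (Measure X)}

open Classical in
lemma atomLIntegral_congr {M : Multiset X} {F F' : Measure X → ℝ≥0∞}
    (h : ∀ᵐ g ∂μ, ∀ w, F (g + atomSum M.toFinset w) = F' (g + atomSum M.toFinset w)) :
    atomLIntegral lam μ M F = atomLIntegral lam μ M F' := by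
  rw [atomLIntegral, atomLIntegral]
  congr 1
  ext w
  exact lintegral_congr_ae (h.mono fun g hg => hg w)

lemma atomLIntegral_zero_fun (M : Multiset X) :
    atomLIntegral lam μ M (fun _ => 0) = 0 := by
  simp [atomLIntegral, lmarginal]

end AtomCongr

section Conclusion

lemma measurableSet_pos_times {X : Type*} [MeasurableSpace X] {L m : ℕ} : MeasurableSet
    {d : (Fin L → Fin m → X) × (Fin L → Fin m → ℝ) | ∀ l i, 0 < d.2 l i} := by
  have h1 : {d : (Fin L → Fin m → X) × (Fin L → Fin m → ℝ) | ∀ l i, 0 < d.2 l i} =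
      ⋂ l, ⋂ i, {d | 0 < d.2 l i} := by ext; simp
  rw [h1]
  exact MeasurableSet.iInter fun l => MeasurableSet.iInter fun i =>
    measurableSet_lt measurable_const (by fun_prop)
variable {X : Type*} [MeasurableSpace X] [MeasurableEq X] {lam : ℝ → ℝ≥0∞} {H : Measure X}
  [IsProbabilityMeasure H] [NullSingletonClass H] {μ : Measure (Measure X)} {L m : ℕ}

-- The listed items are null for `g`, so every remaining set keeps at least the mass `g(X)`, which
-- is almost surely nonzero. The cancellation is therefore legitimate; repeated items within a list
-- give density zero.
open Classical in
lemma IsCRMLaw.atomLIntegral_density_mul (h : IsCRMLaw lam H μ) (y : Fin L → Fin m → X)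
    {z : Fin L → Fin m → ℝ} (hz : ∀ l i, 0 < z l i) {F : Measure X → ℝ≥0∞} (hF : Measurable F) :
    atomLIntegral lam μ (itemMultiset fun p : Fin L × Fin m => y p.1 p.2)
      (fun g => plDensity g y * (arrivalDensity g y z * F g)) =
      if ∀ l, Function.Injective (y l) then
        evidence lam μ y z * ∫⁻ g, F g ∂posteriorLaw lam μ y z else 0 := by
  have hsing : ∀ᵐ g ∂μ, ∀ l i, g {y l i} = 0 :=
    ae_all_iff.2 fun l => ae_all_iff.2 fun i => h.ae_singleton_eq_zero (y l i)
  rw [← h.atomLIntegral_timeDensity_mul hz hF, ← atomLIntegral_zero_fun (lam := lam) (μ := μ)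
    (itemMultiset fun p : Fin L × Fin m => y p.1 p.2), ← apply_ite]
  refine atomLIntegral_congr ?_
  filter_upwards [h.ae_lt_top, h.ae_univ_ne_zero, hsing] with g hg hg0 hgy w
  rw [← mul_assoc, plDensity_mul_arrivalDensity _ hz]
  · split_ifs <;> simp
  · intro l i
    rw [finKernel_of_lt_top (add_atomSum_univ_lt_top hg _ w), add_atomSum_remaining y hgy]
    exact (pos_iff_ne_zero.2 hg0).trans_le le_self_add |>.ne'

open Classical in
/-- The posterior law as a kernel. -/
def posteriorKernel (h : IsCRMLaw lam H μ) (L m : ℕ) :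
    Kernel ((Fin L → Fin m → X) × (Fin L → Fin m → ℝ)) (Measure X) where
  -- Off the positive times any fixed probability measure would do: that set of data is null, and
  -- the kernel stays Markov.
  toFun d := if ∀ l i, 0 < d.2 l i then posteriorLaw lam μ d.1 d.2 else Measure.dirac 0
  measurable' := by
    have hμ := h.isProbabilityMeasure
    refine Measure.measurable_of_measurable_coe _ fun B hB => ?_
    let N : Set (Measure X) → (Fin L → Fin m → X) × (Fin L → Fin m → ℝ) → ℝ≥0∞ := fun B d =>
      atomLIntegral lam μ (itemMultiset fun p : Fin L × Fin m => d.1 p.1 p.2)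
        fun g => timeDensity g d.1 d.2 * B.indicator 1 g
    have hN : ∀ B, MeasurableSet B → Measurable (N B) := fun B hB =>
      h.1.measurable_atomLIntegral (y := fun (d : (Fin L → Fin m → X) × (Fin L → Fin m → ℝ))
        (p : Fin L × Fin m) => d.1 p.1 p.2) (by fun_prop)
        (F := fun q : Measure X × (Fin L → Fin m → X) × (Fin L → Fin m → ℝ) =>
          timeDensity q.1 q.2.1 q.2.2 * B.indicator 1 q.1)
        ((measurable_timeDensity L m).mul ((measurable_one.indicator hB).comp measurable_fst))
    -- The evidence cancels in the ratio, so posterior probabilities inherit measurability from the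
    -- unnormalised integrals.
    have h1 : (fun d : (Fin L → Fin m → X) × (Fin L → Fin m → ℝ) =>
        (if ∀ l i, 0 < d.2 l i then posteriorLaw lam μ d.1 d.2 else Measure.dirac 0) B) =
        fun d => if ∀ l i, 0 < d.2 l i then N B d / N univ d else Measure.dirac 0 B := by
      ext d
      split_ifs with hd
      · have hP := h.isProbabilityMeasure_posteriorLaw (y := d.1) hd
        simp only [N]
        rw [h.atomLIntegral_timeDensity_mul hd (measurable_one.indicator hB),
          h.atomLIntegral_timeDensity_mul hd (measurable_one.indicator MeasurableSet.univ),
          lintegral_indicator_one hB, lintegral_indicator_one MeasurableSet.univ, measure_univ,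
          mul_one, ENNReal.mul_div_right_comm, ENNReal.div_self h.evidence_ne_zero
          (h.evidence_ne_top hd), one_mul]
      · rfl
    rw [h1]
    exact Measurable.ite measurableSet_pos_times ((hN B hB).div (hN univ MeasurableSet.univ))
      measurable_const

lemma posteriorKernel_apply (h : IsCRMLaw lam H μ)
    {d : (Fin L → Fin m → X) × (Fin L → Fin m → ℝ)} (hd : ∀ l i, 0 < d.2 l i) :
    posteriorKernel h L m d = posteriorLaw lam μ d.1 d.2 := if_pos hd

instance isMarkovKernel_posteriorKernel (h : IsCRMLaw lam H μ) (L m : ℕ) :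
    IsMarkovKernel (posteriorKernel h L m) := ⟨fun d => by
  classical
  by_cases hd : ∀ l i, 0 < d.2 l i
  · rw [posteriorKernel_apply h hd]
    exact h.isProbabilityMeasure_posteriorLaw hd
  · have h1 : posteriorKernel h L m d = Measure.dirac 0 := if_neg hd
    rw [h1]
    infer_instance⟩

variable {Ω : Type*} [MeasurableSpace Ω] {P : Measure Ω} [IsProbabilityMeasure P]
  {G : Ω → Measure X} {Y : Ω → Fin L → Fin m → X} {Z : Ω → Fin L → Fin m → ℝ}

/-- The joint law of the completely random measure, the lists and the arrival times is a
functional of the integrals over the completely random measure with the observed items as fixed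
atoms. -/
lemma IsCRMLaw.exists_functional_joint (hGm : Measurable G) (hYm : Measurable Y)
    (hZm : Measurable Z) (hG : IsCRMLaw lam H (P.map G))
    (hY : HasCondLaw Y G P fun g ξ => ξ = Measure.pi fun _ : Fin L => plMeasure g m)
    (hZ : HasCondLaw Z (fun ω => (G ω, Y ω)) P fun b ξ =>
      ξ = Measure.pi fun l : Fin L => arrivalMeasure b.1 (b.2 l)) :
    ∃ b : ((Fin L → Fin m → X) → ℝ≥0∞) → ℝ≥0∞,
      ∀ F : (Measure X × (Fin L → Fin m → X)) × (Fin L → Fin m → ℝ) → ℝ≥0∞, Measurable F →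
        ∫⁻ ω, F ((G ω, Y ω), Z ω) ∂P = b fun y => ∫⁻ z, atomLIntegral lam (P.map G)
          (itemMultiset fun p : Fin L × Fin m => y p.1 p.2)
          (fun g => plDensity g y * (arrivalDensity g y z * F ((g, y), z)))
          ∂(Measure.pi fun _ : Fin L => Measure.pi fun _ : Fin m => (volume : Measure ℝ)) := by
  have hμ := hG.isProbabilityMeasure
  obtain ⟨b, hb⟩ := hG.exists_functional L m
  refine ⟨b, fun F hF => ?_⟩
  have hDF : Measurable fun q : (Measure X × (Fin L → Fin m → X)) × (Fin L → Fin m → ℝ) =>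
      plDensity q.1.1 q.1.2 * (arrivalDensity q.1.1 q.1.2 q.2 * F q) :=
    ((measurable_plDensity L m).comp measurable_fst).mul ((measurable_arrivalDensity L m).mul hF)
  have h1 := hb _ (hDF.lintegral_prod_right'
    (ν := Measure.pi fun _ : Fin L => Measure.pi fun _ : Fin m => (volume : Measure ℝ)))
  have h2 : ∀ y : Fin L → Fin m → X,
      Measurable fun q : Measure X × (Fin L → Fin m → ℝ) =>
        plDensity q.1 y * (arrivalDensity q.1 y q.2 * F ((q.1, y), q.2)) := fun y =>
    hDF.comp (by fun_prop : Measurable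
      fun q : Measure X × (Fin L → Fin m → ℝ) => ((q.1, y), q.2))
  have h3 := fun y : Fin L → Fin m → X => hG.1.atomLIntegral_lintegral_swap (μ := P.map G)
    (Measure.pi fun _ : Fin L => Measure.pi fun _ : Fin m => (volume : Measure ℝ))
    (itemMultiset fun p : Fin L × Fin m => y p.1 p.2) (h2 y)
  simp_rw [← h3]
  exact (lintegral_joint hGm hYm hZm hG.ae_lt_top hY hZ hF).trans h1

/-- The exponential density does not vanish at `0`, whereas the posterior needs positive times.
Almost every `z` is thus either entirely positive or has a negative entry, where the joint density
is zero. -/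
lemma ae_pi_pi_ne_zero : ∀ᵐ z ∂(Measure.pi fun _ : Fin L => Measure.pi fun _ : Fin m =>
    (volume : Measure ℝ)), ∀ l i, z l i ≠ 0 := by
  refine ae_all_iff.2 fun l => ae_all_iff.2 fun i => ?_
  have h0 : ∀ᵐ t : ℝ, t ≠ 0 := Measure.ae_ne volume 0
  have h1 : ∀ᵐ t ∂(Measure.pi fun _ : Fin m => (volume : Measure ℝ)), t i ≠ 0 :=
    (Measure.tendsto_eval_ae_ae (μ := fun _ : Fin m => (volume : Measure ℝ)) (i := i)).eventually h0
  exact (Measure.tendsto_eval_ae_ae (μ := fun _ : Fin L => Measure.pi fun _ : Fin m =>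
    (volume : Measure ℝ)) (i := l)).eventually h1

/-- Both sides of the disintegration identity are values of the same functional `b`, so it suffices
that their arguments agree for every `y`. No linearity or continuity of `b` is involved. -/
theorem IsCRMLaw.hasCondLaw_posteriorLaw (hGm : Measurable G) (hYm : Measurable Y)
    (hZm : Measurable Z) (hG : IsCRMLaw lam H (P.map G))
    (hY : HasCondLaw Y G P fun g ξ => ξ = Measure.pi fun _ : Fin L => plMeasure g m)
    (hZ : HasCondLaw Z (fun ω => (G ω, Y ω)) P fun b ξ =>
      ξ = Measure.pi fun l : Fin L => arrivalMeasure b.1 (b.2 l)) :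
    HasCondLaw G (fun ω => (Y ω, Z ω)) P fun d ξ => IsPosteriorLaw lam H d.1 d.2 ξ := by
  classical
  obtain ⟨b, hb⟩ := IsCRMLaw.exists_functional_joint hGm hYm hZm hG hY hZ
  have hYZ : Measurable fun ω => (Y ω, Z ω) := hYm.prodMk hZm
  set K := posteriorKernel hG L m with hK
  have hbad : ∀ (y : Fin L → Fin m → X) (z : Fin L → Fin m → ℝ) (F : Measure X → ℝ≥0∞),
      (∀ l i, z l i ≠ 0) → (¬ ∀ l i, 0 < z l i) →
      atomLIntegral lam (P.map G) (itemMultiset fun p : Fin L × Fin m => y p.1 p.2)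
        (fun g => plDensity g y * (arrivalDensity g y z * F g)) = 0 := by
    intro y z F hz0 hz
    push Not at hz
    obtain ⟨l, i, hli⟩ := hz
    simp_rw [arrivalDensity_of_neg _ y (lt_of_le_of_ne hli (hz0 l i)), zero_mul, mul_zero]
    exact atomLIntegral_zero_fun _
  have hpos : ∀ᵐ d ∂P.map (fun ω => (Y ω, Z ω)), ∀ l i, 0 < d.2 l i := by
    have hF : Measurable fun q : (Measure X × (Fin L → Fin m → X)) × (Fin L → Fin m → ℝ) =>
        {d : (Fin L → Fin m → X) × (Fin L → Fin m → ℝ) | ∀ l i, 0 < d.2 l i}ᶜ.indicator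
          (fun _ => (1 : ℝ≥0∞)) (q.1.2, q.2) :=
      (measurable_const.indicator measurableSet_pos_times.compl).comp (by fun_prop : Measurable
        fun q : (Measure X × (Fin L → Fin m → X)) × (Fin L → Fin m → ℝ) => (q.1.2, q.2))
    have h1 := hb _ hF
    -- The value of `b` at the zero function is found to be `0` by testing with a zero integrand.
    have h2 := hb (fun _ => 0) measurable_const
    simp only [mul_zero, atomLIntegral_zero_fun, lintegral_zero] at h2
    rw [ae_iff]
    change (P.map fun ω => (Y ω, Z ω)) {d : (Fin L → Fin m → X) × (Fin L → Fin m → ℝ) |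
      ∀ l i, 0 < d.2 l i}ᶜ = 0
    rw [← lintegral_indicator_one measurableSet_pos_times.compl,
      lintegral_map (measurable_one.indicator measurableSet_pos_times.compl) hYZ]
    refine h1.trans (Eq.trans ?_ h2.symm)
    congr 1
    ext y
    rw [lintegral_eq_zero_of_ae_eq_zero]
    filter_upwards [ae_pi_pi_ne_zero] with z hz0
    by_cases hz : ∀ l i, 0 < z l i
    · have h3 : ((y, z) : (Fin L → Fin m → X) × (Fin L → Fin m → ℝ)) ∉
        {d : (Fin L → Fin m → X) × (Fin L → Fin m → ℝ) | ∀ l i, 0 < d.2 l i}ᶜ := fun h => h hz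
      simp only [indicator_of_notMem h3, mul_zero]
      exact atomLIntegral_zero_fun _
    · exact hbad y z _ hz0 hz
  refine ⟨K, inferInstance, ?_, ?_⟩
  · refine ⟨(hYZ.prodMk hGm).aemeasurable, ?_⟩
    have hPYZ : IsProbabilityMeasure (P.map fun ω => (Y ω, Z ω)) :=
      Measure.isProbabilityMeasure_map hYZ.aemeasurable
    refine Measure.ext fun S hS => ?_
    have hS1 : Measurable fun q : (Measure X × (Fin L → Fin m → X)) × (Fin L → Fin m → ℝ) =>
        S.indicator (fun _ => (1 : ℝ≥0∞)) ((q.1.2, q.2), q.1.1) :=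
      (measurable_const.indicator hS).comp (by fun_prop : Measurable
        fun q : (Measure X × (Fin L → Fin m → X)) × (Fin L → Fin m → ℝ) => ((q.1.2, q.2), q.1.1))
    have hKS := Kernel.measurable_kernel_prodMk_left (κ := K) hS
    have hS2 : Measurable fun q : (Measure X × (Fin L → Fin m → X)) × (Fin L → Fin m → ℝ) =>
        K (q.1.2, q.2) (Prod.mk (q.1.2, q.2) ⁻¹' S) :=
      hKS.comp (by fun_prop : Measurable
        fun q : (Measure X × (Fin L → Fin m → X)) × (Fin L → Fin m → ℝ) => (q.1.2, q.2))
    rw [Measure.compProd_apply hS, lintegral_map hKS hYZ, ← lintegral_indicator_one hS,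
      lintegral_map (measurable_one.indicator hS) (hYZ.prodMk hGm)]
    refine (hb _ hS1).trans (Eq.trans ?_ (hb _ hS2).symm)
    congr 1
    ext y
    refine lintegral_congr_ae ?_
    filter_upwards [ae_pi_pi_ne_zero] with z hz0
    by_cases hz : ∀ l i, 0 < z l i
    · have hSm : MeasurableSet (Prod.mk (y, z) ⁻¹' S) := measurable_prodMk_left hS
      have hP := hG.isProbabilityMeasure_posteriorLaw (y := y) hz
      have h3 : (fun g => S.indicator (fun _ => (1 : ℝ≥0∞)) ((y, z), g)) =
          (Prod.mk (y, z) ⁻¹' S).indicator 1 := rfl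
      -- The second integrand does not depend on `g`, so the posterior integrates it to the kernel's
      -- value; both sides become the evidence times the posterior probability of the section of
      -- `S`.
      rw [hG.atomLIntegral_density_mul y hz (F := fun g => S.indicator (fun _ => 1) ((y, z), g))
          (measurable_one.indicator hSm),
        hG.atomLIntegral_density_mul y hz measurable_const, lintegral_const, measure_univ, mul_one,
        hK, posteriorKernel_apply hG (d := (y, z)) hz, h3, lintegral_indicator_one hSm]
    · rw [hbad y z _ hz0 hz, hbad y z _ hz0 hz]
  · filter_upwards [hpos] with d hd
    rw [hK, posteriorKernel_apply hG hd]
    exact hG.isPosteriorLaw_posteriorLaw hd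

end Conclusion

end

end PlackettLuce

theorem mainTheorem3 {X Ω : Type*} [MeasurableSpace X] [MeasurableEq X] [MeasurableSpace Ω]
    (P : Measure Ω) [IsProbabilityMeasure P]
    (H : Measure X) [IsProbabilityMeasure H] [NullSingletonClass H]
    (lam : ℝ → ℝ≥0∞) (L m : ℕ)
    (G : Ω → Measure X) (Y : Ω → Fin L → Fin m → X) (Z : Ω → Fin L → Fin m → ℝ)
    (hGm : Measurable G) (hYm : Measurable Y) (hZm : Measurable Z)
    -- the prior on `G` is `CRM(λ, H)`
    (hG : PlackettLuce.IsCRMLaw lam H (P.map G))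
    -- given `G`, the lists are independent Plackett-Luce lists
    (hY : PlackettLuce.HasCondLaw Y G P fun g R =>
      R = Measure.pi fun _ : Fin L => PlackettLuce.plMeasure g m)
    -- given `G` and the lists, the inter-arrival times are independent exponentials
    (hZ : PlackettLuce.HasCondLaw Z (fun ω => (G ω, Y ω)) P fun b R =>
      R = Measure.pi fun l : Fin L => PlackettLuce.arrivalMeasure b.1 (b.2 l)) :
    PlackettLuce.HasCondLaw G (fun ω => (Y ω, Z ω)) P fun d R =>
      PlackettLuce.IsPosteriorLaw lam H d.1 d.2 R := by
  exact PlackettLuce.IsCRMLaw.hasCondLaw_posteriorLaw hGm hYm hZm hG hY hZ
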